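/- **Setting.** Let $m>0$ and identify $\mathbb C^4\cong\mathbb R^8$ through $\mathcal R\psi=(\Re\psi_1,\dots,\Re\psi_4,\Im\psi_1,\dots,\Im\psi_4)$, with components $\mathcal R^j\psi$, $j=1,\dots,8$. Let $\mathcal H=L^2_{loc}(\mathbb R^3,\mathbb C^4)$ with the seminorms $\|\psi\|_{L^2(|x|<R)}$, $R>0$, and let $\langle\psi,\phi\rangle=\sum_j\int\mathcal R^j\psi\,\mathcal R^j\phi\,dx$. Let $\psi_0$ be a measurable random function with values in $\mathcal H$, i.e. $(\omega,x)\mapsto\psi_0(\omega,x)$ is measurable for the completed product $\sigma$-algebra and almost surely $\psi_0(\omega,\cdot)\in\mathcal H$; let $\mu_0$ be its law. Let $\psi(t)=U(t)\psi_0$, $t\in\mathbb R$, be the random solution: a measurable random function with values in $\mathcal H$ for each $t$, whose sample paths almost surely are the solution in $C(\mathbb R,\mathcal H)$, in the sense of distributions, of the Dirac equation $$\dot\psi=\bigl[-\alpha\cdot\nabla-i\beta m\bigr]\psi,\qquad \psi|_{t=0}=\psi_0,$$ where $\beta=\begin{pmatrix}I&0\\0&-I\end{pmatrix}$, $\alpha_k=\begin{pmatrix}0&\sigma_k\\\sigma_k&0\end{pmatrix}$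 and $\sigma_k$ are the Pauli matrices. Let $\mu_t$ be the law of $\psi(t)$. Assume: * **S0.** $E\psi_0(x)=0$ for almost all $x$. * **S1.** There is a matrix function $q_0=(q_0^{ij})_{i,j=1}^8$ on $\mathbb R^3$ with $E\bigl(\mathcal R^i\psi_0(x)\mathcal R^j\psi_0(y)\bigr)=q_0^{ij}(x-y)$ for almost all $x,y$ (the expectations being finite). * **S2.** $E|\psi_0(x)|^2=e_0<\infty$ for almost all $x$, with a constant $e_0$. * **S3.** The mixing coefficient $$\varphi(r)=\sup_{\mathcal A,\mathcal B}\ \sup_{A\in\sigma(\mathcal A),\,B\in\sigma(\mathcal B),\,\mu_0(B)>0}\frac{|\mu_0(A\cap B)-\mu_0(A)\mu_0(B)|}{\mu_0(B)},$$ where $\mathcal A,\mathcal B$ run over the open bounded sets in $\mathbb R^3$ at distance at least $r$ and $\sigma(\mathcal A)$ is generated by the functionals $\psi\mapsto\langle\psi,\phi\rangle$ with $\phi\in C_0^\infty(\mathbb R^3,\mathbb C^4)$, $\operatorname{supp}\phi\subset\mathcal A$, satisfies $\varphi(r)\to0$ as $r\to\infty$ and $\int_0^\infty r^2\varphi^{1/2}(r)\,dr<\infty$.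 Put $$\Lambda_1=\begin{pmatrix}\alpha_1&0\\0&\alpha_1\end{pmatrix},\quad \Lambda_2=\begin{pmatrix}0&i\alpha_2\\-i\alpha_2&0\end{pmatrix},\quad \Lambda_3=\begin{pmatrix}\alpha_3&0\\0&\alpha_3\end{pmatrix},\quad \Lambda_0=\begin{pmatrix}0&-\beta\\\beta&0\end{pmatrix},$$ $P(\xi)=\sum_{j=1}^3\xi_j\Lambda_j+m\Lambda_0$ for $\xi\in\mathbb C^3$, $\hat q(k)=\int e^{ik\cdot z}q(z)\,dz$, and $$\hat q_\infty(k)=\tfrac12\hat q_0(k)+\tfrac12\,\frac{1}{|k|^2+m^2}\,P(-ik)\,\hat q_0(k)\,P^T(ik),\qquad q_\infty(z)=(2\pi)^{-3}\int e^{-ik\cdot z}\hat q_\infty(k)\,dk .$$ **Proposition 4.1.** The functions $q_0^{ij}$, $\hat q_0^{ij}$ and $\hat q_\infty^{ij}$ are integrable on $\mathbb R^3$ (so that $\hat q_0$ and $q_\infty$ are well defined by the integrals). For every $t\in\mathbb R$ the correlation functions of $\mu_t$ are finite and translation invariant: there are continuous real functions $q_t^{ij}$ on $\mathbb R^3$ with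 $$E\bigl(\mathcal R^i\psi(x,t)\,\mathcal R^j\psi(y,t)\bigr)=q_t^{ij}(x-y)\quad\text{for almost all }x,y\in\mathbb R^3,$$ and, for all $i,j=1,\dots,8$ and every $z\in\mathbb R^3$, $$q_t^{ij}(z)\to q_\infty^{ij}(z),\qquad t\to\infty .$$ -/

import Mathlib

open MeasureTheory Filter Topology

noncomputable section

namespace DiracField

/-- Physical (or momentum) space `ℝ³` with the Euclidean norm. -/
abbrev E3 : Type := EuclideanSpace ℝ (Fin 3)

/-- The four spinor indices, in two blocks of two. -/
abbrev SpinIdx : Type := Fin 2 ⊕ Fin 2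

/-- The space `ℂ⁴` of spinors with the Hermitian norm. -/
abbrev C4 : Type := EuclideanSpace ℂ SpinIdx

/-- The eight real indices: four real parts, then four imaginary parts. -/
abbrev RealIdx : Type := SpinIdx ⊕ SpinIdx

/-- The `j`-th component of `ℛ v = (Re v, Im v) ∈ ℝ⁸`, for `v ∈ ℂ⁴`. -/
def realComp (j : RealIdx) (v : C4) : ℝ :=
  match j with
  | Sum.inl s => (v s).re
  | Sum.inr s => (v s).im

/-! ### Dirac matrices -/

/-- The Pauli matrices. -/
def pauli : Fin 3 → Matrix (Fin 2) (Fin 2) ℂ :=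
  ![!![0, 1; 1, 0], !![0, -Complex.I; Complex.I, 0], !![1, 0; 0, -1]]

/-- The Dirac matrices `α₁, α₂, α₃`. -/
def alpha (k : Fin 3) : Matrix SpinIdx SpinIdx ℂ :=
  Matrix.fromBlocks 0 (pauli k) (pauli k) 0

/-- The Dirac matrix `β`. -/
def beta : Matrix SpinIdx SpinIdx ℂ := Matrix.fromBlocks 1 0 0 (-1)

/-- The `8 × 8` matrices `Λ₁, Λ₂, Λ₃` (all their entries are real); `Λₖ` is the action of `αₖ`
on `ℝ⁸ ≅ ℂ⁴`. -/
def Lam : Fin 3 → Matrix RealIdx RealIdx ℂ :=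
  ![Matrix.fromBlocks (alpha 0) 0 0 (alpha 0),
    Matrix.fromBlocks 0 (Complex.I • alpha 1) (-(Complex.I • alpha 1)) 0,
    Matrix.fromBlocks (alpha 2) 0 0 (alpha 2)]

/-- The `8 × 8` matrix `Λ₀`, which is the action of `iβ` on `ℝ⁸ ≅ ℂ⁴`. -/
def Lam0 : Matrix RealIdx RealIdx ℂ := Matrix.fromBlocks 0 (-beta) beta 0

/-- The symbol `P(ξ) = ξ · Λ + m Λ₀`, for `ξ ∈ ℂ³`. -/
def diracSymbol (m : ℝ) (ξ : Fin 3 → ℂ) : Matrix RealIdx RealIdx ℂ :=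
  ∑ j, ξ j • Lam j + (m : ℂ) • Lam0

/-! ### Test functions and the phase space `ℋ = L²_loc(ℝ³, ℂ⁴)` -/

/-- `φ` is a test function: `φ ∈ C₀^∞(ℝ³, ℂ⁴)`. -/
def IsTest (φ : E3 → C4) : Prop :=
  ContDiff ℝ ((⊤ : ℕ∞) : WithTop ℕ∞) φ ∧ HasCompactSupport φ

/-- The real pairing `⟨ψ, φ⟩ = ∑ⱼ ∫ ℛʲψ(x) ℛʲφ(x) dx`. -/
def pairing (ψ φ : E3 → C4) : ℝ :=
  ∑ j, ∫ x, realComp j (ψ x) * realComp j (φ x)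

/-- `ψ` belongs to `ℋ = L²_loc(ℝ³, ℂ⁴)`. -/
def MemH (ψ : E3 → C4) : Prop :=
  ∀ R : ℝ, MemLp ψ 2 (volume.restrict (Metric.ball 0 R))

/-- The formal adjoint `φ ↦ α · ∇φ + i β m φ` (for the real pairing) of the Dirac generator
`-α · ∇ - i β m`. -/
def adjointGenerator (m : ℝ) (φ : E3 → C4) (x : E3) : C4 :=
  (∑ k, (alpha k).toEuclideanLin (fderiv ℝ φ x (EuclideanSpace.single k 1)))
    + (Complex.I * (m : ℂ)) • beta.toEuclideanLin (φ x)

/-- `ψ ∈ C(ℝ, ℋ)` is the solution of the Cauchy problem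
`∂ₜψ = (-α · ∇ - i β m) ψ`, `ψ|ₜ₌₀ = ψ₀`, the equation being understood in the sense of
distributions, that is, `d/dt ⟨ψ(t), φ⟩ = ⟨ψ(t), α · ∇φ + i β m φ⟩` for all test functions `φ`. -/
structure IsSolution (m : ℝ) (ψ₀ : E3 → C4) (ψ : ℝ → E3 → C4) : Prop where
  memH : ∀ t, MemH (ψ t)
  continuous_H : ∀ (R t₀ : ℝ),
    Tendsto (fun t => eLpNorm (ψ t - ψ t₀) 2 (volume.restrict (Metric.ball 0 R)))
      (𝓝 t₀) (𝓝 0)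
  equation : ∀ φ : E3 → C4, IsTest φ → ∀ t : ℝ,
    HasDerivAt (fun s => pairing (ψ s) φ) (pairing (ψ t) (adjointGenerator m φ)) t
  initial : ψ 0 =ᵐ[volume] ψ₀

/-! ### Random functions, correlation functions, mixing -/

variable {Ω : Type*} [MeasurableSpace Ω]

/-- A measurable random function with values in `ℋ`: measurable in `(ω, x)` with respect to the
completed product `σ`-algebra, and almost surely in `L²_loc`. -/
structure IsRandomFunction (P : Measure Ω) (X : Ω → E3 → C4) : Prop where
  measurable : AEMeasurable (fun p : Ω × E3 => X p.1 p.2) (P.prod volume)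
  memH : ∀ᵐ ω ∂P, MemH (X ω)

/-- The random solution `ψ(t) = U(t) ψ₀`: a family of random functions whose sample paths are
almost surely solutions of the Dirac equation with initial value `ψ₀`. -/
structure IsRandomSolution (P : Measure Ω) (m : ℝ) (ψ₀ : Ω → E3 → C4)
    (ψ : ℝ → Ω → E3 → C4) : Prop where
  random : ∀ t, IsRandomFunction P (ψ t)
  solution : ∀ᵐ ω ∂P, IsSolution m (ψ₀ ω) (fun t => ψ t ω)

/-- The correlation functions of (the law of) `X` are finite, translation invariant and given by
`q`: `E (ℛⁱX(x) ℛʲX(y)) = qⁱʲ(x - y)` for almost all `x, y`. -/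
def HasCorrelation (P : Measure Ω) (X : Ω → E3 → C4) (q : E3 → Matrix RealIdx RealIdx ℝ) :
    Prop :=
  ∀ i j, ∀ᵐ p : E3 × E3,
    Integrable (fun ω => realComp i (X ω p.1) * realComp j (X ω p.2)) P ∧
      ∫ ω, realComp i (X ω p.1) * realComp j (X ω p.2) ∂P = q (p.1 - p.2) i j

/-- Zero expectation: `E X(x) = 0` for almost all `x`. -/
def HasZeroMean (P : Measure Ω) (X : Ω → E3 → C4) : Prop :=
  ∀ᵐ x : E3, Integrable (fun ω => X ω x) P ∧ ∫ ω, X ω x ∂P = 0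

/-- Finite mean charge density: `E |X(x)|² = e₀ < ∞` for almost all `x`. -/
def HasFiniteDensity (P : Measure Ω) (X : Ω → E3 → C4) : Prop :=
  ∃ e₀ : NNReal, ∀ᵐ x : E3, ∫⁻ ω, ‖X ω x‖ₑ ^ 2 ∂P = e₀

/-- The `σ`-algebra `σ(𝒜)` generated by the linear functionals `⟨X, φ⟩` with test functions `φ`
supported in `𝒜`, pulled back to the probability space by `X`. -/
abbrev sigmaOf (X : Ω → E3 → C4) (𝒜 : Set E3) : MeasurableSpace Ω :=
  ⨆ (φ : E3 → C4) (_ : IsTest φ ∧ tsupport φ ⊆ 𝒜),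
    MeasurableSpace.comap (fun ω => pairing (X ω) φ) (borel ℝ)

/-- The Ibragimov–Linnik mixing coefficient `φ(r)` of (the law of) `X`: the supremum of
`|P(A ∩ B) - P(A) P(B)| / P(B)` over the open bounded sets `𝒜, ℬ` at distance at least `r`
and the events `A ∈ σ(𝒜)`, `B ∈ σ(ℬ)` with `P(B) > 0`. -/
def mixingCoeff (P : Measure Ω) (X : Ω → E3 → C4) (r : ℝ) : ENNReal :=
  ⨆ (𝒜 : Set E3) (ℬ : Set E3)
    (_ : IsOpen 𝒜 ∧ Bornology.IsBounded 𝒜 ∧ IsOpen ℬ ∧ Bornology.IsBounded ℬ ∧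
      ∀ x ∈ 𝒜, ∀ y ∈ ℬ, r ≤ dist x y)
    (A : Set Ω) (B : Set Ω)
    (_ : MeasurableSet[sigmaOf X 𝒜] A ∧ MeasurableSet[sigmaOf X ℬ] B ∧ 0 < P B),
    ENNReal.ofReal (|P.real (A ∩ B) - P.real A * P.real B| / P.real B)

/-- The strong uniform mixing condition with its rate: `φ(r) → 0` as `r → ∞` and
`∫₀^∞ r² φ^{1/2}(r) dr < ∞`. -/
def IsStronglyMixing (P : Measure Ω) (X : Ω → E3 → C4) : Prop :=
  Tendsto (mixingCoeff P X) atTop (𝓝 0) ∧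
    ∫⁻ r in Set.Ioi (0 : ℝ), ENNReal.ofReal (r ^ 2) * mixingCoeff P X r ^ (1 / 2 : ℝ) < ⊤

/-! ### The limit correlation function -/

/-- The Fourier transform `q̂(k) = ∫ e^{i k · z} q(z) dz`, entry by entry. -/
def fourierMat (q : E3 → Matrix RealIdx RealIdx ℝ) (k : E3) : Matrix RealIdx RealIdx ℂ :=
  Matrix.of fun i j =>
    ∫ z : E3, Complex.exp (Complex.I * ((inner ℝ k z : ℝ) : ℂ)) * ((q z i j : ℝ) : ℂ)

/-- The inverse Fourier transform `(2π)⁻³ ∫ e^{-i k · z} f(k) dk`, entry by entry. -/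
def fourierInvMat (f : E3 → Matrix RealIdx RealIdx ℂ) (z : E3) : Matrix RealIdx RealIdx ℂ :=
  Matrix.of fun i j =>
    ((((2 * Real.pi) ^ 3)⁻¹ : ℝ) : ℂ) *
      ∫ k : E3, Complex.exp (-(Complex.I * ((inner ℝ k z : ℝ) : ℂ))) * f k i j

/-- `q̂_∞(k) = ½ q̂₀(k) + ½ (k² + m²)⁻¹ P(-ik) q̂₀(k) Pᵀ(ik)`. -/
def limitSpectrum (m : ℝ) (q₀ : E3 → Matrix RealIdx RealIdx ℝ) (k : E3) :
    Matrix RealIdx RealIdx ℂ :=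
  (1 / 2 : ℂ) • fourierMat q₀ k +
    ((1 / 2 : ℂ) * (((‖k‖ ^ 2 + m ^ 2)⁻¹ : ℝ) : ℂ)) •
      (diracSymbol m (fun j => -(Complex.I * ((k j : ℝ) : ℂ))) * fourierMat q₀ k *
        (diracSymbol m (fun j => Complex.I * ((k j : ℝ) : ℂ))).transpose)

/-- The limit correlation function `q_∞`. -/
def limitCorrelation (m : ℝ) (q₀ : E3 → Matrix RealIdx RealIdx ℝ) :
    E3 → Matrix RealIdx RealIdx ℂ :=
  fourierInvMat (limitSpectrum m q₀)

end DiracField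

end

noncomputable section

namespace DiracField

open scoped FourierTransform ComplexConjugate

/-! ### Algebra of the Dirac matrices in real coordinates -/

/-! The generator is skew-adjoint for the real pairing and its symbol satisfies `P(2πiξ)² = -ω(ξ)²`
with `ω² = 4π²|ξ|² + m²` (`sym_mul_self`). The adjoint evolution of a test field is therefore the
explicit Fourier multiplier `cos ωt + ω⁻¹ sin ωt · P`. If `Q` is the spectral density of the initial
field and `J = ω⁻¹P`, then at time `t` it becomes `(cos ωt - sin ωt J) Q (cos ωt + sin ωt J)`. By
the double angle formulas (`evolvedSpec_eq`) this is `½(Q - JQJ)` plus terms oscillating like `cos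
2ωt` and `sin 2ωt`. The constant term is the limit spectrum after `ξ = -k/2π`. The oscillating terms
disappear by a Riemann–Lebesgue lemma with phase `ω` (`tendsto_integral_freq`), provided `Q` is
integrable.

Integrability of `Q` has two sources. Uniform mixing and zero mean give `|q₀(z)| ≤ 2 e₀
φ(|z|/2)^{1/2}` (`cov_sq_le_of_mixing`, `abs_le_mixing`), and this bound is integrable on `ℝ³`
because `r² φ^{1/2}(r)` is integrable on the half-line. So `Q` is continuous and bounded. Being the
spectrum of a random field it is moreover of positive type (`norm_spec_le`). A bounded integrable
function with nonnegative Fourier transform has an integrable transform (`integrable_spec_diag`),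
and the diagonal entries dominate the others.

Sample paths are only weak solutions in `L²_loc`, so the formula at time `t` comes from duality:
`⟨ψ(t), φ⟩ = ⟨ψ₀, φ_t⟩`, where `φ_t` is the adjoint evolution of `φ` (`pairingR_eq_of_isSolution`).
Here `φ_t` has to be an admissible test field, hence compactly supported. That is finite speed of
propagation, obtained from an energy estimate on cones (`eq_zero_of_symmetric_hyperbolic`). Duality
determines the correlations of smeared fields only. To reach almost every pair of points, local
second moments of `ψ(t)` are derived by mollification and Fatou (`lintegral_sq_ball_lt_top`), and a
locally integrable kernel is recovered from its integrals against products of test functions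
(`ae_eq_zero_of_integral_mul_mul`). -/

lemma Lam_im (k : Fin 3) (i j : RealIdx) : (Lam k i j).im = 0 := by
  fin_cases k <;> rcases i with (i | i) | (i | i) <;> rcases j with (j | j) | (j | j) <;>
    fin_cases i <;> fin_cases j <;> simp [Lam, alpha, pauli, Matrix.fromBlocks]

lemma Lam0_im (i j : RealIdx) : (Lam0 i j).im = 0 := by
  rcases i with (i | i) | (i | i) <;> rcases j with (j | j) | (j | j) <;>
    simp [Lam0, beta, Matrix.fromBlocks, Matrix.one_apply] <;> split_ifs <;> simp

lemma Lam_symm (k : Fin 3) (i j : RealIdx) : Lam k i j = Lam k j i := by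
  fin_cases k <;> rcases i with (i | i) | (i | i) <;> rcases j with (j | j) | (j | j) <;>
    fin_cases i <;> fin_cases j <;> simp [Lam, alpha, pauli, Matrix.fromBlocks]

lemma Lam0_antisymm (i j : RealIdx) : Lam0 i j = -Lam0 j i := by
  rcases i with (i | i) | (i | i) <;> rcases j with (j | j) | (j | j) <;>
    simp [Lam0, beta, Matrix.fromBlocks, Matrix.one_apply, eq_comm]

/-- The entries of `Lam k`, as real numbers. -/
def LamR (k : Fin 3) (i j : RealIdx) : ℝ := (Lam k i j).re

/-- The entries of `Lam0`, as real numbers. -/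
def Lam0R (i j : RealIdx) : ℝ := (Lam0 i j).re

lemma ofReal_LamR (k : Fin 3) (i j : RealIdx) : ((LamR k i j : ℝ) : ℂ) = Lam k i j :=
  Complex.ext rfl (by simp [Lam_im])

lemma ofReal_Lam0R (i j : RealIdx) : ((Lam0R i j : ℝ) : ℂ) = Lam0 i j :=
  Complex.ext rfl (by simp [Lam0_im])

lemma LamR_symm (k : Fin 3) (i j : RealIdx) : LamR k i j = LamR k j i := by
  rw [LamR, Lam_symm, LamR]

lemma Lam0R_antisymm (i j : RealIdx) : Lam0R i j = -Lam0R j i := by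
  rw [Lam0R, Lam0_antisymm, Lam0R, Complex.neg_re]

lemma diracSymbol_apply (m : ℝ) (ξ : Fin 3 → ℂ) (i j : RealIdx) :
    diracSymbol m ξ i j = ∑ k, ξ k * Lam k i j + m * Lam0 i j := by
  simp [diracSymbol, Matrix.add_apply, Matrix.sum_apply]

/-- The `Λₖ` are symmetric and `Λ₀` is antisymmetric, so transposition flips the mass term alone.
This is the source of the minus sign in `½(Q - JQJ)`. -/
lemma diracSymbol_transpose (m : ℝ) (ξ : Fin 3 → ℂ) :
    (diracSymbol m ξ).transpose = -diracSymbol m (-ξ) := by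
  ext i j
  simp only [Matrix.transpose_apply, Matrix.neg_apply, diracSymbol_apply]
  rw [Lam0_antisymm]
  simp [Lam_symm _ j i, add_comm]

/-- The shape `[[A, B], [-B, A]]` reduces the square to the `4 × 4` expressions `A² - B²` and `AB +
BA`, which can be checked entry by entry. -/
lemma diracSymbol_eq_fromBlocks (m : ℝ) (ξ : Fin 3 → ℂ) :
    diracSymbol m ξ = Matrix.fromBlocks (ξ 0 • alpha 0 + ξ 2 • alpha 2)
      ((ξ 1 * Complex.I) • alpha 1 - (m : ℂ) • beta)
      (-((ξ 1 * Complex.I) • alpha 1 - (m : ℂ) • beta)) (ξ 0 • alpha 0 + ξ 2 • alpha 2) := by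
  simp [diracSymbol, Fin.sum_univ_three, Lam, Lam0, Matrix.fromBlocks_smul, Matrix.fromBlocks_add,
    mul_smul, sub_eq_add_neg, add_comm]

lemma diracSymbol_block_anticomm (m : ℝ) (ξ : Fin 3 → ℂ) :
    (ξ 0 • alpha 0 + ξ 2 • alpha 2) * ((ξ 1 * Complex.I) • alpha 1 - (m : ℂ) • beta)
      + ((ξ 1 * Complex.I) • alpha 1 - (m : ℂ) • beta) * (ξ 0 • alpha 0 + ξ 2 • alpha 2) = 0 := by
  have h2 : Complex.I * Complex.I = -1 := Complex.I_mul_I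
  ext (i | i) (j | j) <;> fin_cases i <;> fin_cases j <;>
    simp [Matrix.mul_apply, alpha, pauli, beta, Matrix.one_apply] <;> ring_nf

lemma diracSymbol_block_sq (m : ℝ) (ξ : Fin 3 → ℂ) :
    (ξ 0 • alpha 0 + ξ 2 • alpha 2) * (ξ 0 • alpha 0 + ξ 2 • alpha 2)
      - ((ξ 1 * Complex.I) • alpha 1 - (m : ℂ) • beta)
        * ((ξ 1 * Complex.I) • alpha 1 - (m : ℂ) • beta)
      = (∑ k, ξ k ^ 2 - (m : ℂ) ^ 2) • (1 : Matrix _ _ ℂ) := by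
  ext (i | i) (j | j) <;> fin_cases i <;> fin_cases j <;>
    simp [Matrix.mul_apply, alpha, pauli, beta, Matrix.one_apply, Fin.sum_univ_three] <;>
    ring_nf <;> simp

/-- The Clifford relations of the Dirac matrices in real coordinates; at `2πiξ` with real `ξ` the
scalar is `-ω(ξ)²`. -/
lemma diracSymbol_mul_self (m : ℝ) (ξ : Fin 3 → ℂ) :
    diracSymbol m ξ * diracSymbol m ξ = (∑ k, ξ k ^ 2 - (m : ℂ) ^ 2) • (1 : Matrix _ _ ℂ) := by
  rw [diracSymbol_eq_fromBlocks, Matrix.fromBlocks_multiply, ← Matrix.fromBlocks_one,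
    Matrix.fromBlocks_smul, ← diracSymbol_block_sq m ξ]
  have h := diracSymbol_block_anticomm m ξ
  simp only [Matrix.mul_neg, Matrix.neg_mul]
  congr 1
  · rw [h, smul_zero]
  · rw [smul_zero, ← neg_add, add_comm, h, neg_zero]
  · exact neg_add_eq_sub _ _

lemma realComp_mulVec_alpha (k : Fin 3) (v : C4) (i : RealIdx) :
    realComp i ((alpha k).toEuclideanLin v) = ∑ j, LamR k i j * realComp j v := by
  fin_cases k <;> rcases i with (i | i) | (i | i) <;> fin_cases i <;>
    simp [realComp, LamR, Lam, alpha, pauli, Matrix.fromBlocks, Matrix.toLpLin_apply,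
      Matrix.mulVec, dotProduct]

lemma realComp_I_smul_beta (m : ℝ) (v : C4) (i : RealIdx) :
    realComp i ((Complex.I * (m : ℂ)) • beta.toEuclideanLin v)
      = m * ∑ j, Lam0R i j * realComp j v := by
  rcases i with (i | i) | (i | i) <;> fin_cases i <;>
    simp [realComp, Lam0R, Lam0, beta, Matrix.fromBlocks, Matrix.toLpLin_apply,
      Matrix.mulVec, dotProduct, Matrix.one_apply]

/-! ### Finite speed of propagation for symmetric hyperbolic systems -/

/-- Squaring the positive part makes it `C¹`, so it can weight the energy on a cone without any
smooth cutoff. -/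
lemma hasDerivAt_posPart_sq (s : ℝ) : HasDerivAt (fun s : ℝ => max s 0 ^ 2) (2 * max s 0) s := by
  rcases lt_trichotomy s 0 with h | rfl | h
  · rw [max_eq_right h.le, mul_zero]
    refine (hasDerivAt_const s (0 : ℝ)).congr_of_eventuallyEq ?_
    filter_upwards [eventually_lt_nhds h] with y hy
    simp [max_eq_right hy.le]
  · rw [max_self, mul_zero, hasDerivAt_iff_isLittleO]
    simp only [max_self, sub_zero, smul_eq_mul, mul_zero, ne_eq, OfNat.ofNat_ne_zero,
      not_false_eq_true, zero_pow]
    refine Asymptotics.IsBigO.trans_isLittleO (g := fun x : ℝ => x ^ 2) ?_ ?_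
    · refine Asymptotics.IsBigO.of_bound 1 (Eventually.of_forall fun x => ?_)
      rw [one_mul, norm_pow, norm_pow]
      gcongr
      rw [Real.norm_eq_abs, Real.norm_eq_abs]
      rcases le_total x 0 with h | h
      · simp [max_eq_right h]
      · simp [max_eq_left h]
    · exact Asymptotics.isLittleO_pow_id one_lt_two
  · rw [max_eq_left h.le]
    have := hasDerivAt_pow 2 s
    norm_num at this
    refine this.congr_of_eventuallyEq ?_
    filter_upwards [eventually_gt_nhds h] with y hy
    simp [max_eq_left hy.le]

lemma continuous_posPart : Continuous fun s : ℝ => max s 0 := continuous_id.max continuous_const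

/-- The backward cone defining function `R² - 2 S R t - |x - x₀|²`. -/
def coneFun (S R : ℝ) (x₀ : E3) (t : ℝ) (x : E3) : ℝ :=
  R ^ 2 - 2 * S * R * t - ‖x - x₀‖ ^ 2

lemma continuous_coneFun (S R : ℝ) (x₀ : E3) (t : ℝ) : Continuous (coneFun S R x₀ t) := by
  unfold coneFun; fun_prop

lemma hasDerivAt_cone_time (S R : ℝ) (x₀ : E3) (t : ℝ) (x : E3) :
    HasDerivAt (fun s => max (coneFun S R x₀ s x) 0 ^ 2)
      (2 * max (coneFun S R x₀ t x) 0 * (-(2 * S * R))) t := by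
  refine (hasDerivAt_posPart_sq _).comp t ?_
  have := (((hasDerivAt_id t).const_mul (2 * S * R)).const_sub (R ^ 2)).sub_const (‖x - x₀‖ ^ 2)
  simpa [coneFun] using this

lemma hasFDerivAt_cone_space (S R : ℝ) (x₀ : E3) (t : ℝ) (x : E3) :
    HasFDerivAt (fun y => max (coneFun S R x₀ t y) 0 ^ 2)
      ((2 * max (coneFun S R x₀ t x) 0) • (-((2 : ℝ) • (innerSL ℝ (x - x₀) : E3 →L[ℝ] ℝ)))) x := by
  refine (hasDerivAt_posPart_sq (coneFun S R x₀ t x)).comp_hasFDerivAt x ?_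
  have h := ((hasFDerivAt_id (𝕜 := ℝ) x).sub_const x₀).norm_sq.const_sub (R ^ 2 - 2 * S * R * t)
  refine h.congr_fderiv ?_
  ext v; simp [two_mul]

lemma fderiv_cone_space (S R : ℝ) (x₀ : E3) (t : ℝ) (x : E3) (k : Fin 3) :
    fderiv ℝ (fun y => max (coneFun S R x₀ t y) 0 ^ 2) x (EuclideanSpace.single k 1)
      = -(4 * max (coneFun S R x₀ t x) 0 * (x - x₀) k) := by
  rw [(hasFDerivAt_cone_space S R x₀ t x).fderiv]
  simp [EuclideanSpace.inner_single_right]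
  ring

/-- Where the weight is positive and `t ≥ 0`, the point lies within `R` of `x₀`. This lets the decay
of the weight in time absorb its spatial gradient. -/
lemma abs_mul_posPart_cone_le {S R : ℝ} (hS : 0 ≤ S) (hR : 0 ≤ R) (x₀ : E3) {t : ℝ} (ht : 0 ≤ t)
    (x : E3) (k : Fin 3) :
    max (coneFun S R x₀ t x) 0 * |(x - x₀) k| ≤ max (coneFun S R x₀ t x) 0 * R := by
  rcases le_or_gt (coneFun S R x₀ t x) 0 with h | h
  · simp [max_eq_right h]
  · gcongr
    have h1 : ‖x - x₀‖ ^ 2 ≤ R ^ 2 := by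
      have : 0 ≤ 2 * S * R * t := by positivity
      unfold coneFun at h; linarith
    have h2 := abs_le_of_sq_le_sq h1 hR
    have h3 := PiLp.norm_apply_le (x - x₀) k
    rw [Real.norm_eq_abs] at h3
    exact h3.trans ((le_abs_self _).trans h2)

/-! ### Energy balance for symmetric hyperbolic systems -/

variable {ι : Type*} [Fintype ι]

lemma abs_mul_le_sum_sq (v : ι → ℝ) (i j : ι) : |v i * v j| ≤ ∑ l, v l ^ 2 := by
  have hi := Finset.single_le_sum (fun l _ => sq_nonneg (v l)) (Finset.mem_univ i)
  have hj := Finset.single_le_sum (fun l _ => sq_nonneg (v l)) (Finset.mem_univ j)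
  rw [abs_le]
  constructor <;> nlinarith [sq_nonneg (v i + v j), sq_nonneg (v i - v j)]

/-- The flux in direction `k`. -/
def flux (B : Fin 3 → ι → ι → ℝ) (k : Fin 3) (v : ι → ℝ) : ℝ := ∑ i, ∑ j, B k i j * (v i * v j)

lemma abs_flux_le (B : Fin 3 → ι → ι → ℝ) (k : Fin 3) (v : ι → ℝ) :
    |flux B k v| ≤ (∑ i, ∑ j, |B k i j|) * ∑ l, v l ^ 2 := by
  simp only [flux, Finset.sum_mul]
  refine (Finset.abs_sum_le_sum_abs _ _).trans (Finset.sum_le_sum fun i _ => ?_)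
  refine (Finset.abs_sum_le_sum_abs _ _).trans (Finset.sum_le_sum fun j _ => ?_)
  rw [abs_mul]
  exact mul_le_mul_of_nonneg_left (abs_mul_le_sum_sq v i j) (abs_nonneg _)

lemma sum_antisymm_eq_zero (B₀ : ι → ι → ℝ) (h : ∀ i j, B₀ i j = -B₀ j i) (v : ι → ℝ) :
    ∑ i, v i * ∑ j, B₀ i j * v j = 0 := by
  have h1 : ∑ i, v i * ∑ j, B₀ i j * v j = ∑ i, ∑ j, B₀ i j * (v i * v j) :=
    Finset.sum_congr rfl fun i _ => by
      rw [Finset.mul_sum]; exact Finset.sum_congr rfl fun j _ => by ring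
  have h2 : ∑ i, ∑ j, B₀ i j * (v i * v j) = -∑ i, ∑ j, B₀ i j * (v i * v j) := by
    conv_lhs => rw [Finset.sum_comm]
    rw [← Finset.sum_neg_distrib]
    refine Finset.sum_congr rfl fun i _ => ?_
    rw [← Finset.sum_neg_distrib]
    refine Finset.sum_congr rfl fun j _ => ?_
    rw [h]; ring
  rw [h1]; linarith

/-- The right-hand side `Σₖ Bᵏ ∂ₖ u + B₀ u` of a first order system. -/
def firstOrder (B : Fin 3 → ι → ι → ℝ) (B₀ : ι → ι → ℝ) (u : ι → E3 → ℝ) (i : ι) (x : E3) : ℝ :=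
  ∑ k, ∑ j, B k i j * fderiv ℝ (u j) x (EuclideanSpace.single k 1) + ∑ j, B₀ i j * u j x

lemma fderiv_flux (B : Fin 3 → ι → ι → ℝ) (hB : ∀ k i j, B k i j = B k j i) (k : Fin 3)
    (u : ι → E3 → ℝ) (x v : E3) (hu : ∀ i, DifferentiableAt ℝ (u i) x) :
    fderiv ℝ (fun y => flux B k fun i => u i y) x v
      = 2 * ∑ i, u i x * ∑ j, B k i j * fderiv ℝ (u j) x v := by
  have h : HasFDerivAt (fun y => flux B k fun i => u i y)
      (∑ i, ∑ j, B k i j • (u i x • fderiv ℝ (u j) x + u j x • fderiv ℝ (u i) x)) x := by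
    refine HasFDerivAt.fun_sum fun i _ => HasFDerivAt.fun_sum fun j _ => ?_
    exact ((hu i).hasFDerivAt.mul (hu j).hasFDerivAt).const_mul _
  rw [h.fderiv]
  simp only [sum_apply, smul_apply, add_apply, smul_eq_mul, mul_add, Finset.sum_add_distrib]
  have : ∑ i, ∑ j, B k i j * (u j x * fderiv ℝ (u i) x v)
      = ∑ i, ∑ j, B k i j * (u i x * fderiv ℝ (u j) x v) := by
    rw [Finset.sum_comm]
    exact Finset.sum_congr rfl fun i _ => Finset.sum_congr rfl fun j _ => by rw [hB]
  rw [this, ← two_mul]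
  congr 1
  refine Finset.sum_congr rfl fun i _ => ?_
  rw [Finset.mul_sum]
  exact Finset.sum_congr rfl fun j _ => by ring

/-- Local energy balance in divergence form: symmetry of `B k` makes `2 u · Bᵏ ∂ₖu` the derivative
of a quadratic flux, and the antisymmetric zero order term does no work. -/
lemma two_mul_sum_firstOrder (B : Fin 3 → ι → ι → ℝ) (B₀ : ι → ι → ℝ)
    (hB : ∀ k i j, B k i j = B k j i) (hB₀ : ∀ i j, B₀ i j = -B₀ j i)
    (u : ι → E3 → ℝ) (x : E3) (hu : ∀ i, DifferentiableAt ℝ (u i) x) :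
    2 * ∑ i, u i x * firstOrder B B₀ u i x
      = ∑ k, fderiv ℝ (fun y => flux B k fun i => u i y) x (EuclideanSpace.single k 1) := by
  simp only [fderiv_flux B hB _ u x _ hu, firstOrder, mul_add, Finset.sum_add_distrib]
  rw [sum_antisymm_eq_zero B₀ hB₀ (fun i => u i x), mul_zero, add_zero, ← Finset.mul_sum]
  congr 1
  rw [Finset.sum_comm]
  exact Finset.sum_congr rfl fun i _ => Finset.mul_sum _ _ _

lemma coneFun_le {S R : ℝ} (hS : 0 ≤ S) (hR : 0 ≤ R) (x₀ : E3) {t T : ℝ} (ht : |t| ≤ T) (x : E3) :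
    coneFun S R x₀ t x ≤ R ^ 2 + 2 * S * R * T - ‖x - x₀‖ ^ 2 := by
  have h1 : -T ≤ t := (abs_le.1 ht).1
  have h2 : 0 ≤ 2 * S * R := by positivity
  unfold coneFun
  nlinarith

/-- The ball depends on `T` only, so a single integrable bound serves all times near a given one
when the energy is differentiated under the integral. -/
lemma posPart_coneFun_eq_zero {S R : ℝ} (hS : 0 ≤ S) (hR : 0 ≤ R) (x₀ : E3) {t T : ℝ}
    (ht : |t| ≤ T) {x : E3}
    (hx : x ∉ Metric.closedBall x₀ (Real.sqrt (R ^ 2 + 2 * S * R * T))) :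
    max (coneFun S R x₀ t x) 0 = 0 := by
  have hT : 0 ≤ T := (abs_nonneg t).trans ht
  rw [Metric.mem_closedBall, not_le, dist_eq_norm, Real.sqrt_lt (by positivity) (norm_nonneg _)]
    at hx
  exact max_eq_right ((coneFun_le hS hR x₀ ht x).trans (by linarith))

lemma hasCompactSupport_cone {S R : ℝ} (hS : 0 ≤ S) (hR : 0 ≤ R) (x₀ : E3) (t : ℝ) :
    HasCompactSupport fun x => max (coneFun S R x₀ t x) 0 ^ 2 :=
  HasCompactSupport.intro (isCompact_closedBall x₀ (Real.sqrt (R ^ 2 + 2 * S * R * |t|)))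
    fun x hx => by rw [posPart_coneFun_eq_zero hS hR x₀ le_rfl hx]; simp

lemma continuous_firstOrder (B : Fin 3 → ι → ι → ℝ) (B₀ : ι → ι → ℝ) {u : ι → E3 → ℝ}
    (hu : ∀ i, ContDiff ℝ 1 (u i)) (i : ι) : Continuous (firstOrder B B₀ u i) := by
  unfold firstOrder
  refine Continuous.add (continuous_finsetSum _ fun k _ => continuous_finsetSum _ fun j _ => ?_)
    (continuous_finsetSum _ fun j _ => continuous_const.mul (hu j).continuous)
  exact continuous_const.mul (((hu j).continuous_fderiv (by simp)).clm_apply continuous_const)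

lemma contDiff_flux (B : Fin 3 → ι → ι → ℝ) (k : Fin 3) {u : ι → E3 → ℝ}
    (hu : ∀ i, ContDiff ℝ 1 (u i)) : ContDiff ℝ 1 fun y => flux B k fun i => u i y := by
  unfold flux
  exact ContDiff.sum fun i _ => ContDiff.sum fun j _ => contDiff_const.mul ((hu i).mul (hu j))

/-- The energy flux through the lateral boundary of a cone, after integration by parts. -/
lemma integral_cone_mul_firstOrder (B : Fin 3 → ι → ι → ℝ) (B₀ : ι → ι → ℝ)
    (hB : ∀ k i j, B k i j = B k j i) (hB₀ : ∀ i j, B₀ i j = -B₀ j i) {u : ι → E3 → ℝ}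
    (hu : ∀ i, ContDiff ℝ 1 (u i)) {S R : ℝ} (hS : 0 ≤ S) (hR : 0 ≤ R) (x₀ : E3) (t : ℝ) :
    ∫ x, max (coneFun S R x₀ t x) 0 ^ 2 * (2 * ∑ i, u i x * firstOrder B B₀ u i x)
      = ∫ x, ∑ k, 4 * max (coneFun S R x₀ t x) 0 * (x - x₀) k * flux B k fun i => u i x := by
  have hp := continuous_posPart.comp (continuous_coneFun S R x₀ t)
  have hc := hasCompactSupport_cone hS hR x₀ t
  have hc' : HasCompactSupport fun x => max (coneFun S R x₀ t x) 0 := by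
    refine hc.mono' (subset_trans ?_ (subset_tsupport _))
    intro x hx
    simpa using hx
  have hd (i) (x) : DifferentiableAt ℝ (u i) x := (hu i).differentiable (by simp) x
  have hf (k) := contDiff_flux B k hu
  have hi1 (k : Fin 3) : Integrable fun x => max (coneFun S R x₀ t x) 0 ^ 2 *
      fderiv ℝ (fun y => flux B k fun i => u i y) x (EuclideanSpace.single k 1) :=
    Continuous.integrable_of_hasCompactSupport
      ((hp.pow 2).mul (((hf k).continuous_fderiv (by simp)).clm_apply continuous_const))
      hc.mul_right
  have hi2 (k : Fin 3) : Integrable fun x =>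
      4 * max (coneFun S R x₀ t x) 0 * (x - x₀) k * flux B k fun i => u i x := by
    refine Continuous.integrable_of_hasCompactSupport (Continuous.mul (by fun_prop)
      (hf k).continuous) (HasCompactSupport.mul_right (HasCompactSupport.mul_right ?_))
    exact hc'.mul_left
  simp only [two_mul_sum_firstOrder B B₀ hB hB₀ u _ fun i => hd i _, Finset.mul_sum]
  rw [integral_finsetSum _ fun k _ => hi1 k, integral_finsetSum _ fun k _ => hi2 k]
  refine Finset.sum_congr rfl fun k _ => ?_
  rw [integral_mul_fderiv_eq_neg_fderiv_mul_of_integrable _ (hi1 k)]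
  · rw [← integral_neg]
    refine integral_congr_ae (ae_of_all _ fun x => ?_)
    simp only [fderiv_cone_space]; ring
  · exact Continuous.integrable_of_hasCompactSupport ((hp.pow 2).mul (hf k).continuous)
      hc.mul_right
  · exact fun x _ => (hasFDerivAt_cone_space S R x₀ t x).differentiableAt
  · exact fun x _ => (hf k).differentiable (by simp) x
  · simp only [fderiv_cone_space]
    simp only [neg_mul]
    exact (hi2 k).neg

/-- A bounded classical solution of a symmetric hyperbolic system with constant coefficients
that vanishes on a ball at time zero vanishes on a cone. -/
theorem eq_zero_of_symmetric_hyperbolic (B : Fin 3 → ι → ι → ℝ) (B₀ : ι → ι → ℝ)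
    (hB : ∀ k i j, B k i j = B k j i) (hB₀ : ∀ i j, B₀ i j = -B₀ j i)
    {u : ℝ → ι → E3 → ℝ} (hu : ∀ t i, ContDiff ℝ 1 (u t i))
    {M : ℝ} (hM : ∀ t i x, |u t i x| ≤ M) (hM' : ∀ t i x, |firstOrder B B₀ (u t) i x| ≤ M)
    (heq : ∀ t i x, HasDerivAt (fun s => u s i x) (firstOrder B B₀ (u t) i x) t)
    {x₀ : E3} {R : ℝ} (hR : 0 < R) (h0 : ∀ i x, dist x x₀ < R → u 0 i x = 0)
    {t : ℝ} (ht : 0 ≤ t) (htR : 2 * (∑ k, ∑ i, ∑ j, |B k i j|) * t < R) (i : ι) :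
    u t i x₀ = 0 := by
  set S := ∑ k, ∑ i, ∑ j, |B k i j| with hSdef
  have hS : 0 ≤ S := by positivity
  let p (s : ℝ) (x : E3) := max (coneFun S R x₀ s x) 0
  let e (s : ℝ) (x : E3) := ∑ i, u s i x ^ 2
  let F (s : ℝ) (x : E3) := p s x ^ 2 * e s x
  let F' (s : ℝ) (x : E3) := 2 * p s x * (-(2 * S * R)) * e s x
    + p s x ^ 2 * (2 * ∑ i, u s i x * firstOrder B B₀ (u s) i x)
  have hp (s) : Continuous (p s) := continuous_posPart.comp (continuous_coneFun S R x₀ s)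
  have hp0 (s x) : 0 ≤ p s x := le_max_right _ _
  have he (s) : Continuous (e s) := continuous_finsetSum _ fun i _ => ((hu s i).continuous.pow 2)
  have he0 (s x) : 0 ≤ e s x := Finset.sum_nonneg fun i _ => sq_nonneg _
  have hcs (s) : HasCompactSupport (fun x => p s x ^ 2) := hasCompactSupport_cone hS hR.le x₀ s
  have hFc (s) : Continuous (F s) := ((hp s).pow 2).mul (he s)
  have hFi (s) : Integrable (F s) := (hFc s).integrable_of_hasCompactSupport (hcs s).mul_right
  have hF'c (s) : Continuous (F' s) := by
    refine ((((continuous_const.mul (hp s)).mul continuous_const).mul (he s))).add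
      (((hp s).pow 2).mul (continuous_const.mul (continuous_finsetSum _ fun i _ => ?_)))
    exact (hu s i).continuous.mul (continuous_firstOrder B B₀ (hu s) i)
  have hFd (s x) : HasDerivAt (fun s => F s x) (F' s x) s := by
    refine (hasDerivAt_cone_time S R x₀ s x).mul ?_
    have := HasDerivAt.fun_sum fun i (_ : i ∈ Finset.univ) => (heq s i x).pow 2
    refine this.congr_deriv ?_
    rw [Finset.mul_sum]
    exact Finset.sum_congr rfl fun i _ => by simp; ring
  have hderiv (s : ℝ) : HasDerivAt (fun s => ∫ x, F s x) (∫ x, F' s x) s := by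
    set T := |s| + 1
    set ρ := R ^ 2 + 2 * S * R * T
    set K := 2 * ρ * (2 * S * R) * (∑ _i : ι, M ^ 2) + ρ ^ 2 * (2 * ∑ _i : ι, M * M)
    have hs' : ∀ r ∈ Metric.ball s 1, |r| ≤ T := fun r hr => by
      rw [Metric.mem_ball, Real.dist_eq] at hr
      have := abs_sub_abs_le_abs_sub r s
      simp only [T]; linarith
    have hρ : 0 ≤ ρ := by positivity
    refine (hasDerivAt_integral_of_dominated_loc_of_deriv_le (Metric.ball_mem_nhds s one_pos)
      (bound := (Metric.closedBall x₀ (Real.sqrt ρ)).indicator fun _ => K)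
      (Eventually.of_forall fun s => (hFc s).aestronglyMeasurable) (hFi s)
      (hF'c s).aestronglyMeasurable (ae_of_all _ fun x r hr => ?_) ?_
      (ae_of_all _ fun x r _ => hFd r x)).2
    · by_cases hx : x ∈ Metric.closedBall x₀ (Real.sqrt ρ)
      · rw [Set.indicator_of_mem hx]
        have hpρ : p r x ≤ ρ := max_le ((coneFun_le hS hR.le x₀ (hs' r hr) x).trans
          (by simp only [ρ]; nlinarith [sq_nonneg ‖x - x₀‖])) hρ
        have hu2 (i) : u r i x ^ 2 ≤ M ^ 2 := sq_le_sq' (abs_le.1 (hM r i x)).1 (abs_le.1 (hM r i x)).2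
        have hM0 (i : ι) : 0 ≤ M := (abs_nonneg _).trans (hM r i x)
        have h1 : |∑ i, u r i x * firstOrder B B₀ (u r) i x| ≤ ∑ _i : ι, M * M :=
          (Finset.abs_sum_le_sum_abs _ _).trans (Finset.sum_le_sum fun i _ => by
            rw [abs_mul]
            exact mul_le_mul (hM r i x) (hM' r i x) (abs_nonneg _) (hM0 i))
        have h2 : e r x ≤ ∑ _i : ι, M ^ 2 := Finset.sum_le_sum fun i _ => hu2 i
        refine (norm_add_le _ _).trans (add_le_add ?_ ?_)
        · rw [norm_mul, norm_mul, norm_neg, Real.norm_of_nonneg (he0 r x),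
            Real.norm_of_nonneg (by positivity : (0 : ℝ) ≤ 2 * S * R),
            Real.norm_of_nonneg (mul_nonneg zero_le_two (hp0 r x))]
          have := hp0 r x
          have := he0 r x
          gcongr
        · rw [norm_mul, norm_mul, Real.norm_of_nonneg (sq_nonneg _), Real.norm_two,
            Real.norm_eq_abs]
          have := hp0 r x
          gcongr
      · rw [Set.indicator_of_notMem hx]
        have : p r x = 0 := posPart_coneFun_eq_zero hS hR.le x₀ (hs' r hr) hx
        simp [F', this]
    · exact (integrable_indicator_iff measurableSet_closedBall).2
        (integrableOn_const (isCompact_closedBall _ _).measure_ne_top)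
  -- The weight `p²` decays at rate `4SRp`, while after integration by parts the flux is at most
  -- `4pR` times `S e`. The slope of the cone is chosen so that the two cancel.
  have hneg (s : ℝ) (hs : 0 ≤ s) : ∫ x, F' s x ≤ 0 := by
    have hc1 : HasCompactSupport (p s) := by
      refine (hcs s).mono' (subset_trans ?_ (subset_tsupport _))
      intro x hx
      simpa using hx
    have hG1 : Integrable fun x => 2 * p s x * (-(2 * S * R)) * e s x :=
      Continuous.integrable_of_hasCompactSupport
        (((continuous_const.mul (hp s)).mul continuous_const).mul (he s))
        (HasCompactSupport.mul_right (HasCompactSupport.mul_right hc1.mul_left))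
    have hG2 : Integrable fun x => p s x ^ 2 * (2 * ∑ i, u s i x * firstOrder B B₀ (u s) i x) :=
      Continuous.integrable_of_hasCompactSupport (((hp s).pow 2).mul
        (continuous_const.mul (continuous_finsetSum _ fun i _ =>
          (hu s i).continuous.mul (continuous_firstOrder B B₀ (hu s) i)))) (hcs s).mul_right
    have hG3 : Integrable fun x => ∑ k, 4 * p s x * (x - x₀) k * flux B k fun i => u s i x :=
      integrable_finsetSum _ fun k _ => Continuous.integrable_of_hasCompactSupport
        (((continuous_const.mul (hp s)).mul (by fun_prop)).mul
          (contDiff_flux B k (hu s)).continuous)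
        (HasCompactSupport.mul_right (HasCompactSupport.mul_right hc1.mul_left))
    have hle : ∫ x, ∑ k, 4 * p s x * (x - x₀) k * flux B k (fun i => u s i x)
        ≤ ∫ x, -(2 * p s x * (-(2 * S * R)) * e s x) := by
      refine integral_mono hG3 hG1.neg fun x => ?_
      have h1 (k : Fin 3) : 4 * p s x * (x - x₀) k * flux B k (fun i => u s i x)
          ≤ 4 * (p s x * R) * ((∑ i, ∑ j, |B k i j|) * e s x) := by
        refine (le_abs_self _).trans ?_
        rw [abs_mul, mul_assoc, abs_mul, abs_mul, abs_of_nonneg (hp0 s x),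
          abs_of_pos (by norm_num : (0 : ℝ) < 4)]
        exact mul_le_mul (mul_le_mul_of_nonneg_left (abs_mul_posPart_cone_le hS hR.le x₀ hs x k)
          (by norm_num)) (abs_flux_le B k _) (abs_nonneg _)
          (mul_nonneg (by norm_num) (mul_nonneg (hp0 s x) hR.le))
      refine (Finset.sum_le_sum fun k _ => h1 k).trans (le_of_eq ?_)
      rw [← Finset.mul_sum, ← Finset.sum_mul, ← hSdef]
      ring
    have := integral_cone_mul_firstOrder B B₀ hB hB₀ (hu s) hS hR.le x₀ s
    simp only [F']
    rw [integral_add hG1 hG2, this]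
    rw [integral_neg] at hle
    linarith
  have hanti : AntitoneOn (fun s => ∫ x, F s x) (Set.Ici 0) := by
    refine antitoneOn_of_deriv_nonpos (convex_Ici 0)
      (fun s _ => (hderiv s).continuousAt.continuousWithinAt)
      (fun s _ => (hderiv s).differentiableAt.differentiableWithinAt) fun s hs => ?_
    rw [interior_Ici] at hs
    rw [(hderiv s).deriv]
    exact hneg s (le_of_lt hs)
  -- At time zero the data vanish inside the ball of radius `R` and the weight vanishes outside it.
  have hF0 : ∫ x, F 0 x = 0 := by
    rw [integral_congr_ae (g := fun _ => 0) (ae_of_all _ fun x => ?_), integral_zero]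
    by_cases hx : dist x x₀ < R
    · simp [F, e, h0 _ x hx]
    · have : p 0 x = 0 := by
        refine max_eq_right ?_
        rw [not_lt, dist_eq_norm] at hx
        simp only [coneFun, mul_zero, sub_zero, sub_nonpos]
        gcongr
      simp [F, this]
  have hFt : ∫ x, F t x = 0 := le_antisymm
    ((hanti (Set.mem_Ici.2 le_rfl) (Set.mem_Ici.2 ht) ht).trans hF0.le)
    (integral_nonneg fun x => mul_nonneg (sq_nonneg _) (he0 t x))
  have hF0' : F t = 0 := by
    rw [← (hFc t).ae_eq_iff_eq volume continuous_zero]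
    exact (integral_eq_zero_iff_of_nonneg
      (fun x => mul_nonneg (sq_nonneg _) (he0 t x)) (hFi t)).1 hFt
  -- At `x₀` the cone function equals `R (R - 2St)`, which is positive by `htR`.
  have h1 : p t x₀ ^ 2 * e t x₀ = 0 := congrFun hF0' x₀
  have h2 : 0 < p t x₀ := lt_max_of_lt_left (by
    simp only [coneFun, sub_self, norm_zero]
    nlinarith)
  have h3 : e t x₀ = 0 := (mul_eq_zero.1 h1).resolve_left (by positivity)
  have h4 := (Finset.sum_eq_zero_iff_of_nonneg fun i _ => sq_nonneg (u t i x₀)).1 h3 i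
    (Finset.mem_univ i)
  exact pow_eq_zero_iff two_ne_zero |>.1 h4

/-! ### Inverse Fourier transforms of rapidly decaying functions -/

/-- Continuous functions all of whose moments are finite. -/
structure IsRapid (g : E3 → ℂ) : Prop where
  continuous : Continuous g
  moment : ∀ n : ℕ, Integrable fun ξ => ‖ξ‖ ^ n * ‖g ξ‖

namespace IsRapid

variable {g h : E3 → ℂ}

lemma integrable (hg : IsRapid g) : Integrable g := by
  have := hg.moment 0
  simp only [pow_zero, one_mul] at this
  exact (integrable_norm_iff hg.continuous.aestronglyMeasurable).1 this

/-- Only moments are controlled, never derivatives in `ξ`, so the bounded propagator and the symbol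
of linear growth act on this class without any estimate of derivatives of `sin(ωt)/ω`. -/
lemma mul_of_le {a : E3 → ℂ} {C : ℝ} (hg : IsRapid g) (ha : Continuous a)
    (hC : ∀ ξ, ‖a ξ‖ ≤ C * (1 + ‖ξ‖)) : IsRapid fun ξ => a ξ * g ξ where
  continuous := ha.mul hg.continuous
  moment n := by
    refine Integrable.mono' (((hg.moment n).add (hg.moment (n + 1))).const_mul C)
      (by have := hg.continuous; fun_prop) (ae_of_all _ fun ξ => ?_)
    rw [Real.norm_of_nonneg (by positivity), norm_mul]
    calc ‖ξ‖ ^ n * (‖a ξ‖ * ‖g ξ‖) ≤ ‖ξ‖ ^ n * ((C * (1 + ‖ξ‖)) * ‖g ξ‖) := by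
          gcongr; exact hC ξ
      _ = C * (‖ξ‖ ^ n * ‖g ξ‖ + ‖ξ‖ ^ (n + 1) * ‖g ξ‖) := by ring

lemma sum {κ : Type*} {s : Finset κ} {G : κ → E3 → ℂ} (hG : ∀ j ∈ s, IsRapid (G j)) :
    IsRapid fun ξ => ∑ j ∈ s, G j ξ where
  continuous := continuous_finsetSum _ fun j hj => (hG j hj).continuous
  moment n := by
    refine Integrable.mono' (integrable_finsetSum s fun j hj => (hG j hj).moment n)
      (Continuous.aestronglyMeasurable ((continuous_norm.pow n).mul
        (continuous_finsetSum _ fun j hj => (hG j hj).continuous).norm)) (ae_of_all _ fun ξ => ?_)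
    rw [Real.norm_of_nonneg (by positivity), ← Finset.mul_sum]
    gcongr
    exact norm_sum_le _ _

lemma comp_neg (hg : IsRapid g) : IsRapid fun ξ => g (-ξ) where
  continuous := hg.continuous.comp continuous_neg
  moment n := by simpa using (hg.moment n).comp_neg

lemma contDiff_fourierInv (hg : IsRapid g) : ContDiff ℝ ((⊤ : ℕ∞) : WithTop ℕ∞) (𝓕⁻ g) := by
  rw [Real.fourierInv_eq_fourier_comp_neg]
  exact Real.contDiff_fourier fun n _ => hg.comp_neg.moment n

lemma fderiv_fourierInv (hg : IsRapid g) (x v : E3) :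
    fderiv ℝ (𝓕⁻ g) x v
      = 𝓕⁻ (fun ξ => 2 * Real.pi * Complex.I * (inner ℝ ξ v : ℝ) * g ξ) x := by
  have h1 := hg.comp_neg.moment 1
  simp only [pow_one] at h1
  have hint := hg.comp_neg.integrable
  rw [Real.fourierInv_eq_fourier_comp_neg, Real.fourierInv_eq_fourier_comp_neg,
    Real.fderiv_fourier hint h1, Real.fourier_continuousLinearMap_apply]
  · refine congrFun (congrArg 𝓕 (funext fun ξ => ?_)) x
    change -(2 * Real.pi * Complex.I) • ((inner ℝ ξ v : ℝ) • g (-ξ)) = _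
    simp
    ring
  · refine (h1.const_mul (2 * Real.pi * ‖innerSL ℝ (E := E3)‖)).mono'
      (hint.aestronglyMeasurable.fourierSMulRight) (ae_of_all _ fun ξ => ?_)
    refine (VectorFourier.norm_fourierSMulRight_le _ _ _).trans (le_of_eq ?_)
    ring

end IsRapid

lemma norm_fourierInv_le (g : E3 → ℂ) (x : E3) : ‖𝓕⁻ g x‖ ≤ ∫ ξ, ‖g ξ‖ := by
  rw [Real.fourierInv_eq]
  refine (norm_integral_le_integral_norm _).trans (le_of_eq ?_)
  simp_rw [Circle.norm_smul]

lemma integrable_fourierChar_smul {g : E3 → ℂ} (hg : Integrable g) (x : E3) :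
    Integrable fun ξ => Real.fourierChar (inner ℝ ξ x : ℝ) • g ξ := by
  simpa using (Real.fourierIntegral_convergent_iff (-x)).2 hg

lemma fourierInv_sum {κ : Type*} (s : Finset κ) {G : κ → E3 → ℂ} (hG : ∀ j ∈ s, Integrable (G j))
    (x : E3) : 𝓕⁻ (fun ξ => ∑ j ∈ s, G j ξ) x = ∑ j ∈ s, 𝓕⁻ (G j) x := by
  simp only [Real.fourierInv_eq, Finset.smul_sum]
  exact integral_finsetSum _ fun j hj => integrable_fourierChar_smul (hG j hj) x

lemma fourierInv_add {g h : E3 → ℂ} (hg : Integrable g) (hh : Integrable h)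
    (x : E3) : 𝓕⁻ (fun ξ => g ξ + h ξ) x = 𝓕⁻ g x + 𝓕⁻ h x := by
  simp only [Real.fourierInv_eq, smul_add]
  exact integral_add (integrable_fourierChar_smul hg x) (integrable_fourierChar_smul hh x)

lemma fourierInv_const_mul (c : ℂ) (g : E3 → ℂ) (x : E3) :
    𝓕⁻ (fun ξ => c * g ξ) x = c * 𝓕⁻ g x := by
  simp only [Real.fourierInv_eq, Circle.smul_def, smul_eq_mul, mul_left_comm _ c]
  exact integral_const_mul _ _

lemma hasDerivAt_fourierInv {G G' : ℝ → E3 → ℂ} {b : E3 → ℝ} (hG : ∀ t, Integrable (G t))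
    (hG' : ∀ t, AEStronglyMeasurable (G' t)) (hb : Integrable b) (hbd : ∀ t ξ, ‖G' t ξ‖ ≤ b ξ)
    (hd : ∀ t ξ, HasDerivAt (fun s => G s ξ) (G' t ξ) t) (t : ℝ) (x : E3) :
    HasDerivAt (fun s => 𝓕⁻ (G s) x) (𝓕⁻ (G' t) x) t := by
  simp only [Real.fourierInv_eq, Circle.smul_def, smul_eq_mul]
  refine (hasDerivAt_integral_of_dominated_loc_of_deriv_le (bound := b) univ_mem
    (Eventually.of_forall fun s => (integrable_fourierChar_smul (hG s) x).aestronglyMeasurable)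
    (integrable_fourierChar_smul (hG t) x) ?_ (ae_of_all _ fun ξ s _ => ?_) hb
    (ae_of_all _ fun ξ s _ => (hd s ξ).const_mul _)).2
  · refine AEStronglyMeasurable.mul ?_ (hG' t)
    exact (by fun_prop : Continuous fun ξ : E3 => (Real.fourierChar (inner ℝ ξ x : ℝ) : ℂ)).aestronglyMeasurable
  · rw [norm_mul, Circle.norm_coe, one_mul]; exact hbd s ξ

/-! ### The symbol of the Dirac operator and its propagator -/

/-- The frequency `ω(ξ) = √(4π²|ξ|² + m²)`. -/
def freq (m : ℝ) (ξ : E3) : ℝ := Real.sqrt ((2 * Real.pi * ‖ξ‖) ^ 2 + m ^ 2)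

/-- The symbol `P(2πiξ)`. -/
def sym (m : ℝ) (ξ : E3) : Matrix RealIdx RealIdx ℂ :=
  diracSymbol m fun k => 2 * Real.pi * Complex.I * (ξ k : ℝ)

/-- The propagator `cos(ω t) + sin(ω t) ω⁻¹ P(2πiξ)`. -/
def prop (m t : ℝ) (ξ : E3) : Matrix RealIdx RealIdx ℂ :=
  (Real.cos (freq m ξ * t) : ℂ) • 1 + ((Real.sin (freq m ξ * t) / freq m ξ : ℝ) : ℂ) • sym m ξ

lemma continuous_freq (m : ℝ) : Continuous (freq m) := by unfold freq; fun_prop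

lemma freq_pos {m : ℝ} (hm : 0 < m) (ξ : E3) : 0 < freq m ξ := by unfold freq; positivity

lemma freq_neg (m : ℝ) (ξ : E3) : freq m (-ξ) = freq m ξ := by simp [freq]

lemma freq_sq (m : ℝ) (ξ : E3) : freq m ξ ^ 2 = (2 * Real.pi * ‖ξ‖) ^ 2 + m ^ 2 :=
  Real.sq_sqrt (by positivity)

lemma le_freq (m : ℝ) (ξ : E3) : m ≤ freq m ξ := Real.le_sqrt_of_sq_le (by nlinarith [sq_nonneg (2 * Real.pi * ‖ξ‖)])

lemma two_pi_norm_le_freq (m : ℝ) (ξ : E3) : 2 * Real.pi * ‖ξ‖ ≤ freq m ξ :=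
  Real.le_sqrt_of_sq_le (by nlinarith [sq_nonneg m])

lemma freq_le {m : ℝ} (hm : 0 < m) (ξ : E3) : freq m ξ ≤ (2 * Real.pi + m) * (1 + ‖ξ‖) := by
  have := Real.pi_pos
  refine Real.sqrt_le_iff.2 ⟨by positivity, ?_⟩
  have h : 2 * Real.pi * ‖ξ‖ + m ≤ (2 * Real.pi + m) * (1 + ‖ξ‖) := by
    nlinarith [norm_nonneg ξ, mul_nonneg hm.le (norm_nonneg ξ)]
  have h2 : (2 * Real.pi * ‖ξ‖) ^ 2 + m ^ 2 ≤ (2 * Real.pi * ‖ξ‖ + m) ^ 2 := by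
    have : 0 ≤ 2 * Real.pi * ‖ξ‖ * m := by positivity
    nlinarith
  exact h2.trans (by gcongr)

lemma sym_apply (m : ℝ) (ξ : E3) (i j : RealIdx) :
    sym m ξ i j = ∑ k, Lam k i j * (2 * Real.pi * Complex.I * (ξ k : ℝ)) + m * Lam0 i j := by
  rw [sym, diracSymbol_apply]
  simp only [mul_comm (Lam _ i j)]

lemma continuous_sym (m : ℝ) (i j : RealIdx) : Continuous fun ξ => sym m ξ i j := by
  simp only [sym_apply]; fun_prop

/-- This relation sums the exponential series of `t P(2πiξ)` to the closed form chosen for `prop`.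
-/
lemma sym_mul_self (m : ℝ) (ξ : E3) : sym m ξ * sym m ξ = (-(freq m ξ : ℂ) ^ 2) • 1 := by
  have h : (freq m ξ : ℂ) ^ 2 = ((∑ k, (2 * Real.pi) ^ 2 * ξ k ^ 2 + m ^ 2 : ℝ) : ℂ) := by
    rw [← Complex.ofReal_pow, freq_sq, mul_pow, EuclideanSpace.real_norm_sq_eq, Finset.mul_sum]
  rw [sym, diracSymbol_mul_self, h]
  congr 1
  push_cast
  simp only [mul_pow, Complex.I_sq]
  rw [sub_eq_add_neg, neg_add, ← Finset.sum_neg_distrib]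
  congr 1
  exact Finset.sum_congr rfl fun _ _ => by ring

/-- A uniform bound for the entries of the Dirac matrices. -/
def symConst : ℝ := ∑ i, ∑ j, (∑ k, ‖Lam k i j‖ + ‖Lam0 i j‖)

lemma symConst_nonneg : 0 ≤ symConst := by unfold symConst; positivity

/-- Both `2π|ξₖ|` and `m` are at most `ω`. Hence `ω⁻¹ P` is bounded, which makes the propagator
bounded uniformly in `t` and `ξ`. -/
lemma norm_sym_le {m : ℝ} (hm : 0 < m) (ξ : E3) (i j : RealIdx) :
    ‖sym m ξ i j‖ ≤ symConst * freq m ξ := by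
  have h1 : ‖sym m ξ i j‖ ≤ (∑ k, ‖Lam k i j‖ + ‖Lam0 i j‖) * freq m ξ := by
    rw [sym_apply, add_mul, Finset.sum_mul]
    refine (norm_add_le _ _).trans (add_le_add ((norm_sum_le _ _).trans
      (Finset.sum_le_sum fun k _ => ?_)) ?_)
    · rw [norm_mul]
      gcongr
      simp only [norm_mul, Complex.norm_ofNat, Complex.norm_real, Complex.norm_I, mul_one,
        Real.norm_of_nonneg Real.pi_pos.le]
      exact (mul_le_mul_of_nonneg_left (PiLp.norm_apply_le ξ k) (by positivity)).trans
        (two_pi_norm_le_freq m ξ)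
    · rw [norm_mul, mul_comm, Complex.norm_real, Real.norm_of_nonneg hm.le]
      gcongr
      exact le_freq m ξ
  refine h1.trans (mul_le_mul_of_nonneg_right ?_ (freq_pos hm ξ).le)
  refine le_trans ?_ (Finset.single_le_sum (f := fun i => ∑ j, (∑ k, ‖Lam k i j‖ + ‖Lam0 i j‖))
    (fun i _ => by positivity) (Finset.mem_univ i))
  exact Finset.single_le_sum (f := fun j => (∑ k, ‖Lam k i j‖ + ‖Lam0 i j‖))
    (fun i _ => by positivity) (Finset.mem_univ j)

lemma prop_apply (m t : ℝ) (ξ : E3) (i j : RealIdx) :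
    prop m t ξ i j = (Real.cos (freq m ξ * t) : ℂ) * (1 : Matrix RealIdx RealIdx ℂ) i j
      + ((Real.sin (freq m ξ * t) / freq m ξ : ℝ) : ℂ) * sym m ξ i j := by
  simp only [prop, Matrix.add_apply, Matrix.smul_apply, smul_eq_mul]

lemma norm_prop_le {m : ℝ} (hm : 0 < m) (t : ℝ) (ξ : E3) (i j : RealIdx) :
    ‖prop m t ξ i j‖ ≤ 1 + symConst := by
  have hω := freq_pos hm ξ
  rw [prop_apply]
  refine (norm_add_le _ _).trans (add_le_add ?_ ?_)
  · rw [norm_mul, Complex.norm_real, Real.norm_eq_abs, Matrix.one_apply]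
    split_ifs
    · simpa using Real.abs_cos_le_one _
    · simp
  · rw [norm_mul, Complex.norm_real, norm_div, Real.norm_of_nonneg hω.le, Real.norm_eq_abs]
    calc |Real.sin (freq m ξ * t)| / freq m ξ * ‖sym m ξ i j‖
        ≤ 1 / freq m ξ * (symConst * freq m ξ) := by
          gcongr
          · exact Real.abs_sin_le_one _
          · exact norm_sym_le hm ξ i j
      _ = symConst := by field_simp

lemma continuous_prop {m : ℝ} (hm : 0 < m) (t : ℝ) (i j : RealIdx) :
    Continuous fun ξ => prop m t ξ i j := by
  simp only [prop_apply]
  have h1 := continuous_freq m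
  have h2 := continuous_sym m i j
  have h3 : Continuous fun ξ : E3 => Real.sin (freq m ξ * t) / freq m ξ :=
    (by fun_prop : Continuous fun ξ : E3 => Real.sin (freq m ξ * t)).div h1
      fun ξ => (freq_pos hm ξ).ne'
  fun_prop

/-- The term `-ω sin ωt` equals `P · ω⁻¹ sin ωt · P` because `P² = -ω²`. -/
lemma hasDerivAt_prop {m : ℝ} (hm : 0 < m) (t : ℝ) (ξ : E3) (i j : RealIdx) :
    HasDerivAt (fun s => prop m s ξ i j) ((sym m ξ * prop m t ξ) i j) t := by
  have hω := (freq_pos hm ξ).ne'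
  simp only [prop_apply]
  have h0 : HasDerivAt (fun s : ℝ => freq m ξ * s) (freq m ξ) t := by
    simpa using (hasDerivAt_id t).const_mul (freq m ξ)
  have h1 := (h0.cos.ofReal_comp).mul_const ((1 : Matrix RealIdx RealIdx ℂ) i j)
  have h2 := ((h0.sin.div_const (freq m ξ)).ofReal_comp).mul_const (sym m ξ i j)
  refine (h1.add h2).congr_deriv ?_
  rw [prop, Matrix.mul_add, Matrix.mul_smul, Matrix.mul_smul, sym_mul_self, Matrix.mul_one]
  simp only [Matrix.add_apply, Matrix.smul_apply, smul_eq_mul]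
  push_cast
  have : (freq m ξ : ℂ) ≠ 0 := by exact_mod_cast hω
  field_simp
  ring

lemma prop_zero (m : ℝ) (ξ : E3) : prop m 0 ξ = 1 := by simp [prop]

/-! ### Solution of the Cauchy problem with test initial data -/

/-- Vectors in `C₀^∞(ℝ³, ℝ⁸)`. -/
structure IsTestVec (φ : RealIdx → E3 → ℝ) : Prop where
  smooth : ∀ i, ContDiff ℝ ((⊤ : ℕ∞) : WithTop ℕ∞) (φ i)
  compact : ∀ i, HasCompactSupport (φ i)

/-- The Fourier transform of a real function. -/
def fourierR (f : E3 → ℝ) : E3 → ℂ := 𝓕 fun x => (f x : ℂ)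

lemma isRapid_fourierR {f : E3 → ℝ} (h1 : ContDiff ℝ ((⊤ : ℕ∞) : WithTop ℕ∞) f)
    (h2 : HasCompactSupport f) : IsRapid (fourierR f) := by
  have h3 : ContDiff ℝ ((⊤ : ℕ∞) : WithTop ℕ∞) fun x => (f x : ℂ) :=
    Complex.ofRealCLM.contDiff.comp h1
  have h4 : HasCompactSupport fun x => (f x : ℂ) := h2.comp_left (g := Complex.ofReal) rfl
  let F := h4.toSchwartzMap h3
  exact ⟨(𝓕 F).continuous, fun n => (𝓕 F).integrable_pow_mul volume n⟩

/-- The Fourier transform of the solution at time `t` with initial data `φ`. -/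
def waveSpec (m : ℝ) (φ : RealIdx → E3 → ℝ) (t : ℝ) (i : RealIdx) (ξ : E3) : ℂ :=
  ∑ j, prop m t ξ i j * fourierR (φ j) ξ

/-- The (complexified) solution at time `t` with initial data `φ`. -/
def wave (m : ℝ) (φ : RealIdx → E3 → ℝ) (t : ℝ) (i : RealIdx) : E3 → ℂ := 𝓕⁻ (waveSpec m φ t i)

section

variable {m : ℝ} (hm : 0 < m) {φ : RealIdx → E3 → ℝ} (hφ : IsTestVec φ)

lemma isRapid_waveSpec (hm : 0 < m) (hφ : IsTestVec φ) (t : ℝ) (i : RealIdx) :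
    IsRapid (waveSpec m φ t i) := by
  refine IsRapid.sum fun j _ => (isRapid_fourierR (hφ.smooth j) (hφ.compact j)).mul_of_le
    (C := 1 + symConst) (continuous_prop hm t i j) fun ξ => (norm_prop_le hm t ξ i j).trans ?_
  have := symConst_nonneg
  nlinarith [norm_nonneg ξ, mul_nonneg this (norm_nonneg ξ)]

lemma norm_waveSpec_le (hm : 0 < m) (t : ℝ) (i : RealIdx) (ξ : E3) :
    ‖waveSpec m φ t i ξ‖ ≤ (1 + symConst) * ∑ j, ‖fourierR (φ j) ξ‖ := by
  rw [Finset.mul_sum]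
  refine (norm_sum_le _ _).trans (Finset.sum_le_sum fun j _ => ?_)
  rw [norm_mul]
  exact mul_le_mul_of_nonneg_right (norm_prop_le hm t ξ i j) (norm_nonneg _)

/-- The Fourier transform of the time derivative of the solution. -/
def waveSpecDeriv (m : ℝ) (φ : RealIdx → E3 → ℝ) (t : ℝ) (i : RealIdx) (ξ : E3) : ℂ :=
  ∑ l, sym m ξ i l * waveSpec m φ t l ξ

lemma norm_sym_le' (hm : 0 < m) (ξ : E3) (i j : RealIdx) :
    ‖sym m ξ i j‖ ≤ symConst * (2 * Real.pi + m) * (1 + ‖ξ‖) := by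
  rw [mul_assoc]
  exact (norm_sym_le hm ξ i j).trans
    (mul_le_mul_of_nonneg_left (freq_le hm ξ) symConst_nonneg)

lemma isRapid_sym_mul_waveSpec (hm : 0 < m) (hφ : IsTestVec φ) (t : ℝ) (i l : RealIdx) :
    IsRapid fun ξ => sym m ξ i l * waveSpec m φ t l ξ :=
  (isRapid_waveSpec hm hφ t l).mul_of_le (continuous_sym m i l) fun ξ => norm_sym_le' hm ξ i l

lemma isRapid_waveSpecDeriv (hm : 0 < m) (hφ : IsTestVec φ) (t : ℝ) (i : RealIdx) :
    IsRapid (waveSpecDeriv m φ t i) :=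
  IsRapid.sum fun l _ => isRapid_sym_mul_waveSpec hm hφ t i l

/-- A time independent integrable bound for `waveSpecDeriv`. -/
def waveBound (m : ℝ) (φ : RealIdx → E3 → ℝ) (ξ : E3) : ℝ :=
  ∑ _l : RealIdx, symConst * (2 * Real.pi + m) * (1 + ‖ξ‖) *
    ((1 + symConst) * ∑ j, ‖fourierR (φ j) ξ‖)

lemma norm_waveSpecDeriv_le (hm : 0 < m) (t : ℝ) (i : RealIdx) (ξ : E3) :
    ‖waveSpecDeriv m φ t i ξ‖ ≤ waveBound m φ ξ := by
  refine (norm_sum_le _ _).trans (Finset.sum_le_sum fun l _ => ?_)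
  rw [norm_mul]
  exact mul_le_mul (norm_sym_le' hm ξ i l) (norm_waveSpec_le hm t l ξ) (norm_nonneg _)
    ((norm_nonneg _).trans (norm_sym_le' hm ξ i l))

lemma integrable_waveBound (m : ℝ) (hφ : IsTestVec φ) : Integrable (waveBound m φ) := by
  refine integrable_finsetSum _ fun l _ => ?_
  have h (j) : Integrable fun ξ => (1 + ‖ξ‖) * ‖fourierR (φ j) ξ‖ := by
    have h := isRapid_fourierR (hφ.smooth j) (hφ.compact j)
    have := (h.moment 0).add (h.moment 1)
    refine this.congr (ae_of_all _ fun ξ => ?_)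
    simp; ring
  have := (integrable_finsetSum Finset.univ fun j _ => h j).const_mul
    (symConst * (2 * Real.pi + m) * (1 + symConst))
  refine this.congr (ae_of_all _ fun ξ => ?_)
  simp only [← Finset.mul_sum]; ring

lemma hasDerivAt_wave (hm : 0 < m) (hφ : IsTestVec φ) (t : ℝ) (i : RealIdx) (x : E3) :
    HasDerivAt (fun s => wave m φ s i x) (𝓕⁻ (waveSpecDeriv m φ t i) x) t := by
  refine hasDerivAt_fourierInv (b := waveBound m φ)
    (fun t => (isRapid_waveSpec hm hφ t i).integrable)
    (fun t => (isRapid_waveSpecDeriv hm hφ t i).continuous.aestronglyMeasurable)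
    (integrable_waveBound m hφ) (fun t ξ => norm_waveSpecDeriv_le hm t i ξ) (fun t ξ => ?_) t x
  have := HasDerivAt.fun_sum fun j (_ : j ∈ Finset.univ) =>
    (hasDerivAt_prop hm t ξ i j).mul_const (fourierR (φ j) ξ)
  refine this.congr_deriv ?_
  simp only [Matrix.mul_apply, Finset.sum_mul, waveSpecDeriv, waveSpec, Finset.mul_sum]
  rw [Finset.sum_comm]
  simp only [mul_assoc]

/-- Back in physical space `2πiξₖ` becomes `∂ₖ`. The coefficients are written as real numbers so
that real-linear functionals can later be passed through the system. -/
lemma fourierInv_waveSpecDeriv (hm : 0 < m) (hφ : IsTestVec φ) (t : ℝ) (i : RealIdx) (x : E3) :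
    𝓕⁻ (waveSpecDeriv m φ t i) x
      = ∑ k, ∑ j, (LamR k i j : ℂ) * fderiv ℝ (wave m φ t j) x (EuclideanSpace.single k 1)
        + ∑ j, ((m * Lam0R i j : ℝ) : ℂ) * wave m φ t j x := by
  have hr (j) := isRapid_waveSpec hm hφ t j
  have hk (k : Fin 3) (j : RealIdx) : IsRapid fun ξ =>
      2 * Real.pi * Complex.I * (inner ℝ ξ (EuclideanSpace.single k 1) : ℝ) * waveSpec m φ t j ξ := by
    refine (hr j).mul_of_le (C := 2 * Real.pi) (by fun_prop) fun ξ => ?_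
    simp only [norm_mul, Complex.norm_ofNat, Complex.norm_real, Complex.norm_I, mul_one,
      Real.norm_of_nonneg Real.pi_pos.le]
    gcongr
    refine (norm_inner_le_norm _ _).trans ?_
    simp
  have h1 : waveSpecDeriv m φ t i = fun ξ => ∑ j, (∑ k, (LamR k i j : ℂ) *
      (2 * Real.pi * Complex.I * (inner ℝ ξ (EuclideanSpace.single k 1) : ℝ) * waveSpec m φ t j ξ)
        + ((m * Lam0R i j : ℝ) : ℂ) * waveSpec m φ t j ξ) := by
    funext ξ
    refine Finset.sum_congr rfl fun j _ => ?_
    rw [sym_apply, add_mul, Finset.sum_mul]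
    congr 1
    · refine Finset.sum_congr rfl fun k _ => ?_
      rw [ofReal_LamR]
      simp [EuclideanSpace.inner_single_right]
      ring
    · rw [Complex.ofReal_mul, ofReal_Lam0R]
  rw [h1, fourierInv_sum]
  · rw [Finset.sum_comm, ← Finset.sum_add_distrib]
    refine Finset.sum_congr rfl fun j _ => ?_
    rw [fourierInv_add, fourierInv_sum, fourierInv_const_mul]
    · congr 1
      refine Finset.sum_congr rfl fun k _ => ?_
      rw [fourierInv_const_mul, wave, (hr j).fderiv_fourierInv]
    · exact fun k _ => (hk k j).integrable.const_mul _
    · exact integrable_finsetSum _ fun k _ => (hk k j).integrable.const_mul _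
    · exact (hr j).integrable.const_mul _
  · exact fun j _ => (integrable_finsetSum _ fun k _ => (hk k j).integrable.const_mul _).add
      ((hr j).integrable.const_mul _)

lemma contDiff_wave (hm : 0 < m) (hφ : IsTestVec φ) (t : ℝ) (i : RealIdx) :
    ContDiff ℝ ((⊤ : ℕ∞) : WithTop ℕ∞) (wave m φ t i) :=
  (isRapid_waveSpec hm hφ t i).contDiff_fourierInv

lemma wave_zero (hφ : IsTestVec φ) (i : RealIdx) (x : E3) : wave m φ 0 i x = φ i x := by
  have h : waveSpec m φ 0 i = fourierR (φ i) := by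
    funext ξ
    simp [waveSpec, prop_zero, Matrix.one_apply]
  have hc : Continuous fun x => (φ i x : ℂ) :=
    Complex.continuous_ofReal.comp (hφ.smooth i).continuous
  rw [wave, h, fourierR, hc.fourierInv_fourier_eq
    (hc.integrable_of_hasCompactSupport ((hφ.compact i).comp_left (g := Complex.ofReal) rfl))
    (isRapid_fourierR (hφ.smooth i) (hφ.compact i)).integrable]

lemma norm_wave_le (hm : 0 < m) (hφ : IsTestVec φ) (t : ℝ) (i : RealIdx) (x : E3) :
    ‖wave m φ t i x‖ ≤ ∫ ξ, (1 + symConst) * ∑ j, ‖fourierR (φ j) ξ‖ :=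
  (norm_fourierInv_le _ x).trans (integral_mono (isRapid_waveSpec hm hφ t i).integrable.norm
    ((integrable_finsetSum _ fun j _ =>
      (isRapid_fourierR (hφ.smooth j) (hφ.compact j)).integrable.norm).const_mul _)
    fun ξ => norm_waveSpec_le hm t i ξ)

lemma norm_wave_deriv_le (hm : 0 < m) (hφ : IsTestVec φ) (t : ℝ) (i : RealIdx) (x : E3) :
    ‖𝓕⁻ (waveSpecDeriv m φ t i) x‖ ≤ ∫ ξ, waveBound m φ ξ :=
  (norm_fourierInv_le _ x).trans (integral_mono (isRapid_waveSpecDeriv hm hφ t i).integrable.norm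
    (integrable_waveBound m hφ) fun ξ => norm_waveSpecDeriv_le hm t i ξ)

/-- The mass term in real coordinates. -/
def massR (m : ℝ) (i j : RealIdx) : ℝ := m * Lam0R i j

lemma massR_antisymm (m : ℝ) (i j : RealIdx) : massR m i j = -massR m j i := by
  rw [massR, Lam0R_antisymm, massR, mul_neg]

/-- Real-linear functionals of the complexified solution solve the real Dirac system. -/
lemma firstOrder_clm_wave (hm : 0 < m) (hφ : IsTestVec φ) (L : ℂ →L[ℝ] ℝ) (t : ℝ) (i : RealIdx)
    (x : E3) : firstOrder LamR (massR m) (fun j y => L (wave m φ t j y)) i x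
      = L (𝓕⁻ (waveSpecDeriv m φ t i) x) := by
  rw [fourierInv_waveSpecDeriv hm hφ]
  have hL (a : ℝ) (z : ℂ) : L (a * z) = a * L z := by
    rw [← Complex.real_smul, map_smul, smul_eq_mul]
  simp only [map_add, map_sum, hL, firstOrder, massR]
  congr 1
  refine Finset.sum_congr rfl fun k _ => Finset.sum_congr rfl fun j _ => ?_
  congr 1
  have hd := ((contDiff_wave hm hφ t j).differentiable (by simp) x).hasFDerivAt
  have h : HasFDerivAt (fun y => L (wave m φ t j y)) (L ∘L fderiv ℝ (wave m φ t j) x) x :=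
    L.hasFDerivAt.comp x hd
  rw [h.fderiv]
  rfl

/-- Finite speed of propagation for the components of the solution. -/
lemma clm_wave_eq_zero (hm : 0 < m) (hφ : IsTestVec φ) (L : ℂ →L[ℝ] ℝ) {x₀ : E3} {R : ℝ}
    (hR : 0 < R) (h0 : ∀ i x, dist x x₀ < R → L (φ i x) = 0) {t : ℝ}
    (htR : 2 * (∑ k, ∑ i, ∑ j, |LamR k i j|) * |t| < R) (i : RealIdx) :
    L (wave m φ t i x₀) = 0 := by
  set M1 := ‖L‖ * ∫ ξ, (1 + symConst) * ∑ j, ‖fourierR (φ j) ξ‖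
  set M2 := ‖L‖ * ∫ ξ, waveBound m φ ξ
  have hsm (t i) : ContDiff ℝ 1 fun x => L (wave m φ t i x) :=
    (L.contDiff.comp (contDiff_wave hm hφ t i)).of_le (by exact_mod_cast le_top)
  have hM (t i x) : |L (wave m φ t i x)| ≤ max M1 M2 :=
    ((L.le_opNorm _).trans (mul_le_mul_of_nonneg_left (norm_wave_le hm hφ t i x)
      (norm_nonneg _))).trans (le_max_left _ _)
  have hM' (t i x) : |L (𝓕⁻ (waveSpecDeriv m φ t i) x)| ≤ max M1 M2 :=
    ((L.le_opNorm _).trans (mul_le_mul_of_nonneg_left (norm_wave_deriv_le hm hφ t i x)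
      (norm_nonneg _))).trans (le_max_right _ _)
  have hd (t i x) : HasDerivAt (fun s => L (wave m φ s i x)) (L (𝓕⁻ (waveSpecDeriv m φ t i) x)) t :=
    L.hasFDerivAt.comp_hasDerivAt t (hasDerivAt_wave hm hφ t i x)
  have hz : ∀ i x, dist x x₀ < R → L (wave m φ 0 i x) = 0 := fun i x hx => by
    rw [wave_zero hφ]; exact h0 i x hx
  rcases le_total 0 t with ht | ht
  · rw [abs_of_nonneg ht] at htR
    refine eq_zero_of_symmetric_hyperbolic LamR (massR m) LamR_symm (massR_antisymm m)
      (u := fun t i x => L (wave m φ t i x)) hsm hM ?_ ?_ hR hz ht htR i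
    · intro t i x
      rw [firstOrder_clm_wave hm hφ]; exact hM' t i x
    · intro t i x
      rw [firstOrder_clm_wave hm hφ]; exact hd t i x
  -- Negative times: the reversed solution solves the system with coefficients `-Λₖ` and `-mΛ₀`,
  -- which is again symmetric hyperbolic with the same speed bound.
  · rw [abs_of_nonpos ht] at htR
    have hneg (u : RealIdx → E3 → ℝ) (i x) : firstOrder (fun k i j => -LamR k i j)
        (fun i j => -massR m i j) u i x = -firstOrder LamR (massR m) u i x := by
      simp only [firstOrder, neg_mul, Finset.sum_neg_distrib, neg_add]
    have := eq_zero_of_symmetric_hyperbolic (fun k i j => -LamR k i j) (fun i j => -massR m i j)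
      (fun k i j => by rw [LamR_symm]) (fun i j => by rw [massR_antisymm])
      (u := fun t i x => L (wave m φ (-t) i x)) (fun t i => hsm _ i) (M := max M1 M2)
      (fun t i x => hM _ i x) ?_ ?_ hR (by simpa using hz) (neg_nonneg.2 ht) (by simpa using htR) i
    · simpa using this
    · intro t i x
      rw [hneg, firstOrder_clm_wave hm hφ, abs_neg]; exact hM' _ i x
    · intro t i x
      rw [hneg, firstOrder_clm_wave hm hφ]
      exact ((hd (-t) i x).scomp t (hasDerivAt_neg t)).congr_deriv (by simp)

/-- The imaginary part solves the same real system with zero initial data, so uniqueness applies.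
The radius only has to exceed the distance travelled in time `|t|`. -/
lemma wave_im (hm : 0 < m) (hφ : IsTestVec φ) (t : ℝ) (i : RealIdx) (x : E3) :
    (wave m φ t i x).im = 0 :=
  clm_wave_eq_zero hm hφ Complex.imCLM (x₀ := x)
    (R := 2 * (∑ k, ∑ i, ∑ j, |LamR k i j|) * |t| + 1) (by positivity)
    (fun i x _ => Complex.ofReal_im (φ i x)) (by linarith) i

/-- The real solution. -/
def waveR (m : ℝ) (φ : RealIdx → E3 → ℝ) (t : ℝ) (i : RealIdx) (x : E3) : ℝ := (wave m φ t i x).re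

lemma ofReal_waveR (hm : 0 < m) (hφ : IsTestVec φ) (t : ℝ) (i : RealIdx) (x : E3) :
    (waveR m φ t i x : ℂ) = wave m φ t i x :=
  Complex.ext rfl (by simp [wave_im hm hφ])

/-- On bounded time intervals the solutions are supported in a fixed ball. -/
lemma exists_waveR_eq_zero (hm : 0 < m) (hφ : IsTestVec φ) (T : ℝ) :
    ∃ ρ : ℝ, 0 < ρ ∧ ∀ t, |t| ≤ T → ∀ i x, ρ < ‖x‖ → waveR m φ t i x = 0 := by
  have hb : ∀ i, ∃ r : ℝ, ∀ x, r < ‖x‖ → φ i x = 0 := fun i => by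
    obtain ⟨r, hr⟩ := (hφ.compact i).isCompact.isBounded.subset_closedBall 0
    refine ⟨r, fun x hx => image_eq_zero_of_notMem_tsupport fun h => ?_⟩
    have := hr h
    rw [mem_closedBall_zero_iff] at this
    linarith
  choose r hr using hb
  set S := ∑ k, ∑ i, ∑ j, |LamR k i j|
  have hr' (i) : r i ≤ ∑ i, |r i| := (le_abs_self _).trans
    (Finset.single_le_sum (f := fun i => |r i|) (fun i _ => abs_nonneg _) (Finset.mem_univ i))
  -- The first summand covers the supports of all components of the data, the second the distance
  -- travelled up to time `T`.
  refine ⟨∑ i, |r i| + (2 * S * |T| + 1), by positivity, fun t ht i x hx => ?_⟩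
  refine clm_wave_eq_zero hm hφ Complex.reCLM (x₀ := x) (R := 2 * S * |T| + 1) (by positivity)
    (fun i y hy => ?_) ?_ i
  · rw [hr i y]
    · simp
    · have := norm_sub_norm_le x y
      rw [dist_comm, dist_eq_norm] at hy
      linarith [hr' i]
  · have h1 : |t| ≤ |T| := ht.trans (le_abs_self T)
    have : 2 * S * |t| ≤ 2 * S * |T| := by gcongr
    linarith

lemma isTestVec_waveR (hm : 0 < m) (hφ : IsTestVec φ) (t : ℝ) : IsTestVec (waveR m φ t) where
  smooth i := Complex.reCLM.contDiff.comp (contDiff_wave hm hφ t i)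
  compact i := by
    obtain ⟨ρ, -, h⟩ := exists_waveR_eq_zero hm hφ |t|
    refine HasCompactSupport.intro (isCompact_closedBall 0 ρ) fun x hx => h t le_rfl i x ?_
    simpa using hx

lemma hasDerivAt_waveR (hm : 0 < m) (hφ : IsTestVec φ) (t : ℝ) (i : RealIdx) (x : E3) :
    HasDerivAt (fun s => waveR m φ s i x) (firstOrder LamR (massR m) (waveR m φ t) i x) t := by
  have := firstOrder_clm_wave hm hφ Complex.reCLM t i x
  have h2 := Complex.reCLM.hasFDerivAt.comp_hasDerivAt t (hasDerivAt_wave hm hφ t i x)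
  rw [← this] at h2
  exact h2

lemma abs_firstOrder_waveR_le (hm : 0 < m) (hφ : IsTestVec φ) (t : ℝ) (i : RealIdx) (x : E3) :
    |firstOrder LamR (massR m) (waveR m φ t) i x| ≤ ∫ ξ, waveBound m φ ξ := by
  have := firstOrder_clm_wave hm hφ Complex.reCLM t i x
  have h2 : firstOrder LamR (massR m) (waveR m φ t) i x = (𝓕⁻ (waveSpecDeriv m φ t i) x).re := this
  rw [h2]
  exact (Complex.abs_re_le_norm _).trans (norm_wave_deriv_le hm hφ t i x)

lemma waveR_zero (hφ : IsTestVec φ) : waveR m φ 0 = φ := by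
  funext i x
  rw [waveR, wave_zero hφ, Complex.ofReal_re]

/-- Fourier inversion in this direction needs the solution itself to be integrable in `x`. That
comes from its compact support, hence from finite speed of propagation, and not from smoothness of
the multiplier. -/
lemma fourierR_waveR (hm : 0 < m) (hφ : IsTestVec φ) (t : ℝ) (i : RealIdx) :
    fourierR (waveR m φ t i) = waveSpec m φ t i := by
  have h := isRapid_waveSpec hm hφ t i
  have ht := isTestVec_waveR hm hφ t
  have h1 : (fun x => (waveR m φ t i x : ℂ)) = 𝓕⁻ (waveSpec m φ t i) :=
    funext fun x => ofReal_waveR hm hφ t i x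
  have h2 := (isRapid_fourierR (ht.smooth i) (ht.compact i)).integrable
  rw [fourierR, h1] at h2 ⊢
  refine h.continuous.fourier_fourierInv_eq h.integrable ?_
  have h3 : Integrable (𝓕⁻ (waveSpec m φ t i)) := by
    rw [← h1]
    exact (Complex.continuous_ofReal.comp (ht.smooth i).continuous).integrable_of_hasCompactSupport
      ((ht.compact i).comp_left (g := Complex.ofReal) rfl)
  have h4 : 𝓕 (waveSpec m φ t i) = fun x => 𝓕⁻ (waveSpec m φ t i) (-x) := by
    funext x
    rw [Real.fourierInv_eq_fourier_neg, neg_neg]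
  rw [h4]
  exact h3.comp_neg

end

/-! ### Real coordinates on the spinor space -/

/-- `realComp j` as a continuous linear functional. -/
def realCompL : RealIdx → C4 →L[ℝ] ℝ
  | Sum.inl s => Complex.reCLM.comp ((EuclideanSpace.proj s : C4 →L[ℂ] ℂ).restrictScalars ℝ)
  | Sum.inr s => Complex.imCLM.comp ((EuclideanSpace.proj s : C4 →L[ℂ] ℂ).restrictScalars ℝ)

@[simp] lemma realCompL_apply (j : RealIdx) (v : C4) : realCompL j v = realComp j v := by
  rcases j with j | j <;> rfl

lemma continuous_realComp (j : RealIdx) : Continuous (realComp j) :=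
  (realCompL j).continuous.congr fun v => realCompL_apply j v

lemma norm_sq_eq_sum_realComp (v : C4) : ‖v‖ ^ 2 = ∑ j, realComp j v ^ 2 := by
  rw [EuclideanSpace.norm_sq_eq, Fintype.sum_sum_type fun j => realComp j v ^ 2, ← Finset.sum_add_distrib]
  refine Finset.sum_congr rfl fun s _ => ?_
  rw [← Complex.normSq_eq_norm_sq, Complex.normSq_apply]
  simp [realComp, sq]

lemma abs_realComp_le (j : RealIdx) (v : C4) : |realComp j v| ≤ ‖v‖ := by
  refine abs_le_of_sq_le_sq ?_ (norm_nonneg v)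
  rw [norm_sq_eq_sum_realComp]
  exact Finset.single_le_sum (f := fun j => realComp j v ^ 2) (fun j _ => sq_nonneg _)
    (Finset.mem_univ j)

/-- The spinor with given real coordinates. -/
def ofRealComp (v : RealIdx → ℝ) : C4 :=
  WithLp.toLp 2 fun s => ⟨v (Sum.inl s), v (Sum.inr s)⟩

@[simp] lemma realComp_ofRealComp (v : RealIdx → ℝ) (j : RealIdx) :
    realComp j (ofRealComp v) = v j := by
  rcases j with j | j <;> rfl

/-- The field with given real components. -/
def ofRealField (φ : RealIdx → E3 → ℝ) (x : E3) : C4 := ofRealComp fun i => φ i x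

lemma IsTestVec.isTest {φ : RealIdx → E3 → ℝ} (hφ : IsTestVec φ) : IsTest (ofRealField φ) := by
  constructor
  · rw [contDiff_piLp]
    intro s
    have : (fun x => ofRealField φ x s) = fun x =>
        (φ (Sum.inl s) x : ℂ) + (φ (Sum.inr s) x : ℂ) * Complex.I := by
      funext x
      exact Complex.ext (by simp [ofRealField, ofRealComp]) (by simp [ofRealField, ofRealComp])
    rw [this]
    exact (Complex.ofRealCLM.contDiff.comp (hφ.smooth _)).add
      ((Complex.ofRealCLM.contDiff.comp (hφ.smooth _)).mul contDiff_const)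
  · have : HasCompactSupport fun x => fun i => φ i x := by
      have hc : IsCompact (⋃ i, tsupport (φ i)) := isCompact_iUnion fun i => (hφ.compact i)
      refine HasCompactSupport.intro hc fun x hx => funext fun i => ?_
      exact image_eq_zero_of_notMem_tsupport fun h => hx (Set.mem_iUnion.2 ⟨i, h⟩)
    refine this.comp_left (g := ofRealComp) ?_
    ext s
    exact Complex.ext rfl rfl

/-- The real pairing of a spinor field with a real vector field. -/
def pairingR (v : E3 → C4) (φ : RealIdx → E3 → ℝ) : ℝ := ∑ j, ∫ x, realComp j (v x) * φ j x

lemma pairing_ofRealField (v : E3 → C4) (φ : RealIdx → E3 → ℝ) :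
    pairing v (ofRealField φ) = pairingR v φ := by
  simp [pairing, pairingR, ofRealField]

/-- Identifies the adjoint generator of the weak formulation with the system solved by `waveR`. -/
lemma realComp_adjointGenerator (m : ℝ) {φ : RealIdx → E3 → ℝ} (hφ : IsTestVec φ) (i : RealIdx)
    (x : E3) : realComp i (adjointGenerator m (ofRealField φ) x)
      = firstOrder LamR (massR m) φ i x := by
  have hd : DifferentiableAt ℝ (ofRealField φ) x := hφ.isTest.1.differentiable (by simp) x
  have hf (j : RealIdx) (v : E3) :
      realComp j (fderiv ℝ (ofRealField φ) x v) = fderiv ℝ (φ j) x v := by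
    have h : HasFDerivAt (fun y => realCompL j (ofRealField φ y))
        (realCompL j ∘L fderiv ℝ (ofRealField φ) x) x :=
      (realCompL j).hasFDerivAt.comp x hd.hasFDerivAt
    have h2 : (fun y => realCompL j (ofRealField φ y)) = φ j := by
      funext y; simp [ofRealField]
    rw [h2] at h
    rw [h.fderiv]
    simp
  rw [adjointGenerator, ← realCompL_apply, map_add, map_sum]
  simp only [realCompL_apply, realComp_mulVec_alpha, realComp_I_smul_beta, hf, firstOrder]
  congr 1
  rw [Finset.mul_sum]
  refine Finset.sum_congr rfl fun j _ => ?_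
  rw [massR, ofRealField, realComp_ofRealComp, mul_assoc]

lemma MemH.realComp {v : E3 → C4} (hv : MemH v) (j : RealIdx) (R : ℝ) :
    MemLp (fun x => realComp j (v x)) 2 (volume.restrict (Metric.ball 0 R)) := by
  refine (hv R).of_le ((continuous_realComp j).comp_aestronglyMeasurable (hv R).1)
    (ae_of_all _ fun x => ?_)
  rw [Real.norm_eq_abs]
  exact abs_realComp_le j _

/-! ### Duality between the solutions and the adjoint evolution -/

lemma integral_mul_eq_ball {f g : E3 → ℝ} {ρ : ℝ} (hg : ∀ x, x ∉ Metric.ball 0 ρ → g x = 0) :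
    ∫ x, f x * g x = ∫ x in Metric.ball 0 ρ, f x * g x :=
  (setIntegral_eq_integral_of_forall_compl_eq_zero fun x hx => by rw [hg x hx, mul_zero]).symm

lemma integrable_mul_of_ball {f g : E3 → ℝ} {ρ : ℝ}
    (hf : MemLp f 2 (volume.restrict (Metric.ball 0 ρ)))
    (hg : Continuous g) (hg0 : ∀ x, x ∉ Metric.ball 0 ρ → g x = 0) :
    Integrable fun x => f x * g x := by
  have hgm : HasCompactSupport g := HasCompactSupport.intro (isCompact_closedBall 0 ρ)
    fun x hx => hg0 x fun h => hx (Metric.ball_subset_closedBall h)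
  obtain ⟨K, hK⟩ := hg.bounded_above_of_compact_support hgm
  have h1 : IntegrableOn (fun x => f x * g x) (Metric.ball 0 ρ) := by
    have : IsFiniteMeasure (volume.restrict (Metric.ball (0 : E3) ρ)) := ⟨by
      rw [Measure.restrict_apply_univ]; exact measure_ball_lt_top⟩
    exact (hf.integrable one_le_two).mul_bdd hg.aestronglyMeasurable (ae_of_all _ hK)
  refine (integrableOn_iff_integrable_of_support_subset fun x hx => ?_).1 h1
  by_contra h
  exact hx (by simp [hg0 x h])

/-- Half of a product rule in which `f` need not be differentiable: the second factor vanishes at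
`s₀`, so continuity of `f` in local `L²` is enough. -/
lemma hasDerivAt_integral_mul_sub {f v : ℝ → E3 → ℝ} {v' : E3 → ℝ} {s₀ ρ K : ℝ}
    (hf : ∀ s, MemLp (f s) 2 (volume.restrict (Metric.ball 0 ρ)))
    (hfc : Tendsto (fun s => eLpNorm (f s - f s₀) 2 (volume.restrict (Metric.ball 0 ρ)))
      (𝓝 s₀) (𝓝 0))
    (hv : ∀ s, Continuous (v s))
    (hv0 : ∀ᶠ s in 𝓝 s₀, ∀ x, x ∉ Metric.ball 0 ρ → v s x = 0)
    (hvd : ∀ x, HasDerivAt (fun s => v s x) (v' x) s₀)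
    (hK : ∀ s x, |v s x - v s₀ x| ≤ K * |s - s₀|) :
    HasDerivAt (fun s => ∫ x, f s x * (v s x - v s₀ x)) (∫ x, f s₀ x * v' x) s₀ := by
  set μ := volume.restrict (Metric.ball (0 : E3) ρ)
  have hfin : IsFiniteMeasure μ := ⟨by
    rw [Measure.restrict_apply_univ]; exact measure_ball_lt_top⟩
  have hf1 (s) : Integrable (f s) μ := (hf s).integrable one_le_two
  have hv00 : ∀ x, x ∉ Metric.ball 0 ρ → v s₀ x = 0 := hv0.self_of_nhds
  have hv'0 : ∀ x, x ∉ Metric.ball 0 ρ → v' x = 0 := fun x hx => by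
    refine (hvd x).unique ((hasDerivAt_const s₀ (0 : ℝ)).congr_of_eventuallyEq ?_)
    filter_upwards [hv0] with s hs using hs x hx
  let q (s : ℝ) (x : E3) := (s - s₀)⁻¹ * (v s x - v s₀ x)
  have hqc (s) : Continuous (q s) := continuous_const.mul ((hv s).sub (hv s₀))
  have hqK (s x) : ‖q s x‖ ≤ |K| := by
    rw [Real.norm_eq_abs, abs_mul, abs_inv]
    rcases eq_or_ne s s₀ with rfl | hs
    · simp
    · have : 0 < |s - s₀| := abs_pos.2 (sub_ne_zero.2 hs)
      rw [inv_mul_le_iff₀ this, mul_comm]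
      exact (hK s x).trans (mul_le_mul_of_nonneg_right (le_abs_self K) (abs_nonneg _))
  have hqi (s r) : Integrable (fun x => f r x * q s x) μ :=
    (hf1 r).mul_bdd (hqc s).aestronglyMeasurable (ae_of_all _ (hqK s))
  rw [hasDerivAt_iff_tendsto_slope]
  -- Write `f s = (f s - f s₀) + f s₀`. The difference quotients are bounded by `|K|`, so the first
  -- part is controlled by the `L²` norm on the ball and the second converges by domination.
  have hslope : ∀ᶠ s in 𝓝[≠] s₀, slope (fun s => ∫ x, f s x * (v s x - v s₀ x)) s₀ s
      = ∫ x, (f s x - f s₀ x) * q s x ∂μ + ∫ x, f s₀ x * q s x ∂μ := by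
    filter_upwards [nhdsWithin_le_nhds hv0] with s hs
    rw [← integral_add (((hqi s s).sub (hqi s s₀)).congr (ae_of_all _ fun x => by simp; ring))
      (hqi s s₀), slope_def_field]
    simp only [sub_self, mul_zero, integral_zero, sub_zero]
    rw [integral_mul_eq_ball (ρ := ρ) fun x hx => by rw [hs x hx, hv00 x hx, sub_zero],
      div_eq_inv_mul, ← integral_const_mul]
    refine integral_congr_ae (ae_of_all _ fun x => ?_)
    simp only [q]; ring
  refine Tendsto.congr' (hslope.mono fun s hs => hs.symm) ?_
  rw [← zero_add (∫ x, f s₀ x * v' x)]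
  refine Tendsto.add ?_ ?_
  · have hle (s) : ‖∫ x, (f s x - f s₀ x) * q s x ∂μ‖
        ≤ |K| * (eLpNorm (f s - f s₀) 2 μ * (μ Set.univ) ^ (1 / 2 : ℝ)).toReal := by
      have hm : AEStronglyMeasurable (f s - f s₀) μ := ((hf s).sub (hf s₀)).1
      have h1 : ‖∫ x, (f s x - f s₀ x) * q s x ∂μ‖ ≤ |K| * ∫ x, ‖f s x - f s₀ x‖ ∂μ := by
        rw [← integral_const_mul]
        refine norm_integral_le_of_norm_le (((hf1 s).sub (hf1 s₀)).norm.const_mul _)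
          (ae_of_all _ fun x => ?_)
        rw [norm_mul, mul_comm]
        exact mul_le_mul_of_nonneg_right (hqK s x) (norm_nonneg _)
      refine h1.trans (mul_le_mul_of_nonneg_left ?_ (abs_nonneg _))
      have h2 := eLpNorm_le_eLpNorm_mul_rpow_measure_univ (p := 1) (q := 2) one_le_two hm
      norm_num at h2
      have h3 : ∫ x, ‖f s x - f s₀ x‖ ∂μ = (eLpNorm (f s - f s₀) 1 μ).toReal := by
        rw [eLpNorm_one_eq_lintegral_enorm]
        exact integral_norm_eq_lintegral_enorm hm
      rw [h3]
      refine ENNReal.toReal_mono ?_ (by simpa using h2)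
      refine ENNReal.mul_ne_top ((hf s).sub (hf s₀)).2.ne ?_
      exact ENNReal.rpow_ne_top_of_nonneg (by norm_num) (measure_ne_top μ _)
    have ht : Tendsto (fun s => |K| * (eLpNorm (f s - f s₀) 2 μ *
        (μ Set.univ) ^ (1 / 2 : ℝ)).toReal) (𝓝[≠] s₀) (𝓝 0) := by
      have h1 : Tendsto (fun s => eLpNorm (f s - f s₀) 2 μ * (μ Set.univ) ^ (1 / 2 : ℝ))
          (𝓝[≠] s₀) (𝓝 0) := by
        have := ENNReal.Tendsto.mul_const (b := (μ Set.univ) ^ (1 / 2 : ℝ))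
          (hfc.mono_left (nhdsWithin_le_nhds (s := {s₀}ᶜ)))
          (Or.inr (ENNReal.rpow_ne_top_of_nonneg (by norm_num) (measure_ne_top μ _)))
        simpa using this
      have h2 := (ENNReal.tendsto_toReal ENNReal.zero_ne_top).comp h1
      simpa using h2.const_mul |K|
    exact squeeze_zero_norm hle ht
  · rw [integral_mul_eq_ball hv'0]
    refine tendsto_integral_filter_of_dominated_convergence (fun x => ‖f s₀ x‖ * |K|)
      (Eventually.of_forall fun s => (hqi s s₀).1) (Eventually.of_forall fun s => ae_of_all _ fun x => ?_)
      ((hf1 s₀).norm.mul_const _) (ae_of_all _ fun x => ?_)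
    · rw [norm_mul]
      exact mul_le_mul_of_nonneg_left (hqK s x) (norm_nonneg _)
    · refine Tendsto.const_mul _ ?_
      refine (hasDerivAt_iff_tendsto_slope.1 (hvd x)).congr fun s => ?_
      rw [slope_def_field, div_eq_inv_mul]

/-- The solutions are dual to the adjoint evolution of test fields. -/
theorem pairingR_eq_of_isSolution {m : ℝ} (hm : 0 < m) {ψ₀ : E3 → C4} {ψ : ℝ → E3 → C4}
    (hψ : IsSolution m ψ₀ ψ) {φ : RealIdx → E3 → ℝ} (hφ : IsTestVec φ) (t : ℝ) :
    pairingR (ψ t) φ = pairingR ψ₀ (waveR m φ t) := by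
  set u := waveR m φ
  have hu (t) : IsTestVec (u t) := isTestVec_waveR hm hφ t
  -- The pairing of `ψ s` with the field evolved for the remaining time `t - s` is constant; its
  -- values at `s = t` and `s = 0` are the two sides. The derivative is split into the weak equation
  -- with the test field frozen (`h1`) and the motion of the test field (`h2`), which cancel.
  have hderiv (s₀ : ℝ) : HasDerivAt (fun s => pairingR (ψ s) (u (t - s))) 0 s₀ := by
    obtain ⟨ρ, hρ, hzero⟩ := exists_waveR_eq_zero hm hφ (|t - s₀| + 1)
    have hz : ∀ᶠ s in 𝓝 s₀, ∀ i x, x ∉ Metric.ball 0 (ρ + 1) → u (t - s) i x = 0 := by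
      filter_upwards [Metric.ball_mem_nhds s₀ one_pos] with s hs i x hx
      refine hzero (t - s) ?_ i x ?_
      · rw [Metric.mem_ball, dist_comm, Real.dist_eq] at hs
        have := abs_add_le (t - s₀) (s₀ - s)
        simp only [sub_add_sub_cancel] at this
        linarith
      · rw [mem_ball_zero_iff, not_lt] at hx
        linarith
    have hz0 : ∀ i x, x ∉ Metric.ball 0 (ρ + 1) → u (t - s₀) i x = 0 := hz.self_of_nhds
    have h1 : HasDerivAt (fun s => pairingR (ψ s) (u (t - s₀)))
        (pairingR (ψ s₀) (firstOrder LamR (massR m) (u (t - s₀)))) s₀ := by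
      have := hψ.equation _ (hu (t - s₀)).isTest s₀
      simp only [pairing_ofRealField] at this
      refine this.congr_deriv ?_
      simp only [pairing, pairingR, realComp_adjointGenerator m (hu (t - s₀))]
    have h2 (i : RealIdx) : HasDerivAt
        (fun s => ∫ x, realComp i (ψ s x) * (u (t - s) i x - u (t - s₀) i x))
        (∫ x, realComp i (ψ s₀ x) * (-firstOrder LamR (massR m) (u (t - s₀)) i x)) s₀ := by
      refine hasDerivAt_integral_mul_sub (ρ := ρ + 1) (K := ∫ ξ, waveBound m φ ξ)
        (fun s => (hψ.memH s).realComp i _) ?_ (fun s => ((hu _).smooth i).continuous)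
        (hz.mono fun s hs => hs i) (fun x => ?_) fun s x => ?_
      · refine tendsto_of_tendsto_of_tendsto_of_le_of_le tendsto_const_nhds
          (hψ.continuous_H (ρ + 1) s₀) (fun s => zero_le) fun s => ?_
        refine eLpNorm_mono fun x => ?_
        simp only [Pi.sub_apply, ← realCompL_apply, ← map_sub]
        rw [realCompL_apply]
        exact abs_realComp_le i _
      · have := (hasDerivAt_waveR hm hφ (t - s₀) i x).scomp s₀ ((hasDerivAt_id s₀).const_sub t)
        exact this.congr_deriv (by simp [u])
      · have := Convex.norm_image_sub_le_of_norm_hasDerivWithin_le (s := Set.univ)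
          (f := fun s => u s i x) (C := ∫ ξ, waveBound m φ ξ)
          (fun s _ => (hasDerivAt_waveR hm hφ s i x).hasDerivWithinAt)
          (fun s _ => abs_firstOrder_waveR_le hm hφ s i x) convex_univ
          (Set.mem_univ (t - s₀)) (Set.mem_univ (t - s))
        simpa [Real.norm_eq_abs, abs_sub_comm] using this
    have h3 := h1.add (HasDerivAt.fun_sum fun i (_ : i ∈ Finset.univ) => h2 i)
    have h4 : pairingR (ψ s₀) (firstOrder LamR (massR m) (u (t - s₀))) +
        ∑ i, ∫ x, realComp i (ψ s₀ x) * (-firstOrder LamR (massR m) (u (t - s₀)) i x) = 0 := by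
      simp only [pairingR, mul_neg, integral_neg, Finset.sum_neg_distrib, add_neg_cancel]
    rw [h4] at h3
    refine h3.congr_of_eventuallyEq ?_
    filter_upwards [hz] with s hs
    simp only [pairingR, Pi.add_apply, ← Finset.sum_add_distrib]
    refine Finset.sum_congr rfl fun i _ => ?_
    have hmem := (hψ.memH s).realComp i (ρ + 1)
    have hc (r) : Continuous (u r i) := ((hu r).smooth i).continuous
    rw [← integral_add (integrable_mul_of_ball hmem (hc _) (hz0 i))
      (integrable_mul_of_ball (g := fun x => u (t - s) i x - u (t - s₀) i x) hmem
        ((hc _).sub (hc _)) fun x hx => by rw [hs i x hx, hz0 i x hx, sub_zero])]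
    refine integral_congr_ae (ae_of_all _ fun x => ?_)
    simp only; ring
  have hconst := is_const_of_deriv_eq_zero (fun s => (hderiv s).differentiableAt)
    (fun s => (hderiv s).deriv) t 0
  simp only [sub_self, sub_zero] at hconst
  rw [show u 0 = φ from waveR_zero hφ] at hconst
  rw [hconst]
  refine Finset.sum_congr rfl fun i _ => integral_congr_ae ?_
  filter_upwards [hψ.initial] with x hx
  rw [hx]

/-! ### Covariances under uniform mixing -/

section Mixing

variable {Ω : Type*} [MeasurableSpace Ω] {P : Measure Ω} [IsProbabilityMeasure P]
  {X Y : Ω → ℝ}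

lemma measureReal_preimage_finset_inter (hX : Measurable X) (s : Finset ℝ) (f : SimpleFunc ℝ ℝ)
    {B : Set Ω} (hB : MeasurableSet B) :
    P.real (X ⁻¹' (f ⁻¹' (s : Set ℝ)) ∩ B) = ∑ a ∈ s, P.real (X ⁻¹' (f ⁻¹' {a}) ∩ B) := by
  rw [← measureReal_biUnion_finset]
  · congr 1
    ext ω
    simp
  · intro a _ b _ hab
    refine Disjoint.mono Set.inter_subset_left Set.inter_subset_left ?_
    exact Disjoint.preimage _ (Disjoint.preimage _ (by simpa using hab))
  · exact fun a _ => (hX (f.measurableSet_fiber a)).inter hB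

lemma preimage_range_eq_univ (f : SimpleFunc ℝ ℝ) : f ⁻¹' (f.range : Set ℝ) = Set.univ := by
  ext x; simp

lemma integral_simple_pair (hX : Measurable X) (hY : Measurable Y) (f g : SimpleFunc ℝ ℝ)
    (h : ℝ → ℝ → ℝ) : ∫ ω, h (f (X ω)) (g (Y ω)) ∂P
      = ∑ a ∈ f.range, ∑ b ∈ g.range, h a b * P.real (X ⁻¹' (f ⁻¹' {a}) ∩ Y ⁻¹' (g ⁻¹' {b})) := by
  classical
  have hm (a b : ℝ) : MeasurableSet (X ⁻¹' (f ⁻¹' {a}) ∩ Y ⁻¹' (g ⁻¹' {b})) :=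
    (hX (f.measurableSet_fiber a)).inter (hY (g.measurableSet_fiber b))
  have hpt (ω : Ω) : h (f (X ω)) (g (Y ω)) = ∑ a ∈ f.range, ∑ b ∈ g.range,
      (X ⁻¹' (f ⁻¹' {a}) ∩ Y ⁻¹' (g ⁻¹' {b})).indicator (fun _ => h a b) ω := by
    rw [Finset.sum_eq_single (f (X ω)), Finset.sum_eq_single (g (Y ω))]
    · rw [Set.indicator_of_mem]
      simp
    · intro b _ hb
      rw [Set.indicator_of_notMem]
      simp [hb.symm]
    · intro hb; exact absurd (g.mem_range_self _) hb
    · intro a _ ha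
      refine Finset.sum_eq_zero fun b _ => ?_
      rw [Set.indicator_of_notMem]
      simp [ha.symm]
    · intro hb; exact absurd (f.mem_range_self _) hb
  have hi (a b : ℝ) : Integrable
      ((X ⁻¹' (f ⁻¹' {a}) ∩ Y ⁻¹' (g ⁻¹' {b})).indicator (fun _ => h a b)) P :=
    (integrable_const _).indicator (hm a b)
  simp_rw [hpt]
  rw [integral_finsetSum _ fun a _ => integrable_finsetSum _ fun b _ => hi a b]
  refine Finset.sum_congr rfl fun a _ => ?_
  rw [integral_finsetSum _ fun b _ => hi a b]
  refine Finset.sum_congr rfl fun b _ => ?_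
  rw [integral_indicator_const _ (hm a b), smul_eq_mul, mul_comm]

/-- `σ(X)` and `σ(Y)` are uniformly mixing with coefficient `κ`. -/
def IsMixingPair (P : Measure Ω) (X Y : Ω → ℝ) (κ : ℝ) : Prop :=
  ∀ S T : Set ℝ, MeasurableSet S → MeasurableSet T →
    |P.real (X ⁻¹' S ∩ Y ⁻¹' T) - P.real (X ⁻¹' S) * P.real (Y ⁻¹' T)| ≤ κ * P.real (Y ⁻¹' T)

/-- Values `a` with deviations of one sign combine into a single event for `X`, to which mixing
applies once. The two signs give the factor 2. -/
lemma sum_abs_le_of_mixing (hX : Measurable X) (hY : Measurable Y) {κ : ℝ}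
    (hκ : IsMixingPair P X Y κ) (f : SimpleFunc ℝ ℝ) {T : Set ℝ} (hT : MeasurableSet T) :
    ∑ a ∈ f.range, |P.real (X ⁻¹' (f ⁻¹' {a}) ∩ Y ⁻¹' T)
      - P.real (X ⁻¹' (f ⁻¹' {a})) * P.real (Y ⁻¹' T)| ≤ 2 * κ * P.real (Y ⁻¹' T) := by
  set d : ℝ → ℝ := fun a => P.real (X ⁻¹' (f ⁻¹' {a}) ∩ Y ⁻¹' T)
      - P.real (X ⁻¹' (f ⁻¹' {a})) * P.real (Y ⁻¹' T)
  have hsum (s : Finset ℝ) : |∑ a ∈ s, d a| ≤ κ * P.real (Y ⁻¹' T) := by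
    have h1 := measureReal_preimage_finset_inter (P := P) hX s f (hY hT)
    have h2 := measureReal_preimage_finset_inter (P := P) hX s f MeasurableSet.univ
    simp only [Set.inter_univ] at h2
    simp only [d]
    rw [Finset.sum_sub_distrib, ← Finset.sum_mul, ← h1, ← h2]
    exact hκ _ _ (f.measurableSet_preimage _) hT
  rw [← Finset.sum_filter_add_sum_filter_not f.range fun a => 0 ≤ d a]
  have h1 : ∑ a ∈ f.range with 0 ≤ d a, |d a| = ∑ a ∈ f.range with 0 ≤ d a, d a :=
    Finset.sum_congr rfl fun a ha => abs_of_nonneg (Finset.mem_filter.1 ha).2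
  have h2 : ∑ a ∈ f.range with ¬ 0 ≤ d a, |d a| = -∑ a ∈ f.range with ¬ 0 ≤ d a, d a := by
    rw [← Finset.sum_neg_distrib]
    exact Finset.sum_congr rfl fun a ha => abs_of_neg (not_le.1 (Finset.mem_filter.1 ha).2)
  rw [h1, h2]
  have h3 := (abs_le.1 (hsum {a ∈ f.range | 0 ≤ d a})).2
  have h4 := (abs_le.1 (hsum {a ∈ f.range | ¬ 0 ≤ d a})).1
  linarith

/-- The covariance is `∑ a b d(a,b)`, with `d` the difference between the joint law and the product
of the marginals. Cauchy–Schwarz with weights `|d|` leaves `∑ a²|d|`, bounded trivially by `2 E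
f(X)²`, and `∑ b²|d|`, bounded through mixing by `2κ E g(Y)²`. -/
lemma cov_simple_sq_le (hX : Measurable X) (hY : Measurable Y) {κ : ℝ}
    (hκ : IsMixingPair P X Y κ) (f g : SimpleFunc ℝ ℝ) :
    (∫ ω, f (X ω) * g (Y ω) ∂P - (∫ ω, f (X ω) ∂P) * ∫ ω, g (Y ω) ∂P) ^ 2
      ≤ 4 * κ * (∫ ω, f (X ω) ^ 2 ∂P) * ∫ ω, g (Y ω) ^ 2 ∂P := by
  set pa : ℝ → ℝ := fun a => P.real (X ⁻¹' (f ⁻¹' {a}))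
  set pb : ℝ → ℝ := fun b => P.real (Y ⁻¹' (g ⁻¹' {b}))
  set pab : ℝ → ℝ → ℝ := fun a b => P.real (X ⁻¹' (f ⁻¹' {a}) ∩ Y ⁻¹' (g ⁻¹' {b}))
  have hA (a) : MeasurableSet (X ⁻¹' (f ⁻¹' {a})) := hX (f.measurableSet_fiber a)
  have hB (b) : MeasurableSet (Y ⁻¹' (g ⁻¹' {b})) := hY (g.measurableSet_fiber b)
  have hpa (a) : ∑ b ∈ g.range, pab a b = pa a := by
    have := measureReal_preimage_finset_inter (P := P) hY g.range g (hA a)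
    rw [preimage_range_eq_univ, Set.preimage_univ, Set.univ_inter] at this
    simp only [pa, pab]
    rw [this]
    exact Finset.sum_congr rfl fun b _ => by rw [Set.inter_comm]
  have hpb (b) : ∑ a ∈ f.range, pab a b = pb b := by
    have := measureReal_preimage_finset_inter (P := P) hX f.range f (hB b)
    rw [preimage_range_eq_univ, Set.preimage_univ, Set.univ_inter] at this
    exact this.symm
  have hpa1 : ∑ a ∈ f.range, pa a = 1 := by
    have := measureReal_preimage_finset_inter (P := P) hX f.range f MeasurableSet.univ
    rw [preimage_range_eq_univ, Set.preimage_univ, Set.univ_inter] at this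
    simpa using this.symm
  have hpb1 : ∑ b ∈ g.range, pb b = 1 := by
    have := measureReal_preimage_finset_inter (P := P) hY g.range g MeasurableSet.univ
    rw [preimage_range_eq_univ, Set.preimage_univ, Set.univ_inter] at this
    simpa using this.symm
  have hf (h : ℝ → ℝ) : ∫ ω, h (f (X ω)) ∂P = ∑ a ∈ f.range, h a * pa a := by
    rw [integral_simple_pair hX hY f g fun a _ => h a]
    exact Finset.sum_congr rfl fun a _ => by rw [← hpa, Finset.mul_sum]
  have hg (h : ℝ → ℝ) : ∫ ω, h (g (Y ω)) ∂P = ∑ b ∈ g.range, h b * pb b := by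
    rw [integral_simple_pair hX hY f g fun _ b => h b, Finset.sum_comm]
    exact Finset.sum_congr rfl fun b _ => by rw [← hpb, Finset.mul_sum]
  set d : ℝ → ℝ → ℝ := fun a b => pab a b - pa a * pb b
  have hcov : ∫ ω, f (X ω) * g (Y ω) ∂P - (∫ ω, f (X ω) ∂P) * ∫ ω, g (Y ω) ∂P
      = ∑ p ∈ f.range ×ˢ g.range, p.1 * p.2 * d p.1 p.2 := by
    rw [integral_simple_pair hX hY f g fun a b => a * b, hf fun a => a, hg fun b => b,
      Finset.sum_mul_sum, Finset.sum_product, ← Finset.sum_sub_distrib]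
    refine Finset.sum_congr rfl fun a _ => ?_
    rw [← Finset.sum_sub_distrib]
    exact Finset.sum_congr rfl fun b _ => by simp only [d, pab]; ring
  have hpa0 (a) : 0 ≤ pa a := measureReal_nonneg
  have hpb0 (b) : 0 ≤ pb b := measureReal_nonneg
  have hpab0 (a b) : 0 ≤ pab a b := measureReal_nonneg
  have h1 : ∑ p ∈ f.range ×ˢ g.range, p.1 ^ 2 * |d p.1 p.2| ≤ 2 * ∫ ω, f (X ω) ^ 2 ∂P := by
    rw [hf fun a => a ^ 2, Finset.sum_product, Finset.mul_sum]
    refine Finset.sum_le_sum fun a _ => ?_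
    simp only
    rw [← Finset.mul_sum, mul_left_comm]
    refine mul_le_mul_of_nonneg_left ?_ (sq_nonneg a)
    calc ∑ b ∈ g.range, |d a b| ≤ ∑ b ∈ g.range, (pab a b + pa a * pb b) :=
          Finset.sum_le_sum fun b _ => (abs_sub _ _).trans (le_of_eq (by
            rw [abs_of_nonneg (hpab0 a b), abs_of_nonneg (mul_nonneg (hpa0 a) (hpb0 b))]))
      _ = 2 * pa a := by
          rw [Finset.sum_add_distrib, hpa, ← Finset.mul_sum, hpb1]; ring
  have h2 : ∑ p ∈ f.range ×ˢ g.range, p.2 ^ 2 * |d p.1 p.2| ≤ 2 * κ * ∫ ω, g (Y ω) ^ 2 ∂P := by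
    rw [hg fun b => b ^ 2, Finset.sum_product_right, Finset.mul_sum]
    refine Finset.sum_le_sum fun b _ => ?_
    simp only
    rw [← Finset.mul_sum, mul_left_comm]
    refine mul_le_mul_of_nonneg_left ?_ (sq_nonneg b)
    exact sum_abs_le_of_mixing hX hY hκ f (g.measurableSet_fiber b)
  have h3 : (∑ p ∈ f.range ×ˢ g.range, p.1 * p.2 * d p.1 p.2) ^ 2
      ≤ (∑ p ∈ f.range ×ˢ g.range, p.1 ^ 2 * |d p.1 p.2|)
        * ∑ p ∈ f.range ×ˢ g.range, p.2 ^ 2 * |d p.1 p.2| :=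
    Finset.sum_sq_le_sum_mul_sum_of_sq_le_mul _
      (fun p _ => mul_nonneg (sq_nonneg _) (abs_nonneg _))
      (fun p _ => mul_nonneg (sq_nonneg _) (abs_nonneg _))
      (fun p _ => le_of_eq (by rw [mul_pow, mul_pow, ← sq_abs (d _ _)]; ring))
  rw [hcov]
  refine h3.trans ((mul_le_mul h1 h2 (Finset.sum_nonneg fun p _ =>
    mul_nonneg (sq_nonneg _) (abs_nonneg _)) ?_).trans (le_of_eq (by ring)))
  exact mul_nonneg zero_le_two (integral_nonneg fun ω => sq_nonneg _)

/-- The covariance inequality for uniformly mixing random variables. -/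
theorem cov_sq_le_of_mixing (hX : Measurable X) (hY : Measurable Y) (hX2 : MemLp X 2 P)
    (hY2 : MemLp Y 2 P) {κ : ℝ} (hκ : IsMixingPair P X Y κ) :
    (∫ ω, X ω * Y ω ∂P - (∫ ω, X ω ∂P) * ∫ ω, Y ω ∂P) ^ 2
      ≤ 4 * κ * (∫ ω, X ω ^ 2 ∂P) * ∫ ω, Y ω ^ 2 ∂P := by
  -- Simple approximations of the identity of `ℝ` with `|f n x| ≤ 2|x|`. Composing them with `X` and
  -- `Y` keeps the mixing hypothesis untouched, and all moments converge by domination.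
  let f (n : ℕ) : SimpleFunc ℝ ℝ :=
    SimpleFunc.approxOn (id : ℝ → ℝ) measurable_id Set.univ 0 (Set.mem_univ _) n
  have hfl (x : ℝ) : Tendsto (fun n => f n x) atTop (𝓝 x) :=
    SimpleFunc.tendsto_approxOn measurable_id (Set.mem_univ _) (by simp)
  have hfb (n : ℕ) (x : ℝ) : ‖f n x‖ ≤ 2 * ‖x‖ := by
    have := SimpleFunc.norm_approxOn_zero_le (f := (id : ℝ → ℝ)) measurable_id
      (s := Set.univ) (Set.mem_univ _) x n
    simpa [two_mul] using this
  have hm1 (Z : Ω → ℝ) (hZ : Measurable Z) (n : ℕ) : Measurable fun ω => f n (Z ω) :=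
    (f n).measurable.comp hZ
  have hlim1 (Z : Ω → ℝ) (hZ : Measurable Z) (hZ2 : MemLp Z 2 P) :
      Tendsto (fun n => ∫ ω, f n (Z ω) ∂P) atTop (𝓝 (∫ ω, Z ω ∂P)) :=
    tendsto_integral_of_dominated_convergence (fun ω => 2 * ‖Z ω‖)
      (fun n => (hm1 Z hZ n).aestronglyMeasurable)
      ((hZ2.integrable one_le_two).norm.const_mul 2)
      (fun n => ae_of_all _ fun ω => hfb n _) (ae_of_all _ fun ω => hfl _)
  have hlim2 (Z : Ω → ℝ) (hZ : Measurable Z) (hZ2 : MemLp Z 2 P) :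
      Tendsto (fun n => ∫ ω, f n (Z ω) ^ 2 ∂P) atTop (𝓝 (∫ ω, Z ω ^ 2 ∂P)) :=
    tendsto_integral_of_dominated_convergence (fun ω => 4 * Z ω ^ 2)
      (fun n => ((hm1 Z hZ n).pow_const 2).aestronglyMeasurable) (hZ2.integrable_sq.const_mul 4)
      (fun n => ae_of_all _ fun ω => by
        rw [norm_pow]
        refine (pow_le_pow_left₀ (norm_nonneg _) (hfb n (Z ω)) 2).trans (le_of_eq ?_)
        rw [mul_pow, Real.norm_eq_abs, sq_abs]; norm_num)
      (ae_of_all _ fun ω => (hfl _).pow 2)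
  have hlim3 : Tendsto (fun n => ∫ ω, f n (X ω) * f n (Y ω) ∂P) atTop
      (𝓝 (∫ ω, X ω * Y ω ∂P)) :=
    tendsto_integral_of_dominated_convergence (fun ω => 4 * ‖X ω * Y ω‖)
      (fun n => ((hm1 X hX n).mul (hm1 Y hY n)).aestronglyMeasurable)
      ((hX2.integrable_mul hY2).norm.const_mul 4)
      (fun n => ae_of_all _ fun ω => by
        rw [norm_mul, norm_mul]
        refine (mul_le_mul (hfb n _) (hfb n _) (norm_nonneg _) (by positivity)).trans
          (le_of_eq (by ring)))
      (ae_of_all _ fun ω => (hfl _).mul (hfl _))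
  exact le_of_tendsto_of_tendsto' ((hlim3.sub ((hlim1 X hX hX2).mul (hlim1 Y hY hY2))).pow 2)
    (((hlim2 X hX hX2).const_mul (4 * κ)).mul (hlim2 Y hY hY2))
    fun n => cov_simple_sq_le hX hY hκ (f n) (f n)

/-- Random functions are measurable for the completed product only, so their smearings are merely
a.e. measurable. -/
theorem cov_sq_le_of_mixing₀ (hX : AEMeasurable X P) (hY : AEMeasurable Y P) (hX2 : MemLp X 2 P)
    (hY2 : MemLp Y 2 P) {κ : ℝ} (hκ : IsMixingPair P X Y κ) :
    (∫ ω, X ω * Y ω ∂P - (∫ ω, X ω ∂P) * ∫ ω, Y ω ∂P) ^ 2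
      ≤ 4 * κ * (∫ ω, X ω ^ 2 ∂P) * ∫ ω, Y ω ^ 2 ∂P := by
  have hXe := hX.ae_eq_mk
  have hYe := hY.ae_eq_mk
  have h := cov_sq_le_of_mixing hX.measurable_mk hY.measurable_mk (hX2.ae_eq hXe) (hY2.ae_eq hYe)
    (κ := κ) fun S T hS hT => by
      have h1 : hX.mk X ⁻¹' S =ᵐ[P] X ⁻¹' S := hXe.symm.preimage S
      have h2 : hY.mk Y ⁻¹' T =ᵐ[P] Y ⁻¹' T := hYe.symm.preimage T
      rw [measureReal_congr (h1.inter h2), measureReal_congr h1, measureReal_congr h2]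
      exact hκ S T hS hT
  have e1 : ∫ ω, hX.mk X ω * hY.mk Y ω ∂P = ∫ ω, X ω * Y ω ∂P := integral_congr_ae
    (by filter_upwards [hXe, hYe] with ω h1 h2; rw [h1, h2])
  have e2 : ∫ ω, hX.mk X ω ^ 2 ∂P = ∫ ω, X ω ^ 2 ∂P := integral_congr_ae
    (by filter_upwards [hXe] with ω h1; rw [h1])
  have e3 : ∫ ω, hY.mk Y ω ^ 2 ∂P = ∫ ω, Y ω ^ 2 ∂P := integral_congr_ae
    (by filter_upwards [hYe] with ω h1; rw [h1])
  rwa [e1, e2, e3, ← integral_congr_ae hXe, ← integral_congr_ae hYe] at h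

end Mixing

/-! ### Second moments of smeared random fields -/

section Fields

set_option linter.unusedSectionVars false

variable {Ω : Type*} [MeasurableSpace Ω] {P : Measure Ω} [IsProbabilityMeasure P]
  {X : Ω → E3 → C4}

/-- `f` is integrable, and integrable against the second moment of `X`. -/
structure IsWeight (P : Measure Ω) (X : Ω → E3 → C4) (f : E3 → ℂ) : Prop where
  integrable : Integrable f
  integrable_sq : Integrable (fun p : Ω × E3 => ‖X p.1 p.2‖ ^ 2 * ‖f p.2‖) (P.prod volume)

lemma aemeasurable_realComp (hX : IsRandomFunction P X) (i : RealIdx) :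
    AEMeasurable (fun p : Ω × E3 => realComp i (X p.1 p.2)) (P.prod volume) :=
  (continuous_realComp i).measurable.comp_aemeasurable hX.measurable

lemma aemeasurable_realComp_fst (hX : IsRandomFunction P X) (i : RealIdx) :
    AEMeasurable (fun r : Ω × E3 × E3 => realComp i (X r.1 r.2.1))
      (P.prod (volume.prod volume)) :=
  (aemeasurable_realComp hX i).comp_quasiMeasurePreserving
    (MeasureTheory.QuasiMeasurePreserving.prodMap (.id P) Measure.quasiMeasurePreserving_fst)

lemma aemeasurable_realComp_snd (hX : IsRandomFunction P X) (i : RealIdx) :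
    AEMeasurable (fun r : Ω × E3 × E3 => realComp i (X r.1 r.2.2))
      (P.prod (volume.prod volume)) :=
  (aemeasurable_realComp hX i).comp_quasiMeasurePreserving
    (MeasureTheory.QuasiMeasurePreserving.prodMap (.id P) Measure.quasiMeasurePreserving_snd)

lemma integrable_prod_assoc {a : Ω × E3 → ℝ} {b : E3 → ℝ} (ha : Integrable a (P.prod volume))
    (hb : Integrable b) :
    Integrable (fun r : Ω × E3 × E3 => a (r.1, r.2.1) * b r.2.2) (P.prod (volume.prod volume)) := by
  have h := ha.mul_prod hb
  have hmp : MeasurePreserving (MeasurableEquiv.prodAssoc (α := Ω) (β := E3) (γ := E3)).symm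
      (P.prod (volume.prod volume)) ((P.prod volume).prod volume) :=
    (measurePreserving_prodAssoc P volume volume).symm _
  exact hmp.integrable_comp_of_integrable h

lemma integrable_prod_assoc' {a : Ω × E3 → ℝ} {b : E3 → ℝ} (ha : Integrable a (P.prod volume))
    (hb : Integrable b) :
    Integrable (fun r : Ω × E3 × E3 => a (r.1, r.2.2) * b r.2.1) (P.prod (volume.prod volume)) := by
  have h := integrable_prod_assoc ha hb
  have hmp : MeasurePreserving (Prod.map id Prod.swap : Ω × E3 × E3 → Ω × E3 × E3)
      (P.prod (volume.prod volume)) (P.prod (volume.prod volume)) :=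
    (MeasurePreserving.id P).prod Measure.measurePreserving_swap
  exact hmp.integrable_comp_of_integrable h

/-- From `|ab| ≤ a² + b²`, each term is a second moment against one weight times the integral of the
other. No constant density is needed, so this also covers the evolved field. -/
lemma integrable_corr (hX : IsRandomFunction P X) {f g : E3 → ℂ} (hf : IsWeight P X f)
    (hg : IsWeight P X g) (i j : RealIdx) :
    Integrable (fun r : Ω × E3 × E3 => ((realComp i (X r.1 r.2.1) : ℝ) : ℂ) *
      ((realComp j (X r.1 r.2.2) : ℝ) : ℂ) * (f r.2.1 * g r.2.2)) (P.prod (volume.prod volume)) := by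
  have h1 := integrable_prod_assoc hf.integrable_sq hg.integrable.norm
  have h2 := integrable_prod_assoc' hg.integrable_sq hf.integrable.norm
  have hfm : AEStronglyMeasurable (fun r : Ω × E3 × E3 => f r.2.1 * g r.2.2)
      (P.prod (volume.prod volume)) :=
    (hf.integrable.mul_prod hg.integrable).aestronglyMeasurable.comp_snd
  have hm : AEStronglyMeasurable (fun r : Ω × E3 × E3 => ((realComp i (X r.1 r.2.1) : ℝ) : ℂ) *
      ((realComp j (X r.1 r.2.2) : ℝ) : ℂ)) (P.prod (volume.prod volume)) :=
    ((Complex.measurable_ofReal.comp_aemeasurable (aemeasurable_realComp_fst hX i)).mul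
      (Complex.measurable_ofReal.comp_aemeasurable
        (aemeasurable_realComp_snd hX j))).aestronglyMeasurable
  refine (h1.add h2).mono' (hm.mul hfm) (ae_of_all _ fun r => ?_)
  simp only [norm_mul, Complex.norm_real, Real.norm_eq_abs, Pi.add_apply]
  have hi := abs_realComp_le i (X r.1 r.2.1)
  have hj := abs_realComp_le j (X r.1 r.2.2)
  set a := ‖X r.1 r.2.1‖
  set b := ‖X r.1 r.2.2‖
  have hab : |realComp i (X r.1 r.2.1)| * |realComp j (X r.1 r.2.2)| ≤ a ^ 2 + b ^ 2 := by
    refine (mul_le_mul hi hj (abs_nonneg _) (norm_nonneg _)).trans ?_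
    nlinarith [sq_nonneg (a - b), sq_nonneg (a + b)]
  calc _ ≤ (a ^ 2 + b ^ 2) * (‖f r.2.1‖ * ‖g r.2.2‖) := by gcongr
    _ = _ := by ring

/-- The correlation function of smeared fields. -/
lemma integral_smeared_mul_smeared (hX : IsRandomFunction P X) {f g : E3 → ℂ}
    (hf : IsWeight P X f) (hg : IsWeight P X g) (i j : RealIdx) :
    Integrable (fun ω => (∫ x, ((realComp i (X ω x) : ℝ) : ℂ) * f x) *
      ∫ y, ((realComp j (X ω y) : ℝ) : ℂ) * g y) P ∧
    ∫ ω, (∫ x, ((realComp i (X ω x) : ℝ) : ℂ) * f x) *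
        (∫ y, ((realComp j (X ω y) : ℝ) : ℂ) * g y) ∂P
      = ∫ p : E3 × E3, ((∫ ω, realComp i (X ω p.1) * realComp j (X ω p.2) ∂P : ℝ) : ℂ) *
        (f p.1 * g p.2) := by
  have h := integrable_corr hX hf hg i j
  have hω (ω : Ω) : (∫ x, ((realComp i (X ω x) : ℝ) : ℂ) * f x) *
        (∫ y, ((realComp j (X ω y) : ℝ) : ℂ) * g y)
      = ∫ p : E3 × E3, ((realComp i (X ω p.1) : ℝ) : ℂ) * ((realComp j (X ω p.2) : ℝ) : ℂ) *
        (f p.1 * g p.2) := by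
    rw [← integral_prod_mul]
    refine integral_congr_ae (ae_of_all _ fun p => ?_)
    simp only; ring
  simp only [hω]
  refine ⟨h.integral_prod_left, ?_⟩
  refine (integral_integral_swap (μ := P) (ν := (volume : Measure (E3 × E3)))
    (f := fun ω p => ((realComp i (X ω p.1) : ℝ) : ℂ) * ((realComp j (X ω p.2) : ℝ) : ℂ) *
      (f p.1 * g p.2)) h).trans ?_
  refine integral_congr_ae (ae_of_all _ fun p => ?_)
  simp only [integral_mul_const, ← Complex.ofReal_mul, integral_complex_ofReal]

/-- Almost surely, the smeared fields are given by convergent integrals. -/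
lemma ae_integrable_smeared (hX : IsRandomFunction P X) {f : E3 → ℂ} (hf : IsWeight P X f)
    (i : RealIdx) : Integrable (fun p : Ω × E3 => ((realComp i (X p.1 p.2) : ℝ) : ℂ) * f p.2)
      (P.prod volume) := by
  have h1 : Integrable (fun p : Ω × E3 => ‖f p.2‖) (P.prod volume) := hf.integrable.norm.comp_snd P
  refine (h1.add hf.integrable_sq).mono' ?_ (ae_of_all _ fun p => ?_)
  · exact (Complex.measurable_ofReal.comp_aemeasurable
      (aemeasurable_realComp hX i)).aestronglyMeasurable.mul hf.integrable.aestronglyMeasurable.comp_snd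
  · rw [norm_mul, Complex.norm_real, Real.norm_eq_abs, Pi.add_apply, ← one_add_mul]
    refine mul_le_mul_of_nonneg_right ((abs_realComp_le i _).trans ?_) (norm_nonneg _)
    nlinarith [sq_nonneg (‖X p.1 p.2‖ - 1)]

/-- Second moments at almost all pairs of points. -/
lemma ae_integrable_mul (hX : IsRandomFunction P X)
    (hball : ∀ R : ℝ, IsWeight P X ((Metric.ball 0 R).indicator 1)) (i j : RealIdx) :
    ∀ᵐ p : E3 × E3, Integrable (fun ω => realComp i (X ω p.1) * realComp j (X ω p.2)) P := by
  have h (n : ℕ) : ∀ᵐ p : E3 × E3, p ∈ Metric.ball (0 : E3) n ×ˢ Metric.ball (0 : E3) n →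
      Integrable (fun ω => realComp i (X ω p.1) * realComp j (X ω p.2)) P := by
    have h1 := (integrable_corr hX (hball n) (hball n) i j).prod_left_ae
    filter_upwards [h1] with p hp hmem
    simp only [Set.indicator_of_mem hmem.1, Set.indicator_of_mem hmem.2, Pi.one_apply, mul_one,
      ← Complex.ofReal_mul] at hp
    exact hp.re
  filter_upwards [ae_all_iff.2 h] with p hp
  obtain ⟨n, hn⟩ := exists_nat_gt (max ‖p.1‖ ‖p.2‖)
  refine hp n ⟨?_, ?_⟩
  · rw [mem_ball_zero_iff]; exact (le_max_left _ _).trans_lt hn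
  · rw [mem_ball_zero_iff]; exact (le_max_right _ _).trans_lt hn

/-- The correlation kernel. -/
def corrKernel (P : Measure Ω) (X : Ω → E3 → C4) (i j : RealIdx) (p : E3 × E3) : ℝ :=
  ∫ ω, realComp i (X ω p.1) * realComp j (X ω p.2) ∂P

lemma aestronglyMeasurable_corrKernel (hX : IsRandomFunction P X) (i j : RealIdx) :
    AEStronglyMeasurable (corrKernel P X i j) :=
  AEStronglyMeasurable.integral_prod_right' (E := ℝ) (μ := (volume : Measure (E3 × E3))) (ν := P)
    (f := fun r => realComp i (X r.2 r.1.1) * realComp j (X r.2 r.1.2))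
    (((aemeasurable_realComp_fst hX i).mul (aemeasurable_realComp_snd hX j)).aestronglyMeasurable.prod_swap)

lemma integrable_corrKernel_mul (hX : IsRandomFunction P X) {f g : E3 → ℂ}
    (hf : IsWeight P X f) (hg : IsWeight P X g) (i j : RealIdx) :
    Integrable fun p : E3 × E3 => (corrKernel P X i j p : ℂ) * (f p.1 * g p.2) := by
  refine (integrable_corr hX hf hg i j).integral_prod_right.congr (ae_of_all _ fun p => ?_)
  simp only [integral_mul_const, ← Complex.ofReal_mul, integral_complex_ofReal, corrKernel]

end Fields

/-! ### Translation invariant correlation functions -/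

lemma measurePreserving_shear :
    MeasurePreserving (fun p : E3 × E3 => (p.1 + p.2, p.2)) volume volume :=
  measurePreserving_add_prod volume volume

/-- The measure preserving shear `(z, y) ↦ (z + y, y)` turns the difference of the two points into
the first coordinate. -/
lemma ae_of_ae_sub {R : E3 → Prop} (h : ∀ᵐ p : E3 × E3, R (p.1 - p.2)) : ∀ᵐ z, R z := by
  have h1 := measurePreserving_shear.quasiMeasurePreserving.ae h
  simp only [add_sub_cancel_right] at h1
  filter_upwards [Measure.ae_ae_of_ae_prod h1] with z hz
  exact (eventually_const.1 hz)

/-- The function `q₀` comes without measurability; it inherits it from the correlation kernel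
through this shear. -/
lemma aestronglyMeasurable_of_sub {q : E3 → ℝ}
    (h : AEStronglyMeasurable (fun p : E3 × E3 => q (p.1 - p.2))) : AEStronglyMeasurable q := by
  have h1 := h.comp_measurePreserving measurePreserving_shear
  simp only [Function.comp_def, add_sub_cancel_right] at h1
  have h2 : AEStronglyMeasurable (fun p : E3 × E3 => q p.2) (volume.prod volume) := h1.prod_swap
  exact h2.prodMk_left.exists.choose_spec

lemma integral_sub_mul {𝕜 : Type*} [RCLike 𝕜] {q : E3 → 𝕜} {f g : E3 → 𝕜}
    (h : Integrable fun p : E3 × E3 => q (p.1 - p.2) * (f p.1 * g p.2)) :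
    ∫ p : E3 × E3, q (p.1 - p.2) * (f p.1 * g p.2) = ∫ z, q z * ∫ y, f (z + y) * g y := by
  have hemb : MeasurableEmbedding (fun p : E3 × E3 => (p.1 + p.2, p.2)) :=
    (MeasurableEquiv.mk (Equiv.mk (fun p : E3 × E3 => (p.1 + p.2, p.2)) (fun p => (p.1 - p.2, p.2))
      (fun p => by simp) (fun p => by simp))
      ((measurable_fst.add measurable_snd).prodMk measurable_snd)
      ((measurable_fst.sub measurable_snd).prodMk measurable_snd)).measurableEmbedding
  rw [← measurePreserving_shear.integral_comp hemb]
  have h1 := measurePreserving_shear.integrable_comp_of_integrable h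
  simp only [Function.comp_def, add_sub_cancel_right] at h1 ⊢
  rw [Measure.volume_eq_prod, integral_prod _ h1]
  simp only [integral_const_mul]

lemma integrable_ofReal {f : E3 → ℝ} (hf : Integrable f) : Integrable fun x => (f x : ℂ) :=
  hf.ofReal

section Stationary

set_option linter.unusedSectionVars false

variable {Ω : Type*} [MeasurableSpace Ω] {P : Measure Ω} [IsProbabilityMeasure P]
  {X : Ω → E3 → C4} {q : E3 → Matrix RealIdx RealIdx ℝ} {e₀ : NNReal}

/-- A random field with translation invariant second moments. -/
structure IsStationary (P : Measure Ω) (X : Ω → E3 → C4) (q : E3 → Matrix RealIdx RealIdx ℝ)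
    (e₀ : NNReal) : Prop where
  random : IsRandomFunction P X
  corr : HasCorrelation P X q
  density : ∀ᵐ x : E3, ∫⁻ ω, ‖X ω x‖ₑ ^ 2 ∂P = e₀

namespace IsStationary

lemma corrKernel_eq (h : IsStationary P X q e₀) (i j : RealIdx) :
    ∀ᵐ p : E3 × E3, corrKernel P X i j p = q (p.1 - p.2) i j := by
  filter_upwards [h.corr i j] with p hp using hp.2

lemma aestronglyMeasurable (h : IsStationary P X q e₀) (i j : RealIdx) :
    AEStronglyMeasurable fun z => q z i j :=
  aestronglyMeasurable_of_sub
    ((aestronglyMeasurable_corrKernel h.random i j).congr (h.corrKernel_eq i j))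

lemma isWeight (h : IsStationary P X q e₀) {f : E3 → ℂ} (hf : Integrable f) : IsWeight P X f := by
  refine ⟨hf, ?_⟩
  have hm : AEStronglyMeasurable (fun p : Ω × E3 => ‖X p.1 p.2‖ ^ 2 * ‖f p.2‖)
      (P.prod volume) :=
    (h.random.measurable.norm.pow_const 2).aestronglyMeasurable.mul
      hf.aestronglyMeasurable.norm.comp_snd
  refine ⟨hm, ?_⟩
  rw [hasFiniteIntegral_iff_enorm, lintegral_prod_symm _ hm.enorm]
  have h1 : ∀ᵐ x : E3, ∫⁻ ω, ‖‖X ω x‖ ^ 2 * ‖f x‖‖ₑ ∂P = e₀ * ‖f x‖ₑ := by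
    filter_upwards [h.density] with x hx
    rw [← hx, ← lintegral_mul_const' _ _ enorm_ne_top]
    refine lintegral_congr fun ω => ?_
    rw [enorm_mul, enorm_pow, enorm_norm, enorm_norm]
  rw [lintegral_congr_ae h1, lintegral_const_mul' _ _ ENNReal.coe_ne_top]
  exact ENNReal.mul_lt_top ENNReal.coe_lt_top hf.2

/-- Take expectations in `|ab| ≤ (a² + b²)/2`; both densities equal `e₀`. -/
lemma abs_le (h : IsStationary P X q e₀) (i j : RealIdx) : ∀ᵐ z, |q z i j| ≤ e₀ := by
  refine ae_of_ae_sub (R := fun z => |q z i j| ≤ e₀) ?_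
  have hd1 : ∀ᵐ p : E3 × E3, ∫⁻ ω, ‖X ω p.1‖ₑ ^ 2 ∂P = e₀ :=
    Measure.quasiMeasurePreserving_fst.ae h.density
  have hd2 : ∀ᵐ p : E3 × E3, ∫⁻ ω, ‖X ω p.2‖ₑ ^ 2 ∂P = e₀ :=
    Measure.quasiMeasurePreserving_snd.ae h.density
  have hm : ∀ᵐ x : E3, AEMeasurable (fun ω => X ω x) P := by
    have : AEStronglyMeasurable (fun p : E3 × Ω => X p.2 p.1) (volume.prod P) :=
      h.random.measurable.aestronglyMeasurable.prod_swap
    exact this.prodMk_left.mono fun x hx => hx.aemeasurable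
  have hm1 : ∀ᵐ p : E3 × E3, AEMeasurable (fun ω => X ω p.1) P :=
    Measure.quasiMeasurePreserving_fst.ae hm
  filter_upwards [h.corr i j, hd1, hd2, hm1] with p hp h1 h2 hmp
  rw [← hp.2, ← Real.norm_eq_abs, ← NNReal.coe_mk ‖_‖ (norm_nonneg _), NNReal.coe_le_coe,
    ← ENNReal.coe_le_coe]
  refine (enorm_integral_le_lintegral_enorm _).trans ?_
  have hpt (ω : Ω) : ‖realComp i (X ω p.1) * realComp j (X ω p.2)‖ₑ
      ≤ 2⁻¹ * (‖X ω p.1‖ₑ ^ 2 + ‖X ω p.2‖ₑ ^ 2) := by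
    have hr : |realComp i (X ω p.1) * realComp j (X ω p.2)|
        ≤ 2⁻¹ * (‖X ω p.1‖ ^ 2 + ‖X ω p.2‖ ^ 2) := by
      rw [abs_mul]
      refine (mul_le_mul (abs_realComp_le i _) (abs_realComp_le j _) (abs_nonneg _)
        (norm_nonneg _)).trans ?_
      nlinarith [sq_nonneg (‖X ω p.1‖ - ‖X ω p.2‖)]
    rw [← ofReal_norm, Real.norm_eq_abs]
    refine (ENNReal.ofReal_le_ofReal hr).trans (le_of_eq ?_)
    rw [ENNReal.ofReal_mul (by norm_num), ENNReal.ofReal_add (by positivity) (by positivity),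
      ENNReal.ofReal_pow (norm_nonneg _), ENNReal.ofReal_pow (norm_nonneg _),
      ofReal_norm, ofReal_norm, ENNReal.ofReal_inv_of_pos two_pos]
    simp
  refine (lintegral_mono hpt).trans ?_
  rw [lintegral_const_mul' _ _ (by simp), lintegral_add_left' (hmp.enorm.pow_const 2), h1, h2,
    ← two_mul, ← mul_assoc, ENNReal.inv_mul_cancel two_ne_zero ENNReal.ofNat_ne_top, one_mul]

lemma integrable_mul (h : IsStationary P X q e₀) {f g : E3 → ℂ} (hf : Integrable f)
    (hg : Integrable g) (i j : RealIdx) :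
    Integrable fun p : E3 × E3 => ((q (p.1 - p.2) i j : ℝ) : ℂ) * (f p.1 * g p.2) := by
  refine (integrable_corrKernel_mul h.random (h.isWeight hf) (h.isWeight hg) i j).congr ?_
  filter_upwards [h.corrKernel_eq i j] with p hp
  rw [hp]

lemma integral_smeared (h : IsStationary P X q e₀) {f g : E3 → ℂ} (hf : Integrable f)
    (hg : Integrable g) (i j : RealIdx) :
    ∫ ω, (∫ x, ((realComp i (X ω x) : ℝ) : ℂ) * f x) *
        (∫ y, ((realComp j (X ω y) : ℝ) : ℂ) * g y) ∂P
      = ∫ z, ((q z i j : ℝ) : ℂ) * ∫ y, f (z + y) * g y := by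
  rw [(integral_smeared_mul_smeared h.random (h.isWeight hf) (h.isWeight hg) i j).2,
    ← integral_sub_mul (q := fun z => ((q z i j : ℝ) : ℂ)) (h.integrable_mul hf hg i j)]
  refine integral_congr_ae ?_
  filter_upwards [h.corrKernel_eq i j] with p hp
  rw [← hp, corrKernel]

lemma norm_integral_smeared_le (h : IsStationary P X q e₀) {f g : E3 → ℂ} (hf : Integrable f)
    (hg : Integrable g) (i j : RealIdx) :
    ‖∫ ω, (∫ x, ((realComp i (X ω x) : ℝ) : ℂ) * f x) *
        (∫ y, ((realComp j (X ω y) : ℝ) : ℂ) * g y) ∂P‖ ≤ e₀ * ((∫ x, ‖f x‖) * ∫ x, ‖g x‖) := by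
  rw [(integral_smeared_mul_smeared h.random (h.isWeight hf) (h.isWeight hg) i j).2,
    ← integral_prod_mul, ← integral_const_mul]
  refine norm_integral_le_of_norm_le ((hf.norm.mul_prod hg.norm).const_mul _) ?_
  have hb : ∀ᵐ p : E3 × E3, |q (p.1 - p.2) i j| ≤ e₀ :=
    (quasiMeasurePreserving_sub volume volume).ae (h.abs_le i j)
  filter_upwards [h.corrKernel_eq i j, hb] with p hp hbp
  rw [corrKernel] at hp
  rw [norm_mul, norm_mul, Complex.norm_real, hp, Real.norm_eq_abs]
  gcongr

end IsStationary

/-! ### Smeared components as random variables, and their mixing -/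

/-- The component `i` of `X`, smeared with `f`. -/
def smear (X : Ω → E3 → C4) (i : RealIdx) (f : E3 → ℝ) (ω : Ω) : ℝ := ∫ x, realComp i (X ω x) * f x

lemma ofReal_smear (i : RealIdx) (f : E3 → ℝ) (ω : Ω) :
    (smear X i f ω : ℂ) = ∫ x, ((realComp i (X ω x) : ℝ) : ℂ) * (f x : ℂ) := by
  rw [smear, ← integral_complex_ofReal]
  simp only [Complex.ofReal_mul]

lemma aemeasurable_smear (hX : IsRandomFunction P X) {f : E3 → ℝ}
    (hf : IsWeight P X fun x => (f x : ℂ)) (i : RealIdx) : AEMeasurable (smear X i f) P := by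
  have h := (ae_integrable_smeared hX hf i).integral_prod_left.aestronglyMeasurable.aemeasurable
  simp only [← ofReal_smear] at h
  exact (Complex.measurable_re.comp_aemeasurable h)

lemma memLp_smear (hX : IsRandomFunction P X) {f : E3 → ℝ}
    (hf : IsWeight P X fun x => (f x : ℂ)) (i : RealIdx) : MemLp (smear X i f) 2 P := by
  rw [memLp_two_iff_integrable_sq (aemeasurable_smear hX hf i).aestronglyMeasurable]
  have h := (integral_smeared_mul_smeared hX hf hf i i).1
  simp only [← ofReal_smear] at h
  simp only [← sq, ← Complex.ofReal_pow] at h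
  exact h.re

/-- A smeared component is thus one of the functionals generating `σ(𝒜)`, for any `𝒜` containing the
support of `f`. -/
lemma pairing_single (i : RealIdx) (f : E3 → ℝ) (ω : Ω) :
    pairing (X ω) (ofRealField fun j => if j = i then f else 0) = smear X i f ω := by
  rw [pairing_ofRealField, pairingR, Finset.sum_eq_single i]
  · simp [smear]
  · intro j _ hj; simp [hj]
  · simp

lemma isTestVec_single {f : E3 → ℝ} (hf : ContDiff ℝ ((⊤ : ℕ∞) : WithTop ℕ∞) f)
    (hc : HasCompactSupport f) (i : RealIdx) : IsTestVec fun j => if j = i then f else 0 where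
  smooth j := by
    by_cases h : j = i
    · simpa [h] using hf
    · simp only [h, if_false]
      exact contDiff_const
  compact j := by
    by_cases h : j = i
    · simpa [h] using hc
    · simpa [h] using HasCompactSupport.zero

lemma mixingCoeff_le_one (P : Measure Ω) [IsProbabilityMeasure P] (X : Ω → E3 → C4) (r : ℝ) :
    mixingCoeff P X r ≤ 1 := by
  refine iSup_le fun 𝒜 => iSup_le fun ℬ => iSup_le fun _ => iSup_le fun A => iSup_le fun B =>
    iSup_le fun hB => ?_
  rw [← ENNReal.ofReal_one]
  refine ENNReal.ofReal_le_ofReal (div_le_one_of_le₀ ?_ measureReal_nonneg)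
  have h1 : P.real (A ∩ B) ≤ P.real B := measureReal_mono Set.inter_subset_right
  have h2 : P.real A * P.real B ≤ P.real B :=
    mul_le_of_le_one_left measureReal_nonneg measureReal_le_one
  rw [abs_le]
  have h3 : 0 ≤ P.real (A ∩ B) := measureReal_nonneg
  have h4 : 0 ≤ P.real A * P.real B := mul_nonneg measureReal_nonneg measureReal_nonneg
  constructor <;> linarith

lemma mixingCoeff_antitone (P : Measure Ω) (X : Ω → E3 → C4) : Antitone (mixingCoeff P X) := by
  intro r s hrs
  refine iSup_le fun 𝒜 => iSup_le fun ℬ => iSup_le fun h => ?_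
  exact le_iSup_of_le 𝒜 (le_iSup_of_le ℬ (le_iSup_of_le
    ⟨h.1, h.2.1, h.2.2.1, h.2.2.2.1, fun x hx y hy => hrs.trans (h.2.2.2.2 x hx y hy)⟩ le_rfl))

lemma isMixingPair_smear {f g : E3 → ℝ} (hf : ContDiff ℝ ((⊤ : ℕ∞) : WithTop ℕ∞) f)
    (hfc : HasCompactSupport f) (hg : ContDiff ℝ ((⊤ : ℕ∞) : WithTop ℕ∞) g)
    (hgc : HasCompactSupport g) {a b : E3} {ε δ r : ℝ} (hfa : tsupport f ⊆ Metric.ball a ε)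
    (hgb : tsupport g ⊆ Metric.ball b δ) (hr : r + ε + δ ≤ dist a b) (i j : RealIdx) :
    IsMixingPair P (smear X i f) (smear X j g) (mixingCoeff P X r).toReal := by
  intro S T hS hT
  have hmeas (f : E3 → ℝ) (hf : ContDiff ℝ ((⊤ : ℕ∞) : WithTop ℕ∞) f)
      (hfc : HasCompactSupport f) (𝒜 : Set E3) (h𝒜 : tsupport f ⊆ 𝒜) (i : RealIdx) (S : Set ℝ)
      (hS : MeasurableSet S) : MeasurableSet[sigmaOf X 𝒜] (smear X i f ⁻¹' S) := by
    have hle : MeasurableSpace.comap (fun ω => pairing (X ω)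
        (ofRealField fun j => if j = i then f else 0)) (borel ℝ) ≤ sigmaOf X 𝒜 := by
      refine le_iSup₂_of_le (ofRealField fun j => if j = i then f else 0)
        ⟨(isTestVec_single hf hfc i).isTest, ?_⟩ le_rfl
      refine (closure_mono fun x hx => ?_).trans h𝒜
      by_contra hx'
      refine hx ?_
      have : (fun j => (if j = i then f else 0) x) = fun _ => (0 : ℝ) := by
        funext j
        split_ifs
        · simpa using hx'
        · rfl
      simp only [ofRealField, this]
      ext s
      exact Complex.ext rfl rfl
    refine hle _ ⟨S, ?_, ?_⟩
    · rwa [← BorelSpace.measurable_eq (α := ℝ)]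
    · ext ω
      simp only [Set.mem_preimage, pairing_single]
  have hA := hmeas f hf hfc _ hfa i S hS
  have hB := hmeas g hg hgc _ hgb j T hT
  -- The mixing coefficient ranges over conditioning events of positive probability; for null events
  -- both sides are zero.
  rcases eq_or_ne (P (smear X j g ⁻¹' T)) 0 with h0 | h0
  · have h1 : P.real (smear X j g ⁻¹' T) = 0 := by simp [Measure.real, h0]
    have h2 : P.real (smear X i f ⁻¹' S ∩ smear X j g ⁻¹' T) = 0 :=
      le_antisymm ((measureReal_mono Set.inter_subset_right).trans h1.le) measureReal_nonneg
    simp [h1, h2]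
  · have hpos : 0 < P.real (smear X j g ⁻¹' T) :=
      ENNReal.toReal_pos h0 (measure_ne_top P _)
    rw [← div_le_iff₀ hpos]
    refine (ENNReal.ofReal_le_iff_le_toReal
      (ne_top_of_le_ne_top ENNReal.one_ne_top (mixingCoeff_le_one P X r))).1 ?_
    refine le_iSup_of_le (Metric.ball a ε) (le_iSup_of_le (Metric.ball b δ) (le_iSup_of_le
      ⟨Metric.isOpen_ball, Metric.isBounded_ball, Metric.isOpen_ball, Metric.isBounded_ball, ?_⟩
      (le_iSup_of_le _ (le_iSup_of_le _ (le_iSup_of_le ⟨hA, hB, pos_iff_ne_zero.2 h0⟩ le_rfl)))))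
    intro x hx y hy
    rw [Metric.mem_ball] at hx hy
    have := dist_triangle4 a x y b
    rw [dist_comm a x] at this
    linarith

lemma integral_smear_eq_zero (hX : IsRandomFunction P X) (h0 : HasZeroMean P X) {f : E3 → ℝ}
    (hf : IsWeight P X fun x => (f x : ℂ)) (i : RealIdx) : ∫ ω, smear X i f ω ∂P = 0 := by
  have h := ae_integrable_smeared hX hf i
  have h1 : Integrable (fun p : Ω × E3 => realComp i (X p.1 p.2) * f p.2) (P.prod volume) := by
    have := h.re
    simpa using this
  simp only [smear]
  rw [integral_integral_swap h1]
  refine integral_eq_zero_of_ae ?_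
  filter_upwards [h0] with x hx
  rw [integral_mul_const]
  have := (realCompL i).integral_comp_comm hx.1
  simp only [realCompL_apply, hx.2] at this
  rw [this, ← realCompL_apply, map_zero, zero_mul, Pi.zero_apply]

namespace IsStationary

lemma integral_smear_mul (h : IsStationary P X q e₀) {f g : E3 → ℝ} (hf : Integrable f)
    (hg : Integrable g) (i j : RealIdx) :
    ∫ ω, smear X i f ω * smear X j g ω ∂P = ∫ z, q z i j * ∫ y, f (z + y) * g y := by
  have := h.integral_smeared (integrable_ofReal hf) (integrable_ofReal hg) i j
  simp only [← ofReal_smear] at this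
  simp only [← Complex.ofReal_mul, integral_complex_ofReal] at this
  exact_mod_cast this

lemma abs_integral_smear_le (h : IsStationary P X q e₀) {f g : E3 → ℝ} (hf : Integrable f)
    (hg : Integrable g) (i j : RealIdx) :
    |∫ ω, smear X i f ω * smear X j g ω ∂P| ≤ e₀ * ((∫ x, |f x|) * ∫ x, |g x|) := by
  have := h.norm_integral_smeared_le (integrable_ofReal hf) (integrable_ofReal hg) i j
  simp only [← ofReal_smear] at this
  simp only [← Complex.ofReal_mul, integral_complex_ofReal, Complex.norm_real,
    Real.norm_eq_abs] at this
  exact this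

/-- Decay of smeared correlations, from the mixing condition. -/
lemma abs_corr_le_of_mixing (h : IsStationary P X q e₀) (h0 : HasZeroMean P X) {f g : E3 → ℝ}
    (hf : ContDiff ℝ ((⊤ : ℕ∞) : WithTop ℕ∞) f) (hfc : HasCompactSupport f)
    (hg : ContDiff ℝ ((⊤ : ℕ∞) : WithTop ℕ∞) g) (hgc : HasCompactSupport g)
    {a b : E3} {ε δ r : ℝ} (hfa : tsupport f ⊆ Metric.ball a ε)
    (hgb : tsupport g ⊆ Metric.ball b δ) (hr : r + ε + δ ≤ dist a b) (i j : RealIdx) :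
    |∫ z, q z i j * ∫ y, f (z + y) * g y| ≤ 2 * e₀ * Real.sqrt (mixingCoeff P X r).toReal *
      ((∫ x, |f x|) * ∫ x, |g x|) := by
  have hfi : Integrable f := hf.continuous.integrable_of_hasCompactSupport hfc
  have hgi : Integrable g := hg.continuous.integrable_of_hasCompactSupport hgc
  have hfw := h.isWeight (integrable_ofReal hfi)
  have hgw := h.isWeight (integrable_ofReal hgi)
  have hc := cov_sq_le_of_mixing₀ (aemeasurable_smear h.random hfw i)
    (aemeasurable_smear h.random hgw j) (memLp_smear h.random hfw i) (memLp_smear h.random hgw j)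
    (isMixingPair_smear (P := P) (X := X) hf hfc hg hgc hfa hgb hr i j)
  rw [integral_smear_eq_zero h.random h0 hfw, zero_mul, sub_zero, h.integral_smear_mul hfi hgi] at hc
  -- The means vanish, so the second moment is the covariance; the two variances are at most `e₀`
  -- times the squared `L¹` norms, which leaves an estimate that survives concentration of `f` and
  -- `g` to points.
  have h1 := (le_abs_self _).trans (h.abs_integral_smear_le hfi hfi i i)
  have h2 := (le_abs_self _).trans (h.abs_integral_smear_le hgi hgi j j)
  simp only [← sq] at h1 h2
  set κ := (mixingCoeff P X r).toReal
  have hκ : 0 ≤ κ := ENNReal.toReal_nonneg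
  have hF : 0 ≤ ∫ x, |f x| := integral_nonneg fun x => abs_nonneg _
  have hG : 0 ≤ ∫ x, |g x| := integral_nonneg fun x => abs_nonneg _
  refine abs_le_of_sq_le_sq ?_ (by positivity)
  refine hc.trans ?_
  calc 4 * κ * (∫ ω, smear X i f ω ^ 2 ∂P) * ∫ ω, smear X j g ω ^ 2 ∂P
      ≤ 4 * κ * (e₀ * (∫ x, |f x|) ^ 2) * (e₀ * (∫ x, |g x|) ^ 2) := by
        refine mul_le_mul (mul_le_mul_of_nonneg_left h1 (by positivity)) h2
          (integral_nonneg fun ω => sq_nonneg _) (by positivity)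
    _ = (2 * e₀ * Real.sqrt κ * ((∫ x, |f x|) * ∫ x, |g x|)) ^ 2 := by
        rw [mul_pow, mul_pow, mul_pow, mul_pow, Real.sq_sqrt hκ]; ring

end IsStationary

end Stationary

/-! ### Integrability of the correlation functions under mixing -/

/-- A sequence of smooth bumps with radii tending to zero. -/
def mollBump (n : ℕ) : ContDiffBump (0 : E3) where
  rIn := 1 / (2 * (n + 1))
  rOut := 1 / (n + 1)
  rIn_pos := by positivity
  rIn_lt_rOut := by
    rw [div_lt_div_iff₀ (by positivity) (by positivity)]
    have : (0 : ℝ) < (n : ℝ) + 1 := by positivity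
    linarith

/-- Smooth mollifiers. -/
def moll (n : ℕ) : E3 → ℝ := (mollBump n).normed volume

lemma contDiff_moll (n : ℕ) : ContDiff ℝ ((⊤ : ℕ∞) : WithTop ℕ∞) (moll n) :=
  (mollBump n).contDiff_normed

lemma hasCompactSupport_moll (n : ℕ) : HasCompactSupport (moll n) :=
  (mollBump n).hasCompactSupport_normed

lemma moll_nonneg (n : ℕ) (x : E3) : 0 ≤ moll n x := (mollBump n).nonneg_normed x

lemma integral_moll (n : ℕ) : ∫ x, moll n x = 1 := (mollBump n).integral_normed

lemma integrable_moll (n : ℕ) : Integrable (moll n) := (mollBump n).integrable_normed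

lemma tsupport_moll (n : ℕ) : tsupport (moll n) = Metric.closedBall 0 (1 / (n + 1)) :=
  (mollBump n).tsupport_normed_eq

lemma tendsto_rOut : Tendsto (fun n => (mollBump n).rOut) atTop (𝓝 0) :=
  tendsto_one_div_add_atTop_nhds_zero_nat

/-- Convolution with a mollifier. -/
def mollify (n : ℕ) (g : E3 → ℝ) (x : E3) : ℝ := ∫ t, moll n t * g (x - t)

lemma tendsto_mollify_of_continuous {g : E3 → ℝ} (hg : Continuous g) (x : E3) :
    Tendsto (fun n => mollify n g x) atTop (𝓝 (g x)) :=
  ContDiffBump.convolution_tendsto_right_of_continuous tendsto_rOut hg x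

lemma ae_tendsto_mollify {g : E3 → ℝ} (hg : LocallyIntegrable g) :
    ∀ᵐ x, Tendsto (fun n => mollify n g x) atTop (𝓝 (g x)) :=
  ContDiffBump.ae_convolution_tendsto_right_of_locallyIntegrable (φ := mollBump) (K := 2)
    tendsto_rOut (Eventually.of_forall fun n => by
      simp only [mollBump]
      apply le_of_eq
      field_simp) hg

lemma continuous_mollify (n : ℕ) {g : E3 → ℝ} (hg : LocallyIntegrable g) :
    Continuous (mollify n g) :=
  (hasCompactSupport_moll n).continuous_convolution_left (ContinuousLinearMap.lsmul ℝ ℝ)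
    (contDiff_moll n).continuous hg

/-- The reflected translate of a mollifier. -/
def mollAt (n : ℕ) (z x : E3) : ℝ := moll n (z - x)

lemma contDiff_mollAt (n : ℕ) (z : E3) : ContDiff ℝ ((⊤ : ℕ∞) : WithTop ℕ∞) (mollAt n z) :=
  (contDiff_moll n).comp (contDiff_const.sub contDiff_id)

lemma tsupport_mollAt_subset (n : ℕ) (z : E3) :
    tsupport (mollAt n z) ⊆ Metric.closedBall z (1 / (n + 1)) := by
  refine closure_minimal (fun x hx => ?_) Metric.isClosed_closedBall
  have h1 : z - x ∈ tsupport (moll n) := subset_tsupport _ hx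
  rw [tsupport_moll, mem_closedBall_zero_iff] at h1
  rwa [Metric.mem_closedBall, dist_comm, dist_eq_norm]

lemma hasCompactSupport_mollAt (n : ℕ) (z : E3) : HasCompactSupport (mollAt n z) :=
  HasCompactSupport.of_support_subset_isCompact (isCompact_closedBall z (1 / (n + 1)))
    ((subset_tsupport _).trans (tsupport_mollAt_subset n z))

lemma integrable_mollAt (n : ℕ) (z : E3) : Integrable (mollAt n z) :=
  (contDiff_mollAt n z).continuous.integrable_of_hasCompactSupport (hasCompactSupport_mollAt n z)

lemma integral_mollAt_mul (n : ℕ) (z : E3) (g : E3 → ℝ) :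
    ∫ x, mollAt n z x * g x = mollify n g z := by
  rw [mollify, ← integral_sub_left_eq_self _ volume z]
  simp only [mollAt, sub_sub_cancel]

lemma integral_abs_moll (n : ℕ) : ∫ x, |moll n x| = 1 := by
  simp only [abs_of_nonneg (moll_nonneg n _), integral_moll]

lemma integral_abs_mollAt (n : ℕ) (z : E3) : ∫ x, |mollAt n z x| = 1 := by
  simp only [mollAt]
  rw [integral_sub_left_eq_self (fun x => |moll n x|) volume z, integral_abs_moll]

namespace IsStationary

variable {Ω : Type*} [MeasurableSpace Ω] {P : Measure Ω} [IsProbabilityMeasure P]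
  {X : Ω → E3 → C4} {q : E3 → Matrix RealIdx RealIdx ℝ} {e₀ : NNReal}

lemma locallyIntegrable (h : IsStationary P X q e₀) (i j : RealIdx) :
    LocallyIntegrable fun z => q z i j :=
  (memLp_top_of_bound (h.aestronglyMeasurable i j) e₀
    (by simpa [Real.norm_eq_abs] using h.abs_le i j)).locallyIntegrable le_top

/-- Performing the second smearing first leaves a continuous mollification of `q` tested against
`f`, so the two smearing scales can be sent to zero one after the other. -/
lemma integral_mul_mollify (h : IsStationary P X q e₀) (i j : RealIdx) (n : ℕ) {f : E3 → ℝ}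
    (hf : Integrable f) :
    ∫ z, q z i j * ∫ y, f (z + y) * moll n y = ∫ x, f x * mollify n (fun z => q z i j) x := by
  have h1 : Integrable fun p : E3 × E3 => q (p.1 - p.2) i j * (f p.1 * moll n p.2) := by
    have := (h.integrable_mul (integrable_ofReal hf) (integrable_ofReal (integrable_moll n)) i j).re
    simp only [← Complex.ofReal_mul] at this
    exact this
  have h2 := integral_sub_mul (q := fun z => q z i j) h1
  rw [← h2, Measure.volume_eq_prod, integral_prod _ h1]
  refine integral_congr_ae (ae_of_all _ fun x => ?_)
  simp only [mollify, ← integral_const_mul]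
  refine integral_congr_ae (ae_of_all _ fun y => ?_)
  simp only; ring

/-- Smear with unit mass bumps near `z` and near `0`; the covariance bound does not see their
widths. The bump at `z` shrinks first, by continuity of the mollification, and the one at `0`
afterwards, by Lebesgue differentiation. -/
lemma abs_le_mixing (h : IsStationary P X q e₀) (h0 : HasZeroMean P X) (i j : RealIdx) :
    ∀ᵐ z, |q z i j| ≤ 2 * e₀ * Real.sqrt (mixingCoeff P X (‖z‖ / 2)).toReal := by
  have hz : ∀ᵐ z : E3, z ≠ 0 := by simp [ae_iff]
  filter_upwards [ae_tendsto_mollify (h.locallyIntegrable i j), hz] with z hlim hz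
  set C := 2 * e₀ * Real.sqrt (mixingCoeff P X (‖z‖ / 2)).toReal
  have hpos : 0 < ‖z‖ := norm_pos_iff.2 hz
  -- The closed supports of radius `1/(n+1)` are placed in open balls of twice the radius. Two such
  -- balls of radius below `‖z‖/4` remain at distance at least `‖z‖/2`.
  have hev : ∀ᶠ n : ℕ in atTop, 2 * (1 / ((n : ℝ) + 1)) < ‖z‖ / 4 := by
    have := (tendsto_one_div_add_atTop_nhds_zero_nat (𝕜 := ℝ)).const_mul 2
    rw [mul_zero] at this
    exact this.eventually_lt_const (by positivity)
  have hlt (n : ℕ) : 1 / ((n : ℝ) + 1) < 2 * (1 / ((n : ℝ) + 1)) := by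
    have : 0 < 1 / ((n : ℝ) + 1) := by positivity
    linarith
  have hG : ∀ᶠ n : ℕ in atTop, |mollify n (fun z => q z i j) z| ≤ C := by
    filter_upwards [hev] with n hn
    refine le_of_tendsto (tendsto_mollify_of_continuous
      (continuous_mollify n (h.locallyIntegrable i j)) z).abs ?_
    filter_upwards [hev] with k hk
    rw [← integral_mollAt_mul, ← h.integral_mul_mollify i j n (integrable_mollAt k z)]
    have := h.abs_corr_le_of_mixing h0 (contDiff_mollAt k z) (hasCompactSupport_mollAt k z)
      (contDiff_moll n) (hasCompactSupport_moll n) (a := z) (b := 0) (r := ‖z‖ / 2)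
      ((tsupport_mollAt_subset k z).trans (Metric.closedBall_subset_ball (hlt k)))
      ((tsupport_moll n).le.trans (Metric.closedBall_subset_ball (hlt n)))
      (by rw [dist_zero_right]; linarith) i j
    rwa [integral_abs_moll, integral_abs_mollAt, one_mul, mul_one] at this
  exact le_of_tendsto hlim.abs hG

/-- Polar coordinates in `ℝ³` produce exactly the weight `r²` of the mixing rate; measurability in
`r` follows from monotonicity, and the factor ½ is a dilation. -/
lemma integrable_sqrt_mixing (hS3 : IsStronglyMixing P X) :
    Integrable fun z : E3 => Real.sqrt (mixingCoeff P X (‖z‖ / 2)).toReal := by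
  have hne (r : ℝ) : mixingCoeff P X r ≠ ⊤ :=
    ne_top_of_le_ne_top ENNReal.one_ne_top (mixingCoeff_le_one P X r)
  have hanti : Antitone fun r => Real.sqrt (mixingCoeff P X r).toReal := fun r s hrs =>
    Real.sqrt_le_sqrt (ENNReal.toReal_mono (hne r) (mixingCoeff_antitone P X hrs))
  have h1 : Integrable fun z : E3 => Real.sqrt (mixingCoeff P X ‖z‖).toReal := by
    rw [integrable_fun_norm_addHaar volume (f := fun r => Real.sqrt (mixingCoeff P X r).toReal)]
    refine ⟨((measurable_id.pow_const _).mul hanti.measurable).aestronglyMeasurable, ?_⟩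
    rw [hasFiniteIntegral_iff_enorm]
    refine lt_of_le_of_lt (le_of_eq ?_) hS3.2
    refine setLIntegral_congr_fun measurableSet_Ioi fun r hr => ?_
    have hr' : (0 : ℝ) < r := hr
    simp only [finrank_euclideanSpace, Fintype.card_fin, smul_eq_mul, Nat.add_one_sub_one,
      enorm_mul]
    rw [Real.enorm_eq_ofReal (by positivity), Real.enorm_eq_ofReal (Real.sqrt_nonneg _),
      Real.sqrt_eq_rpow, ← ENNReal.ofReal_rpow_of_nonneg ENNReal.toReal_nonneg (by norm_num),
      ENNReal.ofReal_toReal (hne r)]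
  have h2 := h1.comp_smul (R := (1 / 2 : ℝ)) (by norm_num)
  refine h2.congr (ae_of_all _ fun z => ?_)
  simp only [norm_smul, norm_div, norm_one, Real.norm_two]
  rw [one_div_mul_eq_div]

theorem integrable_of_mixing (h : IsStationary P X q e₀) (h0 : HasZeroMean P X)
    (hS3 : IsStronglyMixing P X) (i j : RealIdx) : Integrable fun z => q z i j :=
  ((integrable_sqrt_mixing hS3).const_mul (2 * e₀ : ℝ)).mono' (h.aestronglyMeasurable i j)
    (h.abs_le_mixing h0 i j)

end IsStationary

/-! ### Integrability of the spectral density -/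

lemma integral_fourier_mul {f g : E3 → ℂ} (hf : Integrable f) (hg : Integrable g) :
    ∫ ξ, 𝓕 f ξ * g ξ = ∫ x, f x * 𝓕 g x := by
  simpa using! VectorFourier.integral_fourierIntegral_smul_eq_flip (L := innerₗ E3)
    Real.continuous_fourierChar continuous_inner hf hg

lemma continuous_fourier {f : E3 → ℂ} (hf : Integrable f) : Continuous (𝓕 f) :=
  VectorFourier.fourierIntegral_continuous (L := innerₗ E3) Real.continuous_fourierChar
    continuous_inner hf

lemma norm_fourier_le (g : E3 → ℂ) (x : E3) : ‖𝓕 g x‖ ≤ ∫ ξ, ‖g ξ‖ :=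
  VectorFourier.norm_fourierIntegral_le_integral_norm _ _ _ _ _

lemma integrable_gauss {b : ℝ} (hb : 0 < b) : Integrable fun x : E3 => Real.exp (-b * ‖x‖ ^ 2) := by
  have := (GaussianFourier.integrable_cexp_neg_mul_sq_norm_add (V := E3) (b := (b : ℂ))
    (by simpa) 0 0).re
  refine this.congr (ae_of_all _ fun x => ?_)
  simp only [zero_mul, add_zero, RCLike.re_to_complex]
  rw [← Complex.ofReal_neg, ← Complex.ofReal_pow, ← Complex.ofReal_mul, Complex.exp_ofReal_re]

lemma integral_gauss_pos {b : ℝ} (hb : 0 < b) : 0 < ∫ x : E3, Real.exp (-b * ‖x‖ ^ 2) := by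
  rw [GaussianFourier.integral_rexp_neg_mul_sq_norm hb]
  have := Real.pi_pos
  positivity

/-- Completing the square: `|z + y|² + |y|² = 2|y + z/2|² + |z|²/2`. -/
lemma integral_gauss_mul_gauss (s : ℝ) (z : E3) :
    ∫ y : E3, Real.exp (-s * ‖z + y‖ ^ 2) * Real.exp (-s * ‖y‖ ^ 2)
      = Real.exp (-(s / 2) * ‖z‖ ^ 2) * ∫ y : E3, Real.exp (-(2 * s) * ‖y‖ ^ 2) := by
  rw [← integral_add_right_eq_self (fun y : E3 => Real.exp (-(2 * s) * ‖y‖ ^ 2)) ((1 / 2 : ℝ) • z),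
    ← integral_const_mul]
  refine integral_congr_ae (ae_of_all _ fun y => ?_)
  simp only [← Real.exp_add]
  congr 1
  rw [norm_add_sq_real, norm_add_sq_real, inner_smul_right, norm_smul, real_inner_comm y z]
  norm_num
  ring

/-- The Gaussian wave packets `e^{-2πi⟨x,ξ⟩} e^{-s|x|²}`. -/
def wavePacket (s : ℝ) (ξ x : E3) : ℂ :=
  (Real.fourierChar (-(inner ℝ x ξ : ℝ)) : ℂ) * (Real.exp (-s * ‖x‖ ^ 2) : ℝ)

lemma integrable_wavePacket {s : ℝ} (hs : 0 < s) (ξ : E3) : Integrable (wavePacket s ξ) := by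
  refine (integrable_gauss hs).ofReal.bdd_mul (c := 1) ?_ (ae_of_all _ fun x => (Circle.norm_coe _).le)
  exact (by fun_prop : Continuous fun x : E3 =>
    (Real.fourierChar (-(inner ℝ x ξ : ℝ)) : ℂ)).aestronglyMeasurable

/-- The phases in `y` cancel, so the autocorrelation is again a plane wave times a Gaussian.
Correlations of fields smeared with wave packets therefore probe the spectral density near `ξ`. -/
lemma integral_wavePacket_mul (s : ℝ) (ξ z : E3) :
    ∫ y, wavePacket s ξ (z + y) * conj (wavePacket s ξ y)
      = (Real.fourierChar (-(inner ℝ z ξ : ℝ)) : ℂ) * (Real.exp (-(s / 2) * ‖z‖ ^ 2) : ℝ) *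
        ((∫ y : E3, Real.exp (-(2 * s) * ‖y‖ ^ 2) : ℝ) : ℂ) := by
  rw [mul_assoc, ← Complex.ofReal_mul, ← integral_gauss_mul_gauss, ← integral_complex_ofReal,
    ← integral_const_mul]
  refine integral_congr_ae (ae_of_all _ fun y => ?_)
  have h : (Real.fourierChar (-(inner ℝ y ξ : ℝ)) : ℂ) *
      conj (Real.fourierChar (-(inner ℝ y ξ : ℝ)) : ℂ) = 1 := by
    rw [Complex.mul_conj, Complex.normSq_eq_norm_sq, Circle.norm_coe]; norm_num
  simp only [wavePacket, map_mul, Complex.conj_ofReal, inner_add_left, neg_add, AddChar.map_add_eq_mul,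
    Circle.coe_mul, Complex.ofReal_mul]
  linear_combination (Real.fourierChar (-(inner ℝ z ξ : ℝ)) : ℂ) *
    (Real.exp (-s * ‖z + y‖ ^ 2) : ℂ) * (Real.exp (-s * ‖y‖ ^ 2) : ℂ) * h

section Stationary

variable {Ω : Type*} [MeasurableSpace Ω] {P : Measure Ω} [IsProbabilityMeasure P]
  {X : Ω → E3 → C4} {q : E3 → Matrix RealIdx RealIdx ℝ} {e₀ : NNReal}

/-- The spectral density of a stationary field. -/
abbrev spec (q : E3 → Matrix RealIdx RealIdx ℝ) (i j : RealIdx) : E3 → ℂ :=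
  fourierR fun z => q z i j

/-- Gaussian regularization of the spectral density. -/
def gaussSpec (q : E3 → Matrix RealIdx RealIdx ℝ) (s : ℝ) (i j : RealIdx) (ξ : E3) : ℂ :=
  ∫ z, Complex.exp (-(s : ℂ) * ‖z‖ ^ 2) •
    ((Real.fourierChar (-(inner ℝ z ξ : ℝ)) : ℂ) * ((q z i j : ℝ) : ℂ))

lemma tendsto_gaussSpec (hq : ∀ i j, Integrable fun z => q z i j) (i j : RealIdx) (ξ : E3) :
    Tendsto (fun c : ℝ => gaussSpec q c⁻¹ i j ξ) atTop (𝓝 (spec q i j ξ)) := by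
  have h : Integrable fun z : E3 =>
      (Real.fourierChar (-(inner ℝ z ξ : ℝ)) : ℂ) * ((q z i j : ℝ) : ℂ) := by
    simpa only [inner_neg_right, Circle.smul_def, smul_eq_mul] using
      integrable_fourierChar_smul (integrable_ofReal (hq i j)) (-ξ)
  have := Real.tendsto_integral_cexp_sq_smul h
  simp only [gaussSpec, spec, fourierR, Real.fourier_eq, Circle.smul_def, smul_eq_mul] at *
  simpa using this

namespace IsStationary

lemma integral_wavePacket (h : IsStationary P X q e₀) {s : ℝ} (hs : 0 < s) (ξ : E3)
    (i j : RealIdx) :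
    ∫ ω, (∫ x, ((realComp i (X ω x) : ℝ) : ℂ) * wavePacket s ξ x) *
        conj (∫ x, ((realComp j (X ω x) : ℝ) : ℂ) * wavePacket s ξ x) ∂P
      = ((∫ y : E3, Real.exp (-(2 * s) * ‖y‖ ^ 2) : ℝ) : ℂ) * gaussSpec q (s / 2) i j ξ := by
  have hf := integrable_wavePacket hs ξ
  have hg : Integrable fun y => conj (wavePacket s ξ y) :=
    (Complex.conjCLE.toContinuousLinearMap.integrable_comp hf)
  simp only [← integral_conj, map_mul, Complex.conj_ofReal]
  rw [h.integral_smeared hf hg i j, gaussSpec, ← integral_const_mul]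
  refine integral_congr_ae (ae_of_all _ fun z => ?_)
  simp only [integral_wavePacket_mul]
  push_cast
  simp only [smul_eq_mul]
  ring

/-- Positivity of the spectrum: up to a positive constant the entries are `E Fᵢ F̄ⱼ` for the wave
packet amplitudes `Fᵢ`, and `|Fᵢ F̄ⱼ| ≤ (|Fᵢ|² + |Fⱼ|²)/2`. Packets of parameter `2s` are used
because autocorrelation halves it. -/
lemma norm_gaussSpec_le (h : IsStationary P X q e₀) {s : ℝ} (hs : 0 < s) (ξ : E3)
    (i j : RealIdx) : ‖gaussSpec q s i j ξ‖ ≤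
      ((gaussSpec q s i i ξ).re + (gaussSpec q s j j ξ).re) / 2 := by
  have hs2 : 0 < 2 * s := by positivity
  set A := ∫ y : E3, Real.exp (-(2 * (2 * s)) * ‖y‖ ^ 2) with hA
  have hApos : 0 < A := integral_gauss_pos (by positivity)
  set F : RealIdx → Ω → ℂ := fun i ω => ∫ x, ((realComp i (X ω x) : ℝ) : ℂ) * wavePacket (2 * s) ξ x
    with hF
  have key (i j : RealIdx) : ∫ ω, F i ω * conj (F j ω) ∂P = (A : ℂ) * gaussSpec q s i j ξ := by
    have := h.integral_wavePacket hs2 ξ i j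
    rwa [mul_div_cancel_left₀ s two_ne_zero] at this
  have hf := integrable_wavePacket hs2 ξ
  have hg : Integrable fun y => conj (wavePacket (2 * s) ξ y) :=
    (Complex.conjCLE.toContinuousLinearMap.integrable_comp hf)
  have hint (i : RealIdx) : Integrable (fun ω => ‖F i ω‖ ^ 2) P := by
    have := (integral_smeared_mul_smeared h.random (h.isWeight hf) (h.isWeight hg) i i).1.re
    refine this.congr (ae_of_all _ fun ω => ?_)
    have e : ∫ y, ((realComp i (X ω y) : ℝ) : ℂ) * conj (wavePacket (2 * s) ξ y)
        = conj (F i ω) := by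
      simp only [hF, ← integral_conj, map_mul, Complex.conj_ofReal]
    change RCLike.re (F i ω * _) = _
    simp only [e, Complex.mul_conj, Complex.normSq_eq_norm_sq]
    simp
    norm_cast
  have hre (i : RealIdx) : ∫ ω, ‖F i ω‖ ^ 2 ∂P = A * (gaussSpec q s i i ξ).re := by
    have := congrArg Complex.re (key i i)
    simp only [Complex.mul_conj, Complex.normSq_eq_norm_sq, Complex.re_ofReal_mul] at this
    rw [← this, integral_complex_ofReal, Complex.ofReal_re]
  have h1 : ‖(A : ℂ) * gaussSpec q s i j ξ‖ ≤ ∫ ω, (‖F i ω‖ ^ 2 + ‖F j ω‖ ^ 2) / 2 ∂P := by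
    rw [← key i j]
    refine norm_integral_le_of_norm_le (((hint i).add (hint j)).div_const 2)
      (ae_of_all _ fun ω => ?_)
    rw [norm_mul, RCLike.norm_conj]
    nlinarith [sq_nonneg (‖F i ω‖ - ‖F j ω‖)]
  rw [norm_mul, Complex.norm_real, Real.norm_of_nonneg hApos.le, integral_div,
    integral_add (hint i) (hint j), hre, hre, ← mul_add, mul_div_assoc] at h1
  exact le_of_mul_le_mul_left h1 hApos

/-- The Gaussian regularization is removed in the limit. For `i = j` the estimate forces the
diagonal entries to be real and nonnegative. -/
lemma norm_spec_le (h : IsStationary P X q e₀) (hq : ∀ i j, Integrable fun z => q z i j) (ξ : E3)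
    (i j : RealIdx) : ‖spec q i j ξ‖ ≤ ((spec q i i ξ).re + (spec q j j ξ).re) / 2 := by
  have hc := Complex.continuous_re.tendsto
  refine le_of_tendsto_of_tendsto (tendsto_gaussSpec hq i j ξ).norm
    ((((hc _).comp (tendsto_gaussSpec hq i i ξ)).add
      ((hc _).comp (tendsto_gaussSpec hq j j ξ))).div_const 2) ?_
  filter_upwards [Ioi_mem_atTop 0] with c hc
  exact h.norm_gaussSpec_le (inv_pos.2 hc) ξ i j

end IsStationary

/-- The transform is a positive Gaussian, and its total mass is the value of the original at the
origin. -/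
lemma integral_norm_fourier_gauss {b : ℝ} (hb : 0 < b) :
    Integrable (𝓕 fun x : E3 => Complex.exp (-(b : ℂ) * ‖x‖ ^ 2)) ∧
    ∫ ξ, ‖𝓕 (fun x : E3 => Complex.exp (-(b : ℂ) * ‖x‖ ^ 2)) ξ‖ = 1 := by
  have hpi := Real.pi_pos
  have hn (ξ : E3) : 𝓕 (fun x : E3 => Complex.exp (-(b : ℂ) * ‖x‖ ^ 2)) ξ
      = (((Real.pi / b) ^ (Module.finrank ℝ E3 / 2 : ℝ) *
        Real.exp (-(Real.pi ^ 2 / b) * ‖ξ‖ ^ 2) : ℝ) : ℂ) := by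
    rw [fourier_gaussian_innerProductSpace (by simpa)]
    push_cast [Complex.ofReal_cpow (by positivity : 0 ≤ Real.pi / b)]
    congr 2
    ring
  have hn' : (𝓕 fun x : E3 => Complex.exp (-(b : ℂ) * ‖x‖ ^ 2)) = _ := funext hn
  have hbb : 0 < Real.pi ^ 2 / b := by positivity
  rw [hn']
  constructor
  · exact ((integrable_gauss hbb).const_mul _).ofReal
  · simp only [Complex.norm_real]
    rw [integral_congr_ae (ae_of_all _ fun ξ => Real.norm_of_nonneg (by positivity)),
      integral_const_mul, GaussianFourier.integral_rexp_neg_mul_sq_norm hbb,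
      ← Real.mul_rpow (by positivity) (by positivity)]
    rw [show Real.pi / b * (Real.pi / (Real.pi ^ 2 / b)) = 1 by field_simp, Real.one_rpow]

namespace IsStationary

/-- Positivity removes the norm. Moving the Fourier transform onto the Gaussian then pairs `q`,
bounded by `e₀`, with a function of unit `L¹` norm; the bound is independent of `b`. -/
lemma integral_spec_mul_gauss_le (h : IsStationary P X q e₀)
    (hq : ∀ i j, Integrable fun z => q z i j) {b : ℝ} (hb : 0 < b) (i : RealIdx) :
    ∫ ξ : E3, ‖spec q i i ξ‖ * Real.exp (-b * ‖ξ‖ ^ 2) ≤ e₀ := by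
  have hg : Integrable fun ξ : E3 => Complex.exp (-(b : ℂ) * ‖ξ‖ ^ 2) := by
    simpa using GaussianFourier.integrable_cexp_neg_mul_sq_norm_add (V := E3) (b := (b : ℂ))
      (by simpa) 0 0
  have h1 := integral_fourier_mul (hq i i).ofReal hg
  have hge (ξ : E3) : Complex.exp (-(b : ℂ) * ‖ξ‖ ^ 2) = (Real.exp (-b * ‖ξ‖ ^ 2) : ℝ) := by
    push_cast; rfl
  have hint : Integrable fun ξ => spec q i i ξ * Complex.exp (-(b : ℂ) * ‖ξ‖ ^ 2) :=
    hg.bdd_mul (continuous_fourier (hq i i).ofReal).aestronglyMeasurable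
      (ae_of_all _ fun ξ => norm_fourier_le _ ξ)
  have h2 : ∫ ξ : E3, ‖spec q i i ξ‖ * Real.exp (-b * ‖ξ‖ ^ 2)
      ≤ ∫ ξ, RCLike.re (spec q i i ξ * Complex.exp (-(b : ℂ) * ‖ξ‖ ^ 2)) := by
    refine integral_mono_of_nonneg (ae_of_all _ fun ξ => by positivity) hint.re
      (ae_of_all _ fun ξ => ?_)
    simp only [hge, RCLike.re_to_complex, Complex.re_mul_ofReal]
    have := h.norm_spec_le hq ξ i i
    rw [add_self_div_two] at this
    gcongr
  rw [integral_re hint] at h2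
  refine h2.trans ((Complex.re_le_norm _).trans ?_)
  have h3 : ∫ ξ, spec q i i ξ * Complex.exp (-(b : ℂ) * ‖ξ‖ ^ 2)
      = ∫ x, ((q x i i : ℝ) : ℂ) * 𝓕 (fun ξ : E3 => Complex.exp (-(b : ℂ) * ‖ξ‖ ^ 2)) x := h1
  rw [h3]
  obtain ⟨g1, g2⟩ := integral_norm_fourier_gauss hb
  refine (norm_integral_le_of_norm_le (g1.norm.const_mul (e₀ : ℝ)) ?_).trans ?_
  · filter_upwards [h.abs_le i i] with z hz
    rw [norm_mul, Complex.norm_real, Real.norm_eq_abs]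
    gcongr
  · rw [integral_const_mul, g2, mul_one]

/-- On the ball of radius `n + 1` the Gaussian with `b = (n + 1)⁻²` is at least `e⁻¹`, so the
integrals over balls are bounded by `e · e₀`. -/
lemma integrable_spec_diag (h : IsStationary P X q e₀) (hq : ∀ i j, Integrable fun z => q z i j)
    (i : RealIdx) : Integrable (spec q i i) := by
  have hc : Continuous (spec q i i) := continuous_fourier (hq i i).ofReal
  refine (aecover_ball (x := (0 : E3)) (r := fun n : ℕ => (n : ℝ) + 1)
    (tendsto_natCast_atTop_atTop.atTop_add tendsto_const_nhds)).integrable_of_integral_norm_bounded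
    (Real.exp 1 * e₀) (fun n => (hc.continuousOn.integrableOn_compact
      (isCompact_closedBall 0 _)).mono_set Metric.ball_subset_closedBall)
    (Eventually.of_forall fun n => ?_)
  set b : ℝ := (((n : ℝ) + 1) ^ 2)⁻¹ with hb
  have hbpos : 0 < b := by positivity
  refine le_trans ?_ (mul_le_mul_of_nonneg_left (h.integral_spec_mul_gauss_le hq hbpos i)
    (Real.exp_pos 1).le)
  rw [← integral_const_mul]
  have hint : Integrable fun ξ : E3 =>
      Real.exp 1 * (‖spec q i i ξ‖ * Real.exp (-b * ‖ξ‖ ^ 2)) :=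
    ((integrable_gauss hbpos).bdd_mul hc.norm.aestronglyMeasurable
      (ae_of_all _ fun ξ => by rw [norm_norm]; exact norm_fourier_le _ ξ)).const_mul _
  refine le_trans ?_ (setIntegral_le_integral (s := Metric.ball 0 ((n : ℝ) + 1)) hint
    (ae_of_all _ fun ξ => by positivity))
  refine setIntegral_mono_on ((hc.norm.continuousOn.integrableOn_compact
      (isCompact_closedBall 0 _)).mono_set Metric.ball_subset_closedBall) hint.integrableOn
      Metric.isOpen_ball.measurableSet fun ξ hξ => ?_
  rw [mul_left_comm, ← Real.exp_add]
  refine le_mul_of_one_le_right (norm_nonneg _) (Real.one_le_exp ?_)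
  rw [mem_ball_zero_iff] at hξ
  have : b * ‖ξ‖ ^ 2 ≤ 1 := by
    rw [hb, inv_mul_le_iff₀ (by positivity), mul_one]
    gcongr
  linarith

lemma integrable_spec (h : IsStationary P X q e₀) (hq : ∀ i j, Integrable fun z => q z i j)
    (i j : RealIdx) : Integrable (spec q i j) := by
  refine (((h.integrable_spec_diag hq i).re.add (h.integrable_spec_diag hq j).re).div_const 2).mono'
    (continuous_fourier (hq i j).ofReal).aestronglyMeasurable
    (ae_of_all _ fun ξ => h.norm_spec_le hq ξ i j)

end IsStationary

end Stationary

/-! ### The evolved and the limit spectral densities -/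

/-- The matrix of spectral densities. -/
def specMat (q : E3 → Matrix RealIdx RealIdx ℝ) (ξ : E3) : Matrix RealIdx RealIdx ℂ :=
  Matrix.of fun i j => spec q i j ξ

/-- The normalized symbol `ω⁻¹ P(2πiξ)`. -/
def unitSym (m : ℝ) (ξ : E3) : Matrix RealIdx RealIdx ℂ := ((freq m ξ)⁻¹ : ℂ) • sym m ξ

lemma norm_unitSym_le {m : ℝ} (hm : 0 < m) (ξ : E3) (i j : RealIdx) :
    ‖unitSym m ξ i j‖ ≤ symConst := by
  have h := freq_pos hm ξ
  rw [unitSym, Matrix.smul_apply, smul_eq_mul, norm_mul, norm_inv, Complex.norm_real,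
    Real.norm_of_nonneg h.le, inv_mul_le_iff₀ h, mul_comm]
  exact norm_sym_le hm ξ i j

lemma continuous_unitSym {m : ℝ} (hm : 0 < m) (i j : RealIdx) :
    Continuous fun ξ => unitSym m ξ i j := by
  have h1 : Continuous fun ξ => ((freq m ξ)⁻¹ : ℂ) := by
    refine (Complex.continuous_ofReal.comp (continuous_freq m)).inv₀ fun ξ => ?_
    simpa using (freq_pos hm ξ).ne'
  exact h1.mul (continuous_sym m i j)

lemma prop_eq (m t : ℝ) (ξ : E3) :
    prop m t ξ = (Real.cos (freq m ξ * t) : ℂ) • 1 + (Real.sin (freq m ξ * t) : ℂ) • unitSym m ξ := by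
  rw [prop, unitSym, smul_smul]
  push_cast
  rfl

lemma sym_neg_transpose (m : ℝ) (ξ : E3) : (sym m (-ξ)).transpose = -sym m ξ := by
  rw [sym, diracSymbol_transpose, sym]
  congr 2
  ext k
  simp

/-- In correlations the first factor enters at frequency `-ξ` and transposed, which amounts to time
reversal; hence the sandwich form of `evolvedSpec`. -/
lemma prop_neg_transpose (m t : ℝ) (ξ : E3) : (prop m t (-ξ)).transpose = prop m (-t) ξ := by
  simp [prop, freq_neg, sym_neg_transpose, neg_div]

/-- The spectral density at time `t`. -/
def evolvedSpec (m : ℝ) (q : E3 → Matrix RealIdx RealIdx ℝ) (t : ℝ) (ξ : E3) :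
    Matrix RealIdx RealIdx ℂ := prop m (-t) ξ * specMat q ξ * prop m t ξ

/-- The spectral density of the limit field. -/
def limSpec (m : ℝ) (q : E3 → Matrix RealIdx RealIdx ℝ) (ξ : E3) :
    Matrix RealIdx RealIdx ℂ :=
  (1 / 2 : ℂ) • (specMat q ξ - unitSym m ξ * specMat q ξ * unitSym m ξ)

/-- The amplitude of the oscillation with `cos (2ωt)`. -/
def cosSpec (m : ℝ) (q : E3 → Matrix RealIdx RealIdx ℝ) (ξ : E3) :
    Matrix RealIdx RealIdx ℂ :=
  (1 / 2 : ℂ) • (specMat q ξ + unitSym m ξ * specMat q ξ * unitSym m ξ)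

/-- The amplitude of the oscillation with `sin (2ωt)`. -/
def sinSpec (m : ℝ) (q : E3 → Matrix RealIdx RealIdx ℝ) (ξ : E3) :
    Matrix RealIdx RealIdx ℂ :=
  (1 / 2 : ℂ) • (specMat q ξ * unitSym m ξ - unitSym m ξ * specMat q ξ)

/-- With `c = cos ωt`, `s = sin ωt` and `J = ω⁻¹P`, the product `(c - sJ) Q (c + sJ)` is `c² Q - s²
JQJ + cs (QJ - JQ)`; then apply the double angle formulas. -/
lemma evolvedSpec_eq (m : ℝ) (q : E3 → Matrix RealIdx RealIdx ℝ) (t : ℝ) (ξ : E3) :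
    evolvedSpec m q t ξ = limSpec m q ξ + (Real.cos (2 * t * freq m ξ) : ℂ) • cosSpec m q ξ
      + (Real.sin (2 * t * freq m ξ) : ℂ) • sinSpec m q ξ := by
  have e : 2 * t * freq m ξ = 2 * (freq m ξ * t) := by ring
  have hcs : (Real.sin (freq m ξ * t) : ℂ) ^ 2 = 1 - (Real.cos (freq m ξ * t) : ℂ) ^ 2 := by
    rw [← Complex.ofReal_pow, Real.sin_sq]; push_cast; ring
  rw [evolvedSpec, prop_eq, prop_eq, limSpec, cosSpec, sinSpec, mul_neg, Real.cos_neg, Real.sin_neg,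
    e, Real.cos_two_mul, Real.sin_two_mul]
  set c := Real.cos (freq m ξ * t)
  set s := Real.sin (freq m ξ * t)
  simp only [add_mul, mul_add, Matrix.smul_mul, Matrix.mul_smul, one_mul, mul_one]
  ext i j
  simp only [Matrix.add_apply, Matrix.smul_apply, Matrix.sub_apply, smul_eq_mul]
  push_cast
  linear_combination (-(unitSym m ξ * specMat q ξ * unitSym m ξ) i j) * hcs

lemma integrable_bounded_mul_mul {M N : E3 → Matrix RealIdx RealIdx ℂ}
    {Q : E3 → Matrix RealIdx RealIdx ℂ} {C D : ℝ} (hM : ∀ i j, Continuous fun ξ => M ξ i j)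
    (hMb : ∀ ξ i j, ‖M ξ i j‖ ≤ C) (hN : ∀ i j, Continuous fun ξ => N ξ i j)
    (hNb : ∀ ξ i j, ‖N ξ i j‖ ≤ D) (hQ : ∀ i j, Integrable fun ξ => Q ξ i j) (i j : RealIdx) :
    Integrable fun ξ => (M ξ * Q ξ * N ξ) i j := by
  simp only [Matrix.mul_apply]
  refine integrable_finsetSum _ fun k _ => Integrable.mul_bdd (c := D) (integrable_finsetSum _ fun l _ => ?_)
    (hN k j).aestronglyMeasurable (ae_of_all _ fun ξ => hNb ξ k j)
  exact (hQ l k).bdd_mul (hM i l).aestronglyMeasurable (ae_of_all _ fun ξ => hMb ξ i l)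

section

variable {m : ℝ} {q : E3 → Matrix RealIdx RealIdx ℝ}

lemma integrable_evolvedSpec (hm : 0 < m) (hQ : ∀ i j, Integrable (spec q i j)) (t : ℝ)
    (i j : RealIdx) : Integrable fun ξ => evolvedSpec m q t ξ i j :=
  integrable_bounded_mul_mul (fun i j => continuous_prop hm _ i j)
    (fun ξ i j => norm_prop_le hm _ ξ i j) (fun i j => continuous_prop hm _ i j)
    (fun ξ i j => norm_prop_le hm _ ξ i j) hQ i j

lemma integrable_unitSym_mul_mul (hm : 0 < m) (hQ : ∀ i j, Integrable (spec q i j))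
    (i j : RealIdx) : Integrable fun ξ => (unitSym m ξ * specMat q ξ * unitSym m ξ) i j :=
  integrable_bounded_mul_mul (fun i j => continuous_unitSym hm i j)
    (fun ξ i j => norm_unitSym_le hm ξ i j) (fun i j => continuous_unitSym hm i j)
    (fun ξ i j => norm_unitSym_le hm ξ i j) hQ i j

lemma norm_one_apply_le (i j : RealIdx) : ‖(1 : Matrix RealIdx RealIdx ℂ) i j‖ ≤ 1 := by
  rw [Matrix.one_apply]
  split_ifs <;> simp

lemma integrable_limSpec (hm : 0 < m) (hQ : ∀ i j, Integrable (spec q i j)) (i j : RealIdx) :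
    Integrable fun ξ => limSpec m q ξ i j :=
  ((hQ i j).sub (integrable_unitSym_mul_mul hm hQ i j)).const_mul _

lemma integrable_cosSpec (hm : 0 < m) (hQ : ∀ i j, Integrable (spec q i j)) (i j : RealIdx) :
    Integrable fun ξ => cosSpec m q ξ i j :=
  ((hQ i j).add (integrable_unitSym_mul_mul hm hQ i j)).const_mul _

lemma integrable_sinSpec (hm : 0 < m) (hQ : ∀ i j, Integrable (spec q i j)) (i j : RealIdx) :
    Integrable fun ξ => sinSpec m q ξ i j := by
  have h1 := integrable_bounded_mul_mul (M := fun _ => 1) (Q := specMat q) (N := unitSym m)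
    (fun i j => continuous_const) (fun _ => norm_one_apply_le)
    (fun i j => continuous_unitSym hm i j) (fun ξ i j => norm_unitSym_le hm ξ i j) hQ i j
  have h2 := integrable_bounded_mul_mul (M := unitSym m) (Q := specMat q) (N := fun _ => 1)
    (fun i j => continuous_unitSym hm i j) (fun ξ i j => norm_unitSym_le hm ξ i j)
    (fun i j => continuous_const) (fun _ => norm_one_apply_le) hQ i j
  simp only [one_mul] at h1
  simp only [mul_one] at h2
  exact (h1.sub h2).const_mul _

/-- Change of convention: the kernel `e^{ik·z}` is `e^{-2πi z·ξ}` at `ξ = -k/2π`. -/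
lemma fourierMat_eq (k : E3) : fourierMat q k = specMat q ((-(2 * Real.pi)⁻¹ : ℝ) • k) := by
  ext i j
  simp only [fourierMat, specMat, Matrix.of_apply, spec, fourierR, Real.fourier_eq', smul_eq_mul]
  refine integral_congr_ae (ae_of_all _ fun z => ?_)
  simp only [inner_smul_right, real_inner_comm k z]
  congr 2
  push_cast
  have := Complex.ofReal_ne_zero.2 Real.pi_ne_zero
  field_simp

/-- At `ξ = -k/2π` one has `-ik = 2πiξ` and `|k|² + m² = ω(ξ)²`, while `Pᵀ(ik) = -P(-ik)` supplies
the minus sign. -/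
lemma limitSpectrum_eq (hm : 0 < m) (k : E3) :
    limitSpectrum m q k = limSpec m q ((-(2 * Real.pi)⁻¹ : ℝ) • k) := by
  have hpi := Real.pi_pos
  have hpi' := Complex.ofReal_ne_zero.2 Real.pi_ne_zero
  set ξ := (-(2 * Real.pi)⁻¹ : ℝ) • k with hξ
  have hfr : ‖k‖ ^ 2 + m ^ 2 = freq m ξ ^ 2 := by
    rw [freq_sq, hξ, norm_smul, norm_neg, norm_inv, Real.norm_of_nonneg (by positivity)]
    field_simp
  have h1 : diracSymbol m (fun j => -(Complex.I * ((k j : ℝ) : ℂ))) = sym m ξ := by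
    rw [sym]
    congr 1
    ext j
    simp only [hξ, PiLp.smul_apply, smul_eq_mul]
    push_cast
    field_simp
  have h2 : (diracSymbol m (fun j => Complex.I * ((k j : ℝ) : ℂ))).transpose = -sym m ξ := by
    rw [diracSymbol_transpose, ← h1]
    rfl
  rw [limitSpectrum, fourierMat_eq, h1, h2, hfr, limSpec, unitSym]
  ext i j
  simp only [Matrix.smul_mul, Matrix.mul_smul, mul_neg, Matrix.add_apply, Matrix.smul_apply,
    Matrix.sub_apply, Matrix.neg_apply, smul_eq_mul]
  push_cast
  ring

lemma integrable_fourierMat (hQ : ∀ i j, Integrable (spec q i j)) (i j : RealIdx) :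
    Integrable fun k => fourierMat q k i j := by
  simp only [fourierMat_eq]
  exact (hQ i j).comp_smul (by simp [Real.pi_ne_zero])

lemma integrable_limitSpectrum (hm : 0 < m) (hQ : ∀ i j, Integrable (spec q i j)) (i j : RealIdx) :
    Integrable fun k => limitSpectrum m q k i j := by
  simp only [limitSpectrum_eq hm]
  exact (integrable_limSpec hm hQ i j).comp_smul (by simp [Real.pi_ne_zero])

lemma limitCorrelation_eq (hm : 0 < m) (z : E3) (i j : RealIdx) :
    limitCorrelation m q z i j = 𝓕⁻ (fun ξ => limSpec m q ξ i j) z := by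
  have hpi := Real.pi_pos
  have hpi' := Complex.ofReal_ne_zero.2 Real.pi_ne_zero
  simp only [limitCorrelation, fourierInvMat, Matrix.of_apply, limitSpectrum_eq hm,
    Real.fourierInv_eq', smul_eq_mul]
  have h := Measure.integral_comp_smul (volume : Measure E3)
    (fun ξ => Complex.exp (((2 * Real.pi * (inner ℝ ξ z : ℝ) : ℝ) : ℂ) * Complex.I)
      * limSpec m q ξ i j) (-(2 * Real.pi)⁻¹)
  have h2 : |((-(2 * Real.pi)⁻¹) ^ Module.finrank ℝ E3)⁻¹| = (2 * Real.pi) ^ 3 := by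
    rw [finrank_euclideanSpace_fin, abs_inv, abs_pow, abs_neg, abs_inv, abs_of_pos (by positivity),
      inv_pow, inv_inv]
  rw [h2] at h
  have h3 : ∀ k : E3, Complex.exp (((2 * Real.pi *
      (inner ℝ ((-(2 * Real.pi)⁻¹ : ℝ) • k) z : ℝ) : ℝ) : ℂ) * Complex.I)
      = Complex.exp (-(Complex.I * ((inner ℝ k z : ℝ) : ℂ))) := by
    intro k
    rw [real_inner_smul_left]
    congr 1
    push_cast
    field_simp
  simp only [h3] at h
  rw [h, Complex.real_smul, ← mul_assoc, ← Complex.ofReal_mul, inv_mul_cancel₀ (by positivity),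
    Complex.ofReal_one, one_mul]

end

/-! ### Correlations of the smeared evolved field -/

/-- The correlation `z ↦ ∫ u(z + y) v(y) dy` of two functions. -/
def crossCorr (u v : E3 → ℂ) (z : E3) : ℂ := ∫ y, u (z + y) * v y

lemma integrable_crossCorr {u v : E3 → ℂ} (hu : Integrable u) (hv : Integrable v) :
    Integrable (crossCorr u v) := by
  have h := measurePreserving_shear.integrable_comp_of_integrable (hu.mul_prod hv)
  exact h.integral_prod_left

lemma continuous_crossCorr {u v : E3 → ℂ} (hu : Continuous u) {C : ℝ} (hC : ∀ x, ‖u x‖ ≤ C)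
    (hv : Integrable v) : Continuous (crossCorr u v) := by
  refine continuous_of_dominated (bound := fun y => C * ‖v y‖) (fun z => ?_) (fun z => ?_)
    (hv.norm.const_mul C) (ae_of_all _ fun y => by fun_prop)
  · exact (hu.comp (continuous_const.add continuous_id)).aestronglyMeasurable.mul
      hv.aestronglyMeasurable
  · refine ae_of_all _ fun y => ?_
    rw [norm_mul]
    exact mul_le_mul_of_nonneg_right (hC _) (norm_nonneg _)

/-- The character at `x - y` splits into a factor for each variable, after which Fubini and the
shear apply. -/
lemma fourierInv_crossCorr {u v : E3 → ℂ} (hu : Integrable u) (hv : Integrable v) (ξ : E3) :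
    𝓕⁻ (crossCorr u v) ξ = 𝓕 u (-ξ) * 𝓕 v ξ := by
  set e : E3 → ℂ := fun z => (Real.fourierChar (inner ℝ z ξ : ℝ) : ℂ) with he
  have hec : Continuous e := by fun_prop
  have hsub (x y : E3) : e (x - y) = e x * (Real.fourierChar (-(inner ℝ y ξ : ℝ)) : ℂ) := by
    simp only [he, inner_sub_left]
    rw [sub_eq_add_neg, AddChar.map_add_eq_mul, Circle.coe_mul]
  have hint : Integrable fun p : E3 × E3 => e (p.1 - p.2) * (u p.1 * v p.2) := by
    refine (hu.mul_prod hv).bdd_mul (c := 1)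
      (hec.comp (continuous_fst.sub continuous_snd)).aestronglyMeasurable
      (ae_of_all _ fun p => (Circle.norm_coe _).le)
  have h := integral_sub_mul hint
  have h2 : ∫ p : E3 × E3, e (p.1 - p.2) * (u p.1 * v p.2) = 𝓕 u (-ξ) * 𝓕 v ξ := by
    rw [Real.fourier_eq, Real.fourier_eq, ← integral_prod_mul]
    refine integral_congr_ae (ae_of_all _ fun p => ?_)
    simp only [hsub]
    simp only [inner_neg_right, neg_neg, Circle.smul_def, smul_eq_mul, he]
    ring
  rw [← h2, h, Real.fourierInv_eq]
  simp only [Circle.smul_def, smul_eq_mul, crossCorr, he]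

lemma integral_fourierInv_mul {f g : E3 → ℂ} (hf : Integrable f) (hg : Integrable g) :
    ∫ ξ, 𝓕⁻ f ξ * g ξ = ∫ x, f x * 𝓕⁻ g x := by
  have h := integral_fourier_mul hf hg.comp_neg
  simp only [Real.fourierInv_eq_fourier_neg]
  rw [← integral_neg_eq_self]
  simp only [neg_neg]
  rw [h]
  simp only [← Real.fourierInv_eq_fourier_neg, ← Real.fourierInv_eq_fourier_comp_neg]

lemma integral_fourierInv_mul_crossCorr {h u v : E3 → ℂ} (hh : Integrable h) (hu : Integrable u)
    (hv : Integrable v) :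
    ∫ z, 𝓕⁻ h z * crossCorr u v z = ∫ ξ, h ξ * (𝓕 u (-ξ) * 𝓕 v ξ) := by
  simp only [integral_fourierInv_mul hh (integrable_crossCorr hu hv), fourierInv_crossCorr hu hv]

lemma integral_mul_crossCorr {q u v : E3 → ℂ} (hq : Integrable q) (hu : Integrable u)
    (huc : Continuous u) {C : ℝ} (hC : ∀ x, ‖u x‖ ≤ C) (hv : Integrable v)
    (hG : Integrable fun ξ => 𝓕 u (-ξ) * 𝓕 v ξ) :
    ∫ z, q z * crossCorr u v z = ∫ ξ, 𝓕 q ξ * (𝓕 u (-ξ) * 𝓕 v ξ) := by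
  have e : 𝓕⁻ (crossCorr u v) = fun ξ => 𝓕 u (-ξ) * 𝓕 v ξ :=
    funext fun ξ => fourierInv_crossCorr hu hv ξ
  have hinv : 𝓕 (fun ξ => 𝓕 u (-ξ) * 𝓕 v ξ) = crossCorr u v := by
    rw [← e]
    refine (continuous_crossCorr huc hC hv).fourier_fourierInv_eq (integrable_crossCorr hu hv) ?_
    have := (e ▸ hG : Integrable (𝓕⁻ (crossCorr u v))).comp_neg
    simpa [Real.fourierInv_eq_fourier_neg] using this
  rw [integral_fourier_mul hq hG, hinv]

lemma integrable_fourierR_mul {f g : E3 → ℝ} (hf : Integrable f) (hg : IsRapid (fourierR g)) :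
    Integrable fun ξ => fourierR f (-ξ) * fourierR g ξ :=
  hg.integrable.bdd_mul ((continuous_fourier hf.ofReal).comp continuous_neg).aestronglyMeasurable
    (ae_of_all _ fun _ => norm_fourier_le _ _)

section Evolved

set_option linter.unusedSectionVars false

variable {Ω : Type*} [MeasurableSpace Ω] {P : Measure Ω} [IsProbabilityMeasure P]
  {q : E3 → Matrix RealIdx RealIdx ℝ} {e₀ : NNReal} {m : ℝ}

lemma IsTestVec.integrable {φ : RealIdx → E3 → ℝ} (hφ : IsTestVec φ) (i : RealIdx) :
    Integrable (φ i) :=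
  (hφ.smooth i).continuous.integrable_of_hasCompactSupport (hφ.compact i)

lemma IsStationary.integral_smear_mul_eq_spec {X : Ω → E3 → C4} (h : IsStationary P X q e₀)
    (hq : ∀ i j, Integrable fun z => q z i j) {u v : RealIdx → E3 → ℝ} (hu : IsTestVec u)
    (hv : IsTestVec v) (a b : RealIdx) :
    ((∫ ω, smear X a (u a) ω * smear X b (v b) ω ∂P : ℝ) : ℂ)
      = ∫ ξ, spec q a b ξ * (fourierR (u a) (-ξ) * fourierR (v b) ξ) := by
  obtain ⟨C, hC⟩ := (hu.smooth a).continuous.bounded_above_of_compact_support (hu.compact a)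
  rw [h.integral_smear_mul (hu.integrable a) (hv.integrable b), ← integral_complex_ofReal]
  have := integral_mul_crossCorr (hq a b).ofReal (hu.integrable a).ofReal
    (Complex.continuous_ofReal.comp (hu.smooth a).continuous) (C := C)
    (fun x => by simpa using hC x) (hv.integrable b).ofReal
    (integrable_fourierR_mul (hu.integrable a) (isRapid_fourierR (hv.smooth b) (hv.compact b)))
  refine Eq.trans (integral_congr_ae (ae_of_all _ fun z => ?_)) this
  simp only [crossCorr]
  push_cast [← integral_complex_ofReal]
  rfl

/-- The test vector with `i`-th component `f` and all others zero. -/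
abbrev single (i : RealIdx) (f : E3 → ℝ) : RealIdx → E3 → ℝ := fun j => if j = i then f else 0

lemma waveSpec_single (t : ℝ) (i : RealIdx) (f : E3 → ℝ) (a : RealIdx) (ξ : E3) :
    waveSpec m (single i f) t a ξ = prop m t ξ a i * fourierR f ξ := by
  rw [waveSpec, Finset.sum_eq_single i]
  · simp [single]
  · intro j _ hj
    have : fourierR (single i f j) ξ = 0 := by
      simp [single, hj, fourierR, Real.fourier_eq]
    rw [this, mul_zero]
  · simp

lemma ae_smear_evolved (hm : 0 < m) {ψ₀ : Ω → E3 → C4} {ψ : ℝ → Ω → E3 → C4}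
    (hψ : IsRandomSolution P m ψ₀ ψ) {f : E3 → ℝ} (hf : ContDiff ℝ ((⊤ : ℕ∞) : WithTop ℕ∞) f)
    (hc : HasCompactSupport f) (t : ℝ) (i : RealIdx) :
    ∀ᵐ ω ∂P, smear (ψ t) i f ω = ∑ a, smear ψ₀ a (waveR m (single i f) t a) ω := by
  filter_upwards [hψ.solution] with ω hω
  have h := pairingR_eq_of_isSolution hm hω (isTestVec_single hf hc i) t
  rw [← pairing_ofRealField, pairing_single] at h
  exact h

lemma memLp_smear_evolved (hm : 0 < m) {ψ₀ : Ω → E3 → C4} {ψ : ℝ → Ω → E3 → C4}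
    (h : IsStationary P ψ₀ q e₀)
    (hψ : IsRandomSolution P m ψ₀ ψ) {f : E3 → ℝ} (hf : ContDiff ℝ ((⊤ : ℕ∞) : WithTop ℕ∞) f)
    (hc : HasCompactSupport f) (t : ℝ) (i : RealIdx) : MemLp (smear (ψ t) i f) 2 P := by
  refine (memLp_congr_ae (ae_smear_evolved hm hψ hf hc t i)).2 (memLp_finsetSum _ fun a _ => ?_)
  exact memLp_smear h.random (h.isWeight (integrable_ofReal
    ((isTestVec_waveR hm (isTestVec_single hf hc i) t).integrable a))) a

/-- By duality the evolved smearings are sums of initial smearings with adjoint waves, whose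
transforms are columns of the propagator. Parseval then places `specMat q` between two propagators,
the left one transposed at `-ξ`. -/
lemma integral_smear_evolved (hm : 0 < m) {ψ₀ : Ω → E3 → C4} {ψ : ℝ → Ω → E3 → C4}
    (h : IsStationary P ψ₀ q e₀) (hq : ∀ i j, Integrable fun z => q z i j)
    (hψ : IsRandomSolution P m ψ₀ ψ) {f g : E3 → ℝ}
    (hf : ContDiff ℝ ((⊤ : ℕ∞) : WithTop ℕ∞) f) (hfc : HasCompactSupport f)
    (hg : ContDiff ℝ ((⊤ : ℕ∞) : WithTop ℕ∞) g) (hgc : HasCompactSupport g)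
    (t : ℝ) (i j : RealIdx) :
    ((∫ ω, smear (ψ t) i f ω * smear (ψ t) j g ω ∂P : ℝ) : ℂ)
      = ∫ ξ, evolvedSpec m q t ξ i j * (fourierR f (-ξ) * fourierR g ξ) := by
  have hsf := isTestVec_single hf hfc i
  have hsg := isTestVec_single hg hgc j
  set u := waveR m (single i f) t with hu_def
  set v := waveR m (single j g) t with hv_def
  have hu : IsTestVec u := isTestVec_waveR hm hsf t
  have hv : IsTestVec v := isTestVec_waveR hm hsg t
  have hmem {w : RealIdx → E3 → ℝ} (hw : IsTestVec w) (a : RealIdx) :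
      MemLp (smear ψ₀ a (w a)) 2 P :=
    memLp_smear h.random (h.isWeight (integrable_ofReal (hw.integrable a))) a
  have hue (a ξ) : fourierR (u a) ξ = prop m t ξ a i * fourierR f ξ := by
    rw [hu_def, fourierR_waveR hm hsf, waveSpec_single]
  have hve (a ξ) : fourierR (v a) ξ = prop m t ξ a j * fourierR g ξ := by
    rw [hv_def, fourierR_waveR hm hsg, waveSpec_single]
  have h1 : ∫ ω, smear (ψ t) i f ω * smear (ψ t) j g ω ∂P
      = ∑ a, ∑ b, ∫ ω, smear ψ₀ a (u a) ω * smear ψ₀ b (v b) ω ∂P := by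
    have hi (a b) : Integrable (fun ω => smear ψ₀ a (u a) ω * smear ψ₀ b (v b) ω) P :=
      (hmem hu a).integrable_mul (hmem hv b)
    simp only [← integral_finsetSum _ fun b _ => hi _ b]
    rw [← integral_finsetSum _ fun a _ => integrable_finsetSum _ fun b _ => hi a b]
    refine integral_congr_ae ?_
    filter_upwards [ae_smear_evolved hm hψ hf hfc t i, ae_smear_evolved hm hψ hg hgc t j]
      with ω h1 h2
    rw [h1, h2, Finset.sum_mul_sum]
  have hint (a b) : Integrable fun ξ =>
      spec q a b ξ * (fourierR (u a) (-ξ) * fourierR (v b) ξ) :=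
    (integrable_fourierR_mul (hu.integrable a)
      (isRapid_fourierR (hv.smooth b) (hv.compact b))).bdd_mul
      (continuous_fourier (hq a b).ofReal).aestronglyMeasurable
      (ae_of_all _ fun ξ => norm_fourier_le _ ξ)
  rw [h1]
  push_cast
  simp only [h.integral_smear_mul_eq_spec hq hu hv, ← integral_finsetSum _ fun b _ => hint _ b]
  rw [← integral_finsetSum _ fun a _ => integrable_finsetSum _ fun b _ => hint a b]
  refine integral_congr_ae (ae_of_all _ fun ξ => ?_)
  have hp (a : RealIdx) : prop m t (-ξ) a i = prop m (-t) ξ i a := by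
    rw [← prop_neg_transpose]; rfl
  simp only [hue, hve, hp, evolvedSpec, Matrix.mul_apply, specMat, Matrix.of_apply, Finset.sum_mul]
  rw [Finset.sum_comm]
  refine Finset.sum_congr rfl fun a _ => Finset.sum_congr rfl fun b _ => ?_
  ring

end Evolved

/-! ### Local second moments of the evolved field -/

lemma MemH.locallyIntegrable_realComp {v : E3 → C4} (hv : MemH v) (j : RealIdx) :
    LocallyIntegrable fun x => DiracField.realComp j (v x) := by
  intro x
  have : IsFiniteMeasure (volume.restrict (Metric.ball (0 : E3) (‖x‖ + 1))) :=
    ⟨by rw [Measure.restrict_apply_univ]; exact measure_ball_lt_top⟩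
  exact ⟨Metric.ball 0 (‖x‖ + 1), Metric.isOpen_ball.mem_nhds (by simp),
    (hv.realComp j (‖x‖ + 1)).integrable (by norm_num)⟩

section

set_option linter.unusedSectionVars false

variable {Ω : Type*} [MeasurableSpace Ω] {P : Measure Ω} [IsProbabilityMeasure P]
  {q : E3 → Matrix RealIdx RealIdx ℝ} {e₀ : NNReal} {m : ℝ}

lemma smear_mollAt (X : Ω → E3 → C4) (i : RealIdx) (n : ℕ) (x : E3) (ω : Ω) :
    smear X i (mollAt n x) ω = mollify n (fun y => realComp i (X ω y)) x := by
  rw [← integral_mollAt_mul, smear]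
  simp only [mul_comm]

lemma aemeasurable_smear_mollAt {X : Ω → E3 → C4} (hX : IsRandomFunction P X) (i : RealIdx) (n : ℕ) :
    AEMeasurable (fun p : Ω × E3 => smear X i (mollAt n p.2) p.1) (P.prod volume) := by
  have h1 : AEMeasurable (fun r : (Ω × E3) × E3 => realComp i (X r.1.1 r.2))
      ((P.prod volume).prod volume) :=
    (aemeasurable_realComp hX i).comp_quasiMeasurePreserving
      (QuasiMeasurePreserving.prodMap Measure.quasiMeasurePreserving_fst (.id volume))
  have h2 : Measurable fun r : (Ω × E3) × E3 => moll n (r.1.2 - r.2) :=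
    (contDiff_moll n).continuous.measurable.comp
      ((measurable_snd.comp measurable_fst).sub measurable_snd)
  exact ((h1.mul h2.aemeasurable).aestronglyMeasurable.integral_prod_right').aemeasurable

lemma norm_fourierR_mollAt_le (n : ℕ) (x ξ : E3) : ‖fourierR (mollAt n x) ξ‖ ≤ 1 := by
  refine (norm_fourier_le _ ξ).trans (le_of_eq ?_)
  simpa using integral_abs_mollAt n x

variable {ψ₀ : Ω → E3 → C4} {ψ : ℝ → Ω → E3 → C4}

/-- Mollifiers have transforms of modulus at most one, so integrability of the evolved spectrum
bounds the variance independently of the width `n` and the centre `x`. -/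
lemma lintegral_smear_mollAt_le (hm : 0 < m) (h : IsStationary P ψ₀ q e₀)
    (hq : ∀ i j, Integrable fun z => q z i j) (hQ : ∀ i j, Integrable (spec q i j))
    (hψ : IsRandomSolution P m ψ₀ ψ) (t : ℝ) (i : RealIdx) (n : ℕ) (x : E3) :
    ∫⁻ ω, ‖smear (ψ t) i (mollAt n x) ω‖ₑ ^ 2 ∂P
      ≤ ENNReal.ofReal (∫ ξ, ‖evolvedSpec m q t ξ i i‖) := by
  have hs := memLp_smear_evolved hm h hψ (contDiff_mollAt n x) (hasCompactSupport_mollAt n x) t i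
  have e : ∫⁻ ω, ‖smear (ψ t) i (mollAt n x) ω‖ₑ ^ 2 ∂P
      = ENNReal.ofReal (∫ ω, smear (ψ t) i (mollAt n x) ω * smear (ψ t) i (mollAt n x) ω ∂P) := by
    have hs2 : Integrable (fun ω => smear (ψ t) i (mollAt n x) ω * smear (ψ t) i (mollAt n x) ω) P :=
      hs.integrable_mul hs
    rw [ofReal_integral_eq_lintegral_ofReal hs2 (ae_of_all _ fun ω => mul_self_nonneg _)]
    refine lintegral_congr fun ω => ?_
    rw [← sq, ← sq_abs, ENNReal.ofReal_pow (abs_nonneg _), ← Real.norm_eq_abs, ofReal_norm]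
  rw [e]
  refine ENNReal.ofReal_le_ofReal ((le_abs_self _).trans ?_)
  rw [← Real.norm_eq_abs, ← Complex.norm_real, integral_smear_evolved hm h hq hψ
    (contDiff_mollAt n x) (hasCompactSupport_mollAt n x) (contDiff_mollAt n x)
    (hasCompactSupport_mollAt n x)]
  refine norm_integral_le_of_norm_le (integrable_evolvedSpec hm hQ t i i).norm
    (ae_of_all _ fun ξ => ?_)
  rw [norm_mul, norm_mul]
  exact mul_le_of_le_one_right (norm_nonneg _) (mul_le_one₀ (norm_fourierR_mollAt_le n x _)
    (norm_nonneg _) (norm_fourierR_mollAt_le n x _))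

/-- Beforehand `ψ t` is only known to be almost surely in `L²_loc`, without moments. Its
mollifications converge for almost every `x` along almost every path, and Fatou, once in `x` and
once in `ω`, carries their uniform second moment bound to the limit. -/
lemma lintegral_sq_ball_lt_top (hm : 0 < m) (h : IsStationary P ψ₀ q e₀)
    (hq : ∀ i j, Integrable fun z => q z i j) (hQ : ∀ i j, Integrable (spec q i j))
    (hψ : IsRandomSolution P m ψ₀ ψ) (t : ℝ) (i : RealIdx) (R : ℝ) :
    ∫⁻ ω, (∫⁻ x in Metric.ball 0 R, ‖realComp i (ψ t ω x)‖ₑ ^ 2) ∂P < ⊤ := by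
  set C := ∫ ξ, ‖evolvedSpec m q t ξ i i‖
  set B := Metric.ball (0 : E3) R
  set F : ℕ → Ω → E3 → ENNReal := fun n ω x => ‖smear (ψ t) i (mollAt n x) ω‖ₑ ^ 2
  have hF (n : ℕ) : AEMeasurable (Function.uncurry (F n)) (P.prod (volume.restrict B)) := by
    have h1 := ((aemeasurable_smear_mollAt (hψ.random t) i n).enorm).pow_const 2
    refine h1.mono_ac ?_
    exact Measure.AbsolutelyContinuous.rfl.prod Measure.restrict_le_self.absolutelyContinuous
  have h1 : ∀ᵐ ω ∂P, ∫⁻ x in B, ‖realComp i (ψ t ω x)‖ₑ ^ 2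
      ≤ liminf (fun n => ∫⁻ x in B, F n ω x) atTop := by
    filter_upwards [(hψ.random t).memH] with ω hω
    have hloc := hω.locallyIntegrable_realComp i
    have hle : ∫⁻ x in B, ‖realComp i (ψ t ω x)‖ₑ ^ 2
        ≤ ∫⁻ x in B, liminf (fun n => F n ω x) atTop := by
      refine lintegral_mono_ae (ae_restrict_of_ae ?_)
      filter_upwards [ae_tendsto_mollify hloc] with x hx
      have : Tendsto (fun n => F n ω x) atTop (𝓝 (‖realComp i (ψ t ω x)‖ₑ ^ 2)) := by
        simp only [F, smear_mollAt]
        exact ((ENNReal.continuous_pow 2).tendsto _).comp ((continuous_enorm.tendsto _).comp hx)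
      rw [this.liminf_eq]
    refine hle.trans (lintegral_liminf_le' fun n => ?_)
    simp only [F, smear_mollAt]
    exact ((continuous_mollify n hloc).measurable.enorm.pow_const 2).aemeasurable
  calc ∫⁻ ω, (∫⁻ x in B, ‖realComp i (ψ t ω x)‖ₑ ^ 2) ∂P
      ≤ ∫⁻ ω, liminf (fun n => ∫⁻ x in B, F n ω x) atTop ∂P := lintegral_mono_ae h1
    _ ≤ liminf (fun n => ∫⁻ ω, (∫⁻ x in B, F n ω x) ∂P) atTop :=
        lintegral_liminf_le' fun n => (hF n).lintegral_prod_right'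
    _ ≤ ENNReal.ofReal C * volume B := by
        refine liminf_le_of_le (by isBoundedDefault) fun b hb => ?_
        obtain ⟨n, hn⟩ := hb.exists
        refine hn.trans ?_
        rw [lintegral_lintegral_swap (hF n)]
        refine (lintegral_mono fun x =>
          lintegral_smear_mollAt_le hm h hq hQ hψ t i n x).trans ?_
        simp [C]
    _ < ⊤ := ENNReal.mul_lt_top ENNReal.ofReal_lt_top measure_ball_lt_top

lemma isWeight_evolved (hm : 0 < m) (h : IsStationary P ψ₀ q e₀)
    (hq : ∀ i j, Integrable fun z => q z i j) (hQ : ∀ i j, Integrable (spec q i j))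
    (hψ : IsRandomSolution P m ψ₀ ψ) (t : ℝ) {f : E3 → ℂ} {R M : ℝ} (hf : Measurable f)
    (hM : ∀ x, ‖f x‖ ≤ M) (hR : ∀ x, x ∉ Metric.ball 0 R → f x = 0) : IsWeight P (ψ t) f := by
  set B := Metric.ball (0 : E3) R
  have hfB : f = B.indicator f := by
    funext x
    by_cases hx : x ∈ B
    · rw [Set.indicator_of_mem hx]
    · rw [Set.indicator_of_notMem hx, hR x hx]
  refine ⟨?_, ?_⟩
  · rw [hfB, integrable_indicator_iff Metric.isOpen_ball.measurableSet]
    exact Measure.integrableOn_of_bounded (measure_ball_lt_top).ne hf.aestronglyMeasurable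
      (ae_of_all _ hM)
  · have hi (i : RealIdx) : Integrable (fun p : Ω × E3 => realComp i (ψ t p.1 p.2) ^ 2 * ‖f p.2‖)
        (P.prod volume) := by
      have hma : AEMeasurable (fun p : Ω × E3 => realComp i (ψ t p.1 p.2) ^ 2 * ‖f p.2‖)
          (P.prod volume) :=
        ((aemeasurable_realComp (hψ.random t) i).pow_const 2).mul
          (hf.norm.comp measurable_snd).aemeasurable
      refine ⟨hma.aestronglyMeasurable, ?_⟩
      rw [hasFiniteIntegral_iff_enorm, lintegral_prod _ hma.enorm]
      have hle (ω : Ω) : ∫⁻ x, ‖realComp i (ψ t ω x) ^ 2 * ‖f x‖‖ₑ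
          ≤ ENNReal.ofReal M * ∫⁻ x in B, ‖realComp i (ψ t ω x)‖ₑ ^ 2 := by
        rw [← lintegral_const_mul' _ _ ENNReal.ofReal_ne_top,
          ← lintegral_indicator Metric.isOpen_ball.measurableSet]
        refine lintegral_mono fun x => ?_
        by_cases hx : x ∈ B
        · rw [Set.indicator_of_mem hx, enorm_mul, enorm_pow, mul_comm, enorm_norm]
          gcongr
          rw [← ofReal_norm]
          exact ENNReal.ofReal_le_ofReal (hM x)
        · rw [hR x hx]; simp
      refine (lintegral_mono hle).trans_lt ?_
      rw [lintegral_const_mul' _ _ ENNReal.ofReal_ne_top]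
      exact ENNReal.mul_lt_top ENNReal.ofReal_lt_top
        (lintegral_sq_ball_lt_top hm h hq hQ hψ t i R)
    have := integrable_finsetSum Finset.univ fun i _ => hi i
    refine this.congr (ae_of_all _ fun p => ?_)
    simp only [norm_sq_eq_sum_realComp, Finset.sum_mul]

end

/-! ### Kernels are determined by their action on products of test functions -/

section Kernel

variable {H : E3 × E3 → ℝ}

lemma integrable_mul_indicator_mul (hH : LocallyIntegrable H) {g : E3 → ℝ} (hg : Continuous g)
    (hc : HasCompactSupport g) (ρ : ℝ) :
    Integrable fun p : E3 × E3 => (Metric.closedBall 0 ρ).indicator (fun _ => H p * g p.2) p.1 := by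
  obtain ⟨C, hC⟩ := hg.bounded_above_of_compact_support hc
  have hK : IsCompact (Metric.closedBall (0 : E3) ρ ×ˢ tsupport g) :=
    (isCompact_closedBall 0 ρ).prod hc
  have h1 : Integrable ((Metric.closedBall (0 : E3) ρ ×ˢ tsupport g).indicator H) :=
    (hH.integrableOn_isCompact hK).integrable_indicator hK.measurableSet
  refine (h1.mul_bdd (c := C) (hg.comp continuous_snd).aestronglyMeasurable
    (ae_of_all _ fun p => hC p.2)).congr (ae_of_all _ fun p => ?_)
  by_cases hp1 : p.1 ∈ Metric.closedBall (0 : E3) ρ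
  · by_cases hp2 : p.2 ∈ tsupport g
    · simp only [Set.indicator_of_mem hp1, Function.comp]
      rw [Set.indicator_of_mem (Set.mk_mem_prod hp1 hp2)]
    · simp [hp1, image_eq_zero_of_notMem_tsupport hp2]
  · have hp : p ∉ Metric.closedBall (0 : E3) ρ ×ˢ tsupport g := fun h => hp1 h.1
    simp only [Set.indicator_of_notMem hp1, Set.indicator_of_notMem hp, zero_mul]

lemma locallyIntegrable_partial (hH : LocallyIntegrable H) {g : E3 → ℝ} (hg : Continuous g)
    (hc : HasCompactSupport g) : LocallyIntegrable fun x => ∫ y, H (x, y) * g y := by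
  intro x
  refine ⟨Metric.closedBall 0 (‖x‖ + 1), Filter.mem_of_superset
    (Metric.isOpen_ball.mem_nhds (by simp)) (Metric.ball_subset_closedBall (x := (0 : E3))), ?_⟩
  rw [← integrable_indicator_iff Metric.isClosed_closedBall.measurableSet]
  refine (integrable_mul_indicator_mul hH hg hc (‖x‖ + 1)).integral_prod_left.congr
    (ae_of_all _ fun x' => ?_)
  by_cases hx : x' ∈ Metric.closedBall (0 : E3) (‖x‖ + 1)
  · simp only [Set.indicator_of_mem hx]
  · simp only [Set.indicator_of_notMem hx, integral_zero]

lemma ae_locallyIntegrable (hH : LocallyIntegrable H) :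
    ∀ᵐ x : E3, LocallyIntegrable fun y => H (x, y) := by
  have h (n : ℕ) : ∀ᵐ x : E3, x ∈ Metric.closedBall (0 : E3) n →
      IntegrableOn (fun y => H (x, y)) (Metric.closedBall 0 n) := by
    have hK : IsCompact (Metric.closedBall (0 : E3) n ×ˢ Metric.closedBall (0 : E3) n) :=
      (isCompact_closedBall 0 _).prod (isCompact_closedBall 0 _)
    have h1 : Integrable ((Metric.closedBall (0 : E3) n ×ˢ Metric.closedBall (0 : E3) n).indicator H)
        ((volume : Measure E3).prod volume) :=
      (hH.integrableOn_isCompact hK).integrable_indicator hK.measurableSet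
    filter_upwards [h1.prod_right_ae] with x hx hmem
    rw [← integrable_indicator_iff Metric.isClosed_closedBall.measurableSet]
    refine hx.congr (ae_of_all _ fun y => ?_)
    beta_reduce
    by_cases hy : y ∈ Metric.closedBall (0 : E3) n
    · rw [Set.indicator_of_mem hy, Set.indicator_of_mem (Set.mk_mem_prod hmem hy)]
    · rw [Set.indicator_of_notMem hy, Set.indicator_of_notMem fun h : (x, y) ∈ _ => hy h.2]
  filter_upwards [ae_all_iff.2 h] with x hx y
  obtain ⟨n, hn⟩ := exists_nat_gt (max ‖x‖ ‖y‖)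
  refine ⟨Metric.closedBall 0 n, Filter.mem_of_superset (Metric.isOpen_ball.mem_nhds ?_)
    (Metric.ball_subset_closedBall (x := (0 : E3))), hx n ?_⟩
  · simpa using (le_max_right _ _).trans_lt hn
  · simpa using ((le_max_left _ _).trans_lt hn).le

/-- For fixed `g` the partial integral against `g` is orthogonal to all test functions of `x`, hence
vanishes a.e. For almost every `x` the slice is then annihilated by enough mollifiers to vanish a.e.
itself. -/
theorem ae_eq_zero_of_integral_mul_mul (hH : LocallyIntegrable H)
    (h0 : ∀ f g : E3 → ℝ, ContDiff ℝ ((⊤ : ℕ∞) : WithTop ℕ∞) f → HasCompactSupport f →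
      ContDiff ℝ ((⊤ : ℕ∞) : WithTop ℕ∞) g → HasCompactSupport g →
      ∫ p : E3 × E3, H p * (f p.1 * g p.2) = 0) : ∀ᵐ p, H p = 0 := by
  have hpart (g : E3 → ℝ) (hg : ContDiff ℝ ((⊤ : ℕ∞) : WithTop ℕ∞) g) (hgc : HasCompactSupport g) :
      ∀ᵐ x, ∫ y, H (x, y) * g y = 0 := by
    refine ae_eq_zero_of_integral_contDiff_smul_eq_zero
      (locallyIntegrable_partial hH hg.continuous hgc) fun f hf hfc => ?_
    have hint : Integrable (fun p : E3 × E3 => H p * (f p.1 * g p.2))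
        ((volume : Measure E3).prod volume) := by
      have hc : HasCompactSupport fun p : E3 × E3 => f p.1 * g p.2 := by
        refine HasCompactSupport.intro (hfc.prod hgc) fun p hp => ?_
        by_cases hp1 : p.1 ∈ tsupport f
        · rw [image_eq_zero_of_notMem_tsupport fun h => hp ⟨hp1, h⟩, mul_zero]
        · rw [image_eq_zero_of_notMem_tsupport hp1, zero_mul]
      have := hH.integrable_smul_right_of_hasCompactSupport
        (g := fun p : E3 × E3 => f p.1 * g p.2)
        ((hf.continuous.comp continuous_fst).mul (hg.continuous.comp continuous_snd)) hc
      simp only [smul_eq_mul] at this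
      exact this
    rw [← h0 f g hf hfc hg hgc, Measure.volume_eq_prod, integral_prod _ hint]
    refine integral_congr_ae (ae_of_all _ fun x => ?_)
    simp only [smul_eq_mul, ← integral_const_mul]
    exact integral_congr_ae (ae_of_all _ fun y => by ring)
  -- The exceptional null set depends on `g`, so only countably many `g` are used: mollifiers
  -- centred at a dense sequence. Continuity of the mollified slice reaches the remaining centres.
  have hall : ∀ᵐ x : E3, ∀ n k : ℕ,
      ∫ y, H (x, y) * mollAt n (TopologicalSpace.denseSeq E3 k) y = 0 :=
    ae_all_iff.2 fun n => ae_all_iff.2 fun k =>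
      hpart _ (contDiff_mollAt n _) (hasCompactSupport_mollAt n _)
  have hae : ∀ᵐ x : E3, ∀ᵐ y : E3, H (x, y) = 0 := by
    filter_upwards [hall, ae_locallyIntegrable hH] with x hx hloc
    have hmz (n : ℕ) : mollify n (fun y => H (x, y)) = fun _ => 0 := by
      refine (continuous_mollify n hloc).ext_on (TopologicalSpace.denseRange_denseSeq E3)
        continuous_const ?_
      rintro _ ⟨k, rfl⟩
      rw [← integral_mollAt_mul, ← hx n k]
      simp only [mul_comm]
    filter_upwards [ae_tendsto_mollify hloc] with y hy
    simp only [hmz] at hy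
    exact tendsto_nhds_unique hy tendsto_const_nhds
  have hm : AEMeasurable (fun p => ‖H p‖ₑ) ((volume : Measure E3).prod volume) :=
    hH.aestronglyMeasurable.enorm
  have hz : ∫⁻ p : E3 × E3, ‖H p‖ₑ ∂((volume : Measure E3).prod volume) = 0 := by
    rw [lintegral_prod _ hm]
    refine (lintegral_congr_ae ?_).trans lintegral_zero
    filter_upwards [hae] with x hx
    refine (lintegral_congr_ae ?_).trans lintegral_zero
    filter_upwards [hx] with y hy
    rw [hy, enorm_zero]
  filter_upwards [(lintegral_eq_zero_iff' hm).1 hz] with p hp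
  simpa using hp

end Kernel

/-! ### Correlation functions of the evolved field -/

section

set_option linter.unusedSectionVars false

variable {Ω : Type*} [MeasurableSpace Ω] {P : Measure Ω} [IsProbabilityMeasure P]
  {q : E3 → Matrix RealIdx RealIdx ℝ} {e₀ : NNReal} {m : ℝ}

lemma continuous_fourierInv {g : E3 → ℂ} (hg : Integrable g) : Continuous (𝓕⁻ g) := by
  rw [Real.fourierInv_eq_fourier_comp_neg]
  exact continuous_fourier hg.comp_neg

lemma integral_fourierInv_sub_mul {h : E3 → ℂ} (hh : Integrable h) {f g : E3 → ℝ}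
    (hf : Integrable f) (hg : Integrable g) :
    Integrable (fun p : E3 × E3 => 𝓕⁻ h (p.1 - p.2) * ((f p.1 * g p.2 : ℝ) : ℂ)) ∧
    ∫ p : E3 × E3, 𝓕⁻ h (p.1 - p.2) * ((f p.1 * g p.2 : ℝ) : ℂ)
      = ∫ ξ, h ξ * (fourierR f (-ξ) * fourierR g ξ) := by
  have hint : Integrable fun p : E3 × E3 => 𝓕⁻ h (p.1 - p.2) * ((f p.1 : ℂ) * (g p.2 : ℂ)) := by
    refine (hf.ofReal.mul_prod hg.ofReal).bdd_mul
      ((continuous_fourierInv hh).comp (continuous_fst.sub continuous_snd)).aestronglyMeasurable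
      (ae_of_all _ fun p => norm_fourierInv_le h _)
  push_cast
  refine ⟨hint, ?_⟩
  rw [integral_sub_mul (q := 𝓕⁻ h) (f := fun x => (f x : ℂ)) (g := fun x => (g x : ℂ)) hint]
  exact integral_fourierInv_mul_crossCorr hh hf.ofReal hg.ofReal

/-- The correlation functions at time `t`, as complex functions. -/
def evolvedCorr (m : ℝ) (q : E3 → Matrix RealIdx RealIdx ℝ) (t : ℝ) (i j : RealIdx) : E3 → ℂ :=
  𝓕⁻ fun ξ => evolvedSpec m q t ξ i j

variable {ψ₀ : Ω → E3 → C4} {ψ : ℝ → Ω → E3 → C4}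

lemma isWeight_ball (hm : 0 < m) (h : IsStationary P ψ₀ q e₀)
    (hq : ∀ i j, Integrable fun z => q z i j) (hQ : ∀ i j, Integrable (spec q i j))
    (hψ : IsRandomSolution P m ψ₀ ψ) (t R : ℝ) :
    IsWeight P (ψ t) ((Metric.ball 0 R).indicator 1) := by
  refine isWeight_evolved hm h hq hQ hψ t (R := R) (M := 1)
    (measurable_one.indicator Metric.isOpen_ball.measurableSet) (fun x => ?_)
    fun x hx => Set.indicator_of_notMem hx _
  refine (norm_indicator_le_norm_self _ _).trans ?_
  simp

lemma locallyIntegrable_corrKernel (hm : 0 < m) (h : IsStationary P ψ₀ q e₀)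
    (hq : ∀ i j, Integrable fun z => q z i j) (hQ : ∀ i j, Integrable (spec q i j))
    (hψ : IsRandomSolution P m ψ₀ ψ) (t : ℝ) (i j : RealIdx) :
    LocallyIntegrable (corrKernel P (ψ t) i j) := by
  intro p
  obtain ⟨n, hn⟩ := exists_nat_gt (max ‖p.1‖ ‖p.2‖)
  set B := Metric.ball (0 : E3) n
  have hB : MeasurableSet (B ×ˢ B) :=
    Metric.isOpen_ball.measurableSet.prod Metric.isOpen_ball.measurableSet
  refine ⟨B ×ˢ B, (Metric.isOpen_ball.prod Metric.isOpen_ball).mem_nhds ⟨?_, ?_⟩, ?_⟩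
  · simpa [B] using (le_max_left _ _).trans_lt hn
  · simpa [B] using (le_max_right _ _).trans_lt hn
  have hw := isWeight_ball hm h hq hQ hψ t n
  rw [← integrable_indicator_iff hB]
  refine (integrable_corrKernel_mul (hψ.random t) hw hw i j).re.congr (ae_of_all _ fun x => ?_)
  by_cases hx : x ∈ B ×ˢ B
  · simp [Set.indicator_of_mem hx, Set.indicator_of_mem hx.1, Set.indicator_of_mem hx.2, B]
  · rw [Set.indicator_of_notMem hx]
    by_cases h1 : x.1 ∈ B
    · have h2 : x.2 ∉ B := fun h2 => hx ⟨h1, h2⟩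
      simp [Set.indicator_of_notMem h2, B]
    · simp [Set.indicator_of_notMem h1, B]

/-- Both integrals equal the evolved spectrum integrated against `f̂(-ξ) ĝ(ξ)`. -/
lemma integral_corrKernel_mul (hm : 0 < m) (h : IsStationary P ψ₀ q e₀)
    (hq : ∀ i j, Integrable fun z => q z i j) (hQ : ∀ i j, Integrable (spec q i j))
    (hψ : IsRandomSolution P m ψ₀ ψ) (t : ℝ) (i j : RealIdx) {f g : E3 → ℝ}
    (hf : ContDiff ℝ ((⊤ : ℕ∞) : WithTop ℕ∞) f) (hfc : HasCompactSupport f)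
    (hg : ContDiff ℝ ((⊤ : ℕ∞) : WithTop ℕ∞) g) (hgc : HasCompactSupport g) :
    Integrable (fun p : E3 × E3 => ((corrKernel P (ψ t) i j p * (f p.1 * g p.2) : ℝ) : ℂ)) ∧
    ∫ p : E3 × E3, ((corrKernel P (ψ t) i j p * (f p.1 * g p.2) : ℝ) : ℂ)
      = ∫ p : E3 × E3, evolvedCorr m q t i j (p.1 - p.2) * ((f p.1 * g p.2 : ℝ) : ℂ) := by
  have hw {f : E3 → ℝ} (hf : ContDiff ℝ ((⊤ : ℕ∞) : WithTop ℕ∞) f) (hfc : HasCompactSupport f) :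
      IsWeight P (ψ t) fun x => (f x : ℂ) := by
    obtain ⟨M, hM⟩ := hf.continuous.bounded_above_of_compact_support hfc
    obtain ⟨R, hR⟩ := hfc.isCompact.isBounded.subset_ball 0
    refine isWeight_evolved hm h hq hQ hψ t (R := R) (M := M)
      (Complex.continuous_ofReal.comp hf.continuous).measurable (fun x => by simpa using hM x)
      fun x hx => ?_
    rw [image_eq_zero_of_notMem_tsupport fun h => hx (hR h), Complex.ofReal_zero]
  refine ⟨?_, ?_⟩
  · have := integrable_corrKernel_mul (hψ.random t) (hw hf hfc) (hw hg hgc) i j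
    push_cast
    exact this
  have h1 := (integral_smeared_mul_smeared (hψ.random t) (hw hf hfc) (hw hg hgc) i j).2
  simp only [← ofReal_smear] at h1
  simp only [← Complex.ofReal_mul] at h1
  have h2 := integral_smear_evolved hm h hq hψ hf hfc hg hgc t i j
  have h3 := (integral_fourierInv_sub_mul (integrable_evolvedSpec hm hQ t i j)
    (hf.continuous.integrable_of_hasCompactSupport hfc)
    (hg.continuous.integrable_of_hasCompactSupport hgc)).2
  rw [evolvedCorr, h3, ← h2, ← integral_complex_ofReal, h1]
  rfl

/-- Real and imaginary parts are compared separately. Reality of `evolvedCorr` is read off from the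
expectations being real, so no symmetry of the spectrum is needed. -/
lemma ae_corrKernel_eq (hm : 0 < m) (h : IsStationary P ψ₀ q e₀)
    (hq : ∀ i j, Integrable fun z => q z i j) (hQ : ∀ i j, Integrable (spec q i j))
    (hψ : IsRandomSolution P m ψ₀ ψ) (t : ℝ) (i j : RealIdx) :
    (∀ᵐ p : E3 × E3, corrKernel P (ψ t) i j p = (evolvedCorr m q t i j (p.1 - p.2)).re) ∧
    ∀ᵐ p : E3 × E3, (evolvedCorr m q t i j (p.1 - p.2)).im = 0 := by
  have hc : Continuous fun p : E3 × E3 => evolvedCorr m q t i j (p.1 - p.2) :=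
    (continuous_fourierInv (integrable_evolvedSpec hm hQ t i j)).comp
      (continuous_fst.sub continuous_snd)
  have hint {f g : E3 → ℝ} (hf : ContDiff ℝ ((⊤ : ℕ∞) : WithTop ℕ∞) f) (hfc : HasCompactSupport f)
      (hg : ContDiff ℝ ((⊤ : ℕ∞) : WithTop ℕ∞) g) (hgc : HasCompactSupport g) :
      Integrable fun p : E3 × E3 => evolvedCorr m q t i j (p.1 - p.2) * ((f p.1 * g p.2 : ℝ) : ℂ) :=
    (integral_fourierInv_sub_mul (integrable_evolvedSpec hm hQ t i j)
      (hf.continuous.integrable_of_hasCompactSupport hfc)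
      (hg.continuous.integrable_of_hasCompactSupport hgc)).1
  constructor
  · have hre : Continuous fun p : E3 × E3 => (evolvedCorr m q t i j (p.1 - p.2)).re :=
      Complex.continuous_re.comp hc
    have := ae_eq_zero_of_integral_mul_mul
      (H := fun p => corrKernel P (ψ t) i j p - (evolvedCorr m q t i j (p.1 - p.2)).re)
      ((locallyIntegrable_corrKernel hm h hq hQ hψ t i j).sub hre.locallyIntegrable)
      fun f g hf hfc hg hgc => by
        obtain ⟨h1, h2⟩ := integral_corrKernel_mul hm h hq hQ hψ t i j hf hfc hg hgc
        have h3 := congrArg Complex.re h2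
        rw [← RCLike.re_to_complex, ← RCLike.re_to_complex, ← integral_re h1,
          ← integral_re (hint hf hfc hg hgc)] at h3
        simp only [RCLike.re_to_complex, Complex.ofReal_re, Complex.re_mul_ofReal] at h3
        simp only [sub_mul]
        rw [integral_sub, h3, sub_self]
        · simpa using h1.re
        · simpa using (hint hf hfc hg hgc).re
    filter_upwards [this] with p hp using sub_eq_zero.1 hp
  · have him : Continuous fun p : E3 × E3 => (evolvedCorr m q t i j (p.1 - p.2)).im :=
      Complex.continuous_im.comp hc
    refine ae_eq_zero_of_integral_mul_mul him.locallyIntegrable fun f g hf hfc hg hgc => ?_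
    obtain ⟨h1, h2⟩ := integral_corrKernel_mul hm h hq hQ hψ t i j hf hfc hg hgc
    have h3 := congrArg Complex.im h2
    rw [← RCLike.im_to_complex, ← RCLike.im_to_complex, ← integral_im h1,
      ← integral_im (hint hf hfc hg hgc)] at h3
    simp only [RCLike.im_to_complex, Complex.ofReal_im, Complex.im_mul_ofReal,
      integral_zero] at h3
    exact h3.symm

/-- Continuity upgrades the a.e. identity to every `z`, as required for convergence at every point.
-/
lemma evolvedCorr_im (hm : 0 < m) (h : IsStationary P ψ₀ q e₀)
    (hq : ∀ i j, Integrable fun z => q z i j) (hQ : ∀ i j, Integrable (spec q i j))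
    (hψ : IsRandomSolution P m ψ₀ ψ) (t : ℝ) (i j : RealIdx) (z : E3) :
    (evolvedCorr m q t i j z).im = 0 := by
  have h1 : ∀ᵐ z, (evolvedCorr m q t i j z).im = 0 :=
    ae_of_ae_sub (R := fun z => (evolvedCorr m q t i j z).im = 0)
      (ae_corrKernel_eq hm h hq hQ hψ t i j).2
  have hc : Continuous fun z => (evolvedCorr m q t i j z).im :=
    Complex.continuous_im.comp (continuous_fourierInv (integrable_evolvedSpec hm hQ t i j))
  exact congrFun ((hc.ae_eq_iff_eq volume continuous_const).1 h1) z

theorem hasCorrelation_evolved (hm : 0 < m) (h : IsStationary P ψ₀ q e₀)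
    (hq : ∀ i j, Integrable fun z => q z i j) (hQ : ∀ i j, Integrable (spec q i j))
    (hψ : IsRandomSolution P m ψ₀ ψ) (t : ℝ) :
    HasCorrelation P (ψ t) fun z => Matrix.of fun i j => (evolvedCorr m q t i j z).re := by
  intro i j
  filter_upwards [(ae_corrKernel_eq hm h hq hQ hψ t i j).1,
    ae_integrable_mul (hψ.random t) (isWeight_ball hm h hq hQ hψ t) i j] with p hp1 hp2
  exact ⟨hp2, hp1⟩

end

/-! ### Decay of oscillatory integrals -/

/-- The frequency is radial and strictly increasing in the radius, with inverse differentiable on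
`(m, ∞)`; differentiable images of null sets are null, and polar coordinates transfer this to `ℝ³`.
-/
lemma volume_preimage_freq {m : ℝ} (hm : 0 < m) {N : Set ℝ} (hN : MeasurableSet N)
    (h0 : volume N = 0) : volume (freq m ⁻¹' N) = 0 := by
  have hpi := Real.pi_pos
  set s : ℝ → ℝ := fun r => Real.sqrt ((2 * Real.pi * r) ^ 2 + m ^ 2) with hs
  have hsm : Measurable s := by fun_prop
  -- The endpoint `m`, where the inverse is not differentiable, is reached only at radius zero.
  set T : Set ℝ := N ∩ Set.Ioi m
  have hT : volume T = 0 := measure_mono_null Set.inter_subset_left h0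
  have himage : volume ((fun w => Real.sqrt (w ^ 2 - m ^ 2) / (2 * Real.pi)) '' T) = 0 := by
    refine addHaar_image_eq_zero_of_differentiableOn_of_addHaar_eq_zero volume (fun w hw => ?_) hT
    have hw' : m < w := hw.2
    have hne : w ^ 2 - m ^ 2 ≠ 0 := by nlinarith
    have hd : DifferentiableAt ℝ (fun w : ℝ => w ^ 2 - m ^ 2) w := by fun_prop
    exact ((hd.sqrt hne).div_const _).differentiableWithinAt
  have hae : ∀ᵐ r ∂(volume.restrict (Set.Ioi (0 : ℝ))), s r ∉ N := by
    rw [ae_restrict_iff' measurableSet_Ioi]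
    filter_upwards [measure_eq_zero_iff_ae_notMem.1 himage] with r hr hpos hmem
    rw [Set.mem_Ioi] at hpos
    refine hr ⟨s r, ⟨hmem, ?_⟩, ?_⟩
    · refine Real.lt_sqrt_of_sq_lt ?_
      have : 0 < 2 * Real.pi * r := by positivity
      nlinarith
    · simp only [hs]
      rw [Real.sq_sqrt (by positivity), add_sub_cancel_right, Real.sqrt_sq (by positivity)]
      field_simp
  -- The Gaussian makes the indicator integrable without changing where it vanishes.
  set f : ℝ → ℝ := fun r => N.indicator 1 (s r) * Real.exp (-1 * r ^ 2) with hf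
  have h1 : ∫ ξ : E3, f ‖ξ‖ = 0 := by
    rw [integral_fun_norm_addHaar volume f]
    have : ∫ y in Set.Ioi (0 : ℝ), y ^ (Module.finrank ℝ E3 - 1) • f y = 0 := by
      refine integral_eq_zero_of_ae ?_
      filter_upwards [hae] with r hr
      simp [hf, hr]
    rw [this]
    simp
  have hle (ξ : E3) : 0 ≤ f ‖ξ‖ :=
    mul_nonneg (Set.indicator_nonneg (fun _ _ => zero_le_one) _) (Real.exp_pos _).le
  have hint : Integrable fun ξ : E3 => f ‖ξ‖ := by
    refine (integrable_gauss one_pos).bdd_mul (c := 1) ?_ (ae_of_all _ fun ξ => ?_)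
    · exact ((measurable_one.indicator hN).comp (hsm.comp measurable_norm)).aestronglyMeasurable
    · exact (norm_indicator_le_norm_self _ _).trans (by simp)
  have h2 := (integral_eq_zero_iff_of_nonneg hle hint).1 h1
  rw [measure_eq_zero_iff_ae_notMem]
  filter_upwards [h2] with ξ hξ hmem
  have hmem' : s ‖ξ‖ ∈ N := hmem
  simp only [hf, Set.indicator_of_mem hmem', Pi.one_apply, one_mul, Pi.zero_apply] at hξ
  exact (Real.exp_pos _).ne' hξ

/-- The push-forward of `f dξ` under the frequency is a finite measure absolutely continuous on the
line, so the integral is the Fourier transform of its density and the one-dimensional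
Riemann–Lebesgue lemma applies. No stationary phase or smoothness of `f` enters. -/
lemma tendsto_integral_freq_of_nonneg {m : ℝ} (hm : 0 < m) {f : E3 → ℝ} (hf : Integrable f)
    (h0 : ∀ ξ, 0 ≤ f ξ) :
    Tendsto (fun w : ℝ => ∫ ξ, (Real.fourierChar (-(freq m ξ * w)) : ℂ) * (f ξ : ℂ))
      (cocompact ℝ) (𝓝 0) := by
  set ν : Measure E3 := volume.withDensity fun ξ => ENNReal.ofReal (f ξ) with hν
  have : IsFiniteMeasure ν := isFiniteMeasure_withDensity_ofReal hf.2
  have hfm : Measurable (freq m) := (continuous_freq m).measurable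
  set κ : Measure ℝ := ν.map (freq m) with hκ
  have hac : κ ≪ volume := by
    refine Measure.AbsolutelyContinuous.mk fun N hN h0 => ?_
    rw [hκ, Measure.map_apply hfm hN]
    exact withDensity_absolutelyContinuous _ _ (volume_preimage_freq hm hN h0)
  have h := Real.tendsto_integral_exp_smul_cocompact fun s : ℝ => ((κ.rnDeriv volume s).toReal : ℂ)
  refine h.congr fun w => ?_
  set g : ℝ → ℂ := fun s => (Real.fourierChar (-(s * w)) : ℂ) with hg
  have hgc : Continuous g := by fun_prop
  calc ∫ s : ℝ, Real.fourierChar (-(s * w)) • ((κ.rnDeriv volume s).toReal : ℂ)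
      = ∫ s, (κ.rnDeriv volume s).toReal • g s := by
        refine integral_congr_ae (ae_of_all _ fun s => ?_)
        simp only [Circle.smul_def, hg, Complex.real_smul, smul_eq_mul, mul_comm]
    _ = ∫ s, g s ∂κ := integral_rnDeriv_smul hac
    _ = ∫ ξ, g (freq m ξ) ∂ν := integral_map hfm.aemeasurable hgc.aestronglyMeasurable
    _ = ∫ ξ, (Real.fourierChar (-(freq m ξ * w)) : ℂ) * (f ξ : ℂ) := by
        rw [hν, integral_withDensity_eq_integral_toReal_smul₀
          hf.aestronglyMeasurable.aemeasurable.ennreal_ofReal (ae_of_all _ fun _ => ENNReal.ofReal_lt_top)]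
        refine integral_congr_ae (ae_of_all _ fun ξ => ?_)
        simp only [ENNReal.toReal_ofReal (h0 ξ), hg, Complex.real_smul, mul_comm]

lemma integrable_fourierChar_freq_mul (m w : ℝ) {F : E3 → ℂ} (hF : Integrable F) :
    Integrable fun ξ => (Real.fourierChar (-(freq m ξ * w)) : ℂ) * F ξ := by
  have := continuous_freq m
  exact hF.bdd_mul (c := 1) (by fun_prop : Continuous fun ξ : E3 =>
    (Real.fourierChar (-(freq m ξ * w)) : ℂ)).aestronglyMeasurable
    (ae_of_all _ fun ξ => (Circle.norm_coe _).le)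

lemma tendsto_integral_freq_of_real {m : ℝ} (hm : 0 < m) {f : E3 → ℝ} (hf : Integrable f) :
    Tendsto (fun w : ℝ => ∫ ξ, (Real.fourierChar (-(freq m ξ * w)) : ℂ) * (f ξ : ℂ))
      (cocompact ℝ) (𝓝 0) := by
  have h1 := tendsto_integral_freq_of_nonneg hm hf.pos_part fun ξ => le_max_right _ _
  have h2 := tendsto_integral_freq_of_nonneg hm hf.neg_part fun ξ => le_max_right _ _
  have h3 := h1.sub h2
  rw [sub_zero] at h3
  refine h3.congr fun w => ?_
  rw [← integral_sub (integrable_fourierChar_freq_mul m w (integrable_ofReal hf.pos_part))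
    (integrable_fourierChar_freq_mul m w (integrable_ofReal hf.neg_part))]
  refine integral_congr_ae (ae_of_all _ fun ξ => ?_)
  simp only
  rw [← mul_sub, ← Complex.ofReal_sub, max_zero_sub_max_neg_zero_eq_self]

/-- The Riemann–Lebesgue lemma with the phase function `freq m`. -/
theorem tendsto_integral_freq {m : ℝ} (hm : 0 < m) {F : E3 → ℂ} (hF : Integrable F) :
    Tendsto (fun w : ℝ => ∫ ξ, (Real.fourierChar (-(freq m ξ * w)) : ℂ) * F ξ)
      (cocompact ℝ) (𝓝 0) := by
  have h3 := (tendsto_integral_freq_of_real hm hF.re).add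
    ((tendsto_integral_freq_of_real hm hF.im).const_mul Complex.I)
  rw [mul_zero, add_zero] at h3
  refine h3.congr fun w => ?_
  rw [← integral_const_mul, ← integral_add
    (integrable_fourierChar_freq_mul m w (integrable_ofReal hF.re))
    ((integrable_fourierChar_freq_mul m w (integrable_ofReal hF.im)).const_mul _)]
  refine integral_congr_ae (ae_of_all _ fun ξ => ?_)
  simp only [RCLike.re_to_complex, RCLike.im_to_complex]
  linear_combination (Real.fourierChar (-(freq m ξ * w)) : ℂ) * Complex.re_add_im (F ξ)

/-- The choice `w = t/π` compensates the `2π` of the standard character and yields the doubled phase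
`2ωt`. -/
lemma exp_phase (m t : ℝ) (ξ : E3) :
    (Real.fourierChar (-(freq m ξ * (t / Real.pi))) : ℂ)
      = Complex.exp (-(((2 * t * freq m ξ : ℝ) : ℂ) * Complex.I)) := by
  have := Complex.ofReal_ne_zero.2 Real.pi_ne_zero
  rw [Real.fourierChar_apply]
  congr 1
  push_cast
  field_simp

lemma tendsto_integral_phase {m : ℝ} (hm : 0 < m) {F : E3 → ℂ} (hF : Integrable F) :
    Tendsto (fun t : ℝ => ∫ ξ, (Real.cos (2 * t * freq m ξ) : ℂ) * F ξ) atTop (𝓝 0) ∧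
    Tendsto (fun t : ℝ => ∫ ξ, (Real.sin (2 * t * freq m ξ) : ℂ) * F ξ) atTop (𝓝 0) := by
  have hpi := Real.pi_pos
  have hmain := tendsto_integral_freq hm hF
  have t1 : Tendsto (fun t : ℝ => t / Real.pi) atTop (cocompact ℝ) :=
    (tendsto_id.atTop_div_const hpi).mono_right atTop_le_cocompact
  have t2 : Tendsto (fun t : ℝ => -t / Real.pi) atTop (cocompact ℝ) :=
    (tendsto_neg_atTop_atBot.atBot_div_const hpi).mono_right atBot_le_cocompact
  have a1 := hmain.comp t1
  have a2 := hmain.comp t2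
  simp only [Function.comp_def] at a1 a2
  have i1 (t : ℝ) := integrable_fourierChar_freq_mul m (t / Real.pi) hF
  constructor
  · have h := (a2.add a1).const_mul (1 / 2 : ℂ)
    rw [add_zero, mul_zero] at h
    refine h.congr fun t => ?_
    rw [← integral_add (i1 (-t)) (i1 t), ← integral_const_mul]
    refine integral_congr_ae (ae_of_all _ fun ξ => ?_)
    simp only [exp_phase, Complex.ofReal_cos, Complex.cos]
    push_cast
    ring_nf
  · have h := (a2.sub a1).const_mul (-Complex.I / 2 : ℂ)
    rw [sub_zero, mul_zero] at h
    refine h.congr fun t => ?_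
    rw [← integral_sub (i1 (-t)) (i1 t), ← integral_const_mul]
    refine integral_congr_ae (ae_of_all _ fun ξ => ?_)
    simp only [exp_phase, Complex.ofReal_sin, Complex.sin]
    push_cast
    ring_nf

/-! ### Convergence of the correlation functions -/

/-- For fixed `z` the character `e^{2πi⟨ξ,z⟩}` is absorbed into the integrable amplitudes, so the
only dependence on time is through `cos 2ωt` and `sin 2ωt`. -/
lemma tendsto_evolvedCorr {m : ℝ} (hm : 0 < m) {q : E3 → Matrix RealIdx RealIdx ℝ}
    (hQ : ∀ i j, Integrable (spec q i j)) (i j : RealIdx) (z : E3) :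
    Tendsto (fun t => evolvedCorr m q t i j z) atTop (𝓝 (limitCorrelation m q z i j)) := by
  have hL := integrable_fourierChar_smul (integrable_limSpec hm hQ i j) z
  have hC := integrable_fourierChar_smul (integrable_cosSpec hm hQ i j) z
  have hS := integrable_fourierChar_smul (integrable_sinSpec hm hQ i j) z
  have h := ((tendsto_const_nhds (x := limitCorrelation m q z i j)).add
    (tendsto_integral_phase hm hC).1).add (tendsto_integral_phase hm hS).2
  rw [add_zero, add_zero] at h
  have hcf := continuous_freq m
  refine h.congr fun t => ?_
  have hC' : Integrable fun ξ => (Real.cos (2 * t * freq m ξ) : ℂ) *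
      (Real.fourierChar (inner ℝ ξ z : ℝ) • cosSpec m q ξ i j) :=
    hC.bdd_mul (c := 1) (by fun_prop : Continuous fun ξ : E3 =>
      (Real.cos (2 * t * freq m ξ) : ℂ)).aestronglyMeasurable (ae_of_all _ fun ξ => by
        rw [Complex.norm_real]; exact Real.abs_cos_le_one _)
  have hS' : Integrable fun ξ => (Real.sin (2 * t * freq m ξ) : ℂ) *
      (Real.fourierChar (inner ℝ ξ z : ℝ) • sinSpec m q ξ i j) :=
    hS.bdd_mul (c := 1) (by fun_prop : Continuous fun ξ : E3 =>
      (Real.sin (2 * t * freq m ξ) : ℂ)).aestronglyMeasurable (ae_of_all _ fun ξ => by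
        rw [Complex.norm_real]; exact Real.abs_sin_le_one _)
  rw [limitCorrelation_eq hm, evolvedCorr, Real.fourierInv_eq, Real.fourierInv_eq,
    ← integral_add hL hC']
  refine (integral_add (hL.add hC') hS').symm.trans ?_
  refine integral_congr_ae (ae_of_all _ fun ξ => ?_)
  simp only [Pi.add_apply, evolvedSpec_eq, Matrix.add_apply, Matrix.smul_apply, smul_eq_mul, Circle.smul_def]
  ring

end DiracField

end

/-! ### The proposition -/

open DiracField in
theorem proposition4p1 {Ω : Type*} [MeasurableSpace Ω] (P : Measure Ω) [IsProbabilityMeasure P]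
    (m : ℝ) (hm : 0 < m)
    (ψ₀ : Ω → E3 → C4) (hψ₀ : IsRandomFunction P ψ₀)
    (q₀ : E3 → Matrix RealIdx RealIdx ℝ)
    (hS0 : HasZeroMean P ψ₀)
    (hS1 : HasCorrelation P ψ₀ q₀)
    (hS2 : HasFiniteDensity P ψ₀)
    (hS3 : IsStronglyMixing P ψ₀)
    (ψ : ℝ → Ω → E3 → C4) (hψ : IsRandomSolution P m ψ₀ ψ) :
    (∀ i j, Integrable (fun z => q₀ z i j)) ∧
    (∀ i j, Integrable (fun k => fourierMat q₀ k i j)) ∧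
    (∀ i j, Integrable (fun k => limitSpectrum m q₀ k i j)) ∧
    ∃ q : ℝ → E3 → Matrix RealIdx RealIdx ℝ,
      (∀ t, HasCorrelation P (ψ t) (q t) ∧ ∀ i j, Continuous (fun z => q t z i j)) ∧
      ∀ (i j : RealIdx) (z : E3),
        Tendsto (fun t => ((q t z i j : ℝ) : ℂ)) atTop (𝓝 (limitCorrelation m q₀ z i j)) := by
  obtain ⟨e₀, he₀⟩ := hS2
  have h : IsStationary P ψ₀ q₀ e₀ := ⟨hψ₀, hS1, he₀⟩
  have hq := h.integrable_of_mixing hS0 hS3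
  have hQ := h.integrable_spec hq
  refine ⟨hq, integrable_fourierMat hQ, integrable_limitSpectrum hm hQ,
    fun t z => Matrix.of fun i j => (evolvedCorr m q₀ t i j z).re, fun t => ⟨?_, fun i j => ?_⟩,
    fun i j z => ?_⟩
  · exact hasCorrelation_evolved hm h hq hQ hψ t
  · exact Complex.continuous_re.comp (continuous_fourierInv (integrable_evolvedSpec hm hQ t i j))
  · refine (tendsto_evolvedCorr hm hQ i j z).congr fun t => ?_
    exact Complex.ext rfl (evolvedCorr_im hm h hq hQ hψ t i j z)
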